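/- **Setting.** Put two fermionic modes $c_{i\uparrow},c_{i\downarrow}$ on each site $i$ of a periodic chain. Let $d_H\ge 0$ be an integer (the range) and let $h$ be a self-adjoint polynomial in the operators $c_{i\sigma},c_{i\sigma}^\dagger$ on the $d_H+1$ sites $1,\dots,d_H+1$, all of whose monomials have an even number of factors. On the periodic chain of $L\ge d_H+1$ sites let $H^{(L)}=\sum_{i=1}^{L}\mathcal T^{\,i-1}(h)$, where $\mathcal T(c_{i\sigma})=c_{i+1,\sigma}$ and $L+1\equiv 1$, and $U^{(L)}(\tau)=e^{-iH^{(L)}\tau}$ (nearest-neighbour interactions are $d_H=1$). A brick-wall ansatz of depth $d$ is given by families $V^{(k)}_{1,2}(\theta)$, $1\le k\le d$, $\theta\in\mathbb R$, of unitary even polynomials in the fermion operators of sites $1,2$. For even $L$ and $\vec\theta\in\mathbb R^{2d}$, $$V^{(L)}(\vec\theta)=\prod_{k=1}^{d}\Big[\prod_{i=1}^{L/2}V^{(k)}_{2i,2i+1}(\theta_{2k})\prod_{i=1}^{L/2}V^{(k)}_{2i-1,2i}(\theta_{2k-1})\Big],\qquad V^{(k)}_{i,i+1}=\mathcal T^{\,i-1}(V^{(k)}_{1,2}).$$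 For parity-preserving unitaries $U,V$ on the Fock space of $M$ modes let $C_{\rm HST}(U,V)=1-4^{-M}|\mathrm{Tr}(UV^\dagger)|^2$ and $C_{\rm LHST}(U,V)=\frac1M\sum_{\mu=1}^{M}\big(1-\|\langle\Phi_{+,\mu}|(U\otimes V^*)|\Phi_+\rangle\|^2\big)$. Here $|\Phi_{+,\mu}\rangle=\frac1{\sqrt2}(1+c_{A_\mu}^\dagger c_{B_\mu}^\dagger)|\mathrm{vac}\rangle$ is the fermion Bell pair of the $\mu$-th modes of two copies $A,B$ of the system, $|\Phi_+\rangle$ is the product of all these pairs, $V^*$ is the entrywise complex conjugate in the occupation basis, and the phase of the modes of $B$ is chosen ($c_{B_\mu}=-i\,(-1)^{N_A}\otimes c_\mu$) so that $|\langle\Phi_+|U\otimes V^*|\Phi_+\rangle|^2=4^{-M}|\mathrm{Tr}(UV^\dagger)|^2$. Say that $h$ satisfies the Lieb–Robinson (LR) bound with coefficient $C(\tau)$, velocity $v\ge 0$ and length $\xi>0$ if, for all $L\ge d_H+1$, all nonempty sets $X,Y$ of consecutive sites of the periodic chain, all $O_X,O_Y$ of operator norm $1$ in the algebras generated by products of two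 fermion operators on $X$ and on $Y$ respectively, and all $\tau\ge 0$, $$\big\|[e^{iH^{(L)}\tau}O_Xe^{-iH^{(L)}\tau},O_Y]\big\|\le C(\tau)\,e^{-[\mathrm{dist}(X,Y)-v\tau]/\xi}.$$ **Theorem.** (i) There are constants $C,v,\xi$, depending only on $h$, such that $h$ satisfies the LR bound with the constant coefficient $C$, velocity $v$ and length $\xi$. (ii) Let $h$ satisfy the LR bound with coefficient $C(\cdot)$, velocity $v$ and length $\xi$, and fix $\tau\ge0$. Then there is a constant $K>0$, depending only on $h,C(\cdot),v,\xi,\tau$, such that the following holds with $$\varepsilon_{\rm LR}=K\,e^{-l_0/\xi}$$ for every real $l_0\ge 0$, every $d\ge0$, every brick-wall ansatz of depth $d$, every $\vec\theta_{\rm opt}\in\mathbb R^{2d}$ and all even $\tilde L\le L$ with $$\tilde L\ \ge\ l_0+d_H+v\tau+2d+1 .$$ - If $\varepsilon_{\rm LHST}>0$ and $C_{\rm LHST}(U^{(\tilde L)}(\tau),V^{(\tilde L)}(\vec\theta_{\rm opt}))<\varepsilon_{\rm LHST}$, then $C_{\rm LHST}(U^{(L)}(\tau),V^{(L)}(\vec\theta_{\rm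 opt}))\le\varepsilon_{\rm LHST}+4\varepsilon_{\rm LR}$. - If $\varepsilon_{\rm HST}>0$ and $C_{\rm HST}(U^{(\tilde L)}(\tau),V^{(\tilde L)}(\vec\theta_{\rm opt}))<\varepsilon_{\rm HST}$, then $C_{\rm HST}(U^{(L)}(\tau),V^{(L)}(\vec\theta_{\rm opt}))\le 2L(\varepsilon_{\rm HST}+4\varepsilon_{\rm LR})$. -/

import Mathlib

open scoped Matrix Kronecker

noncomputable section

namespace LVQC

/-! ### Fermionic Fock space -/

/-- Linear operators on the Fock space of the fermionic modes `ι`, as matrices in the occupation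
basis. A basis vector is labelled by the finite set `s` of occupied modes and stands for
`∏_{μ ∈ s} c_μ† |vac⟩`, the factors being in increasing order from left to right. -/
abbrev FockOp (ι : Type*) : Type _ := Matrix (Finset ι) (Finset ι) ℂ

section Fock

variable {ι : Type*} [Fintype ι] [LinearOrder ι]

/-- The annihilation operator `c_μ`. -/
def annihilate (μ : ι) : FockOp ι :=
  Matrix.of fun s t =>
    if μ ∈ t ∧ s = t.erase μ then (-1 : ℂ) ^ (t.filter (· < μ)).card else 0

/-- The creation operator `c_μ†`. -/
def create (μ : ι) : FockOp ι := (annihilate μ)ᴴ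

/-- The fermion parity operator `(-1)^N`. -/
def parity (ι : Type*) [LinearOrder ι] : FockOp ι :=
  Matrix.diagonal fun s => (-1 : ℂ) ^ s.card

/-! ### The doubled system and the two cost functions -/

/-- Linear operators on the doubled space `ℍ_A ⊗ ℍ_B` of two copies of the Fock space. -/
abbrev DoubledOp (ι : Type*) : Type _ :=
  Matrix (Finset ι × Finset ι) (Finset ι × Finset ι) ℂ

/-- The annihilation operator of the mode `μ` of system `A`. -/
def annA (μ : ι) : DoubledOp ι := annihilate μ ⊗ₖ (1 : FockOp ι)

/-- The annihilation operator of the mode `μ` of system `B`. The factor `(-1)^{N_A}` makes it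
anticommute with the operators of system `A`. The phase `-i` is a choice of phase for the modes
of `B`; with it the Bell pair state is `2^{-M/2} ∑_s i^{|s| mod 2} |s⟩ ⊗ |s⟩`, so that
`⟨Φ₊|U ⊗ V*|Φ₊⟩ = 2^{-M} Tr(U V†)` for all parity preserving `U`, `V`, including those which do
not conserve the number of particles. -/
def annB (μ : ι) : DoubledOp ι := (-Complex.I) • (parity ι ⊗ₖ annihilate μ)

/-- The vacuum of the doubled system. -/
def doubledVac : Finset ι × Finset ι → ℂ := Pi.single (∅, ∅) 1

/-- The operator `(1 + c_{Aμ}† c_{Bμ}†) / √2`, which turns the vacuum of the two modes `A_μ`, `B_μ`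
into the fermion Bell pair `|Φ_{+,μ}⟩`. -/
def bellCreate (μ : ι) : DoubledOp ι :=
  ((Real.sqrt 2 : ℂ)⁻¹) • (1 + (annA μ)ᴴ * (annB μ)ᴴ)

/-- The product `|Φ₊⟩` of the fermion Bell pairs of all the modes. -/
def bellState (ι : Type*) [Fintype ι] [LinearOrder ι] : Finset ι × Finset ι → ℂ :=
  (((Finset.univ : Finset ι).sort (· ≤ ·)).map bellCreate).prod *ᵥ doubledVac

/-- The projection `Π_μ = |Φ_{+,μ}⟩⟨Φ_{+,μ}|` onto the fermion Bell pair of the modes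
`A_μ`, `B_μ` (it is the identity on the other modes). -/
def bellProj (μ : ι) : DoubledOp ι :=
  (1 / 2 : ℂ) •
    ((1 - (annA μ)ᴴ * annA μ) * (1 - (annB μ)ᴴ * annB μ) + (annA μ)ᴴ * (annB μ)ᴴ
      + annB μ * annA μ + ((annA μ)ᴴ * annA μ) * ((annB μ)ᴴ * annB μ))

/-- The vector `(U ⊗ V*) |Φ₊⟩`, where `V*` is the entrywise complex conjugate. -/
def testState (U V : FockOp ι) : Finset ι × Finset ι → ℂ :=
  (U ⊗ₖ V.map (starRingEnd ℂ)) *ᵥ bellState ι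

/-- The Hilbert-Schmidt test cost function `1 - |Tr(U V†)|² / 4^M`. -/
def costHST (U V : FockOp ι) : ℝ :=
  1 - ‖(U * Vᴴ).trace‖ ^ 2 / 4 ^ Fintype.card ι

/-- The cost `1 - |⟨Φ_{+,μ}| (U ⊗ V*) |Φ₊⟩|²` of the mode `μ`. The partial overlap with `Φ_{+,μ}` is a
vector of the remaining modes; its squared norm is the expectation value of `Π_μ`. -/
def costLHSTMode (μ : ι) (U V : FockOp ι) : ℝ :=
  1 - (star (testState U V) ⬝ᵥ (bellProj μ *ᵥ testState U V)).re

/-- The local Hilbert-Schmidt test cost function: the average over the modes. -/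
def costLHST (U V : FockOp ι) : ℝ :=
  (1 / (Fintype.card ι : ℝ)) * ∑ μ : ι, costLHSTMode μ U V

end Fock

/-! ### The periodic chain of spinful fermions -/

/-- The modes `(i, σ)` of the chain of `L` sites (numbered from `0`), `σ` being one of two spin
values. -/
abbrev Mode (L : ℕ) : Type := Fin L ×ₗ Fin 2

/-- The site `i + k` of the periodic chain. -/
def shift {L : ℕ} (i : Fin L) (k : ℕ) : Fin L := ⟨(i.val + k) % L, Nat.mod_lt _ i.pos⟩

/-- Formal polynomials in the operators `c_{kσ}` and `c_{kσ}†` on `n` consecutive sites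
`k = 0, …, n-1`. The generator `(k, σ, false)` is `c_{kσ}` and `(k, σ, true)` is `c_{kσ}†`. -/
abbrev FPoly (n : ℕ) : Type := FreeAlgebra ℂ (Fin n × Fin 2 × Bool)

/-- The polynomials all of whose monomials have an even number of factors. -/
def evenPoly (n : ℕ) : Subalgebra ℂ (FPoly n) :=
  Algebra.adjoin ℂ {x | ∃ a b, x = FreeAlgebra.ι ℂ a * FreeAlgebra.ι ℂ b}

/-- The operator on the periodic chain of `L` sites obtained from a polynomial on `n` sites by putting
these at `i, i+1, …, i+n-1`, that is by substituting `c_{i+k,σ}` for `c_{kσ}`. So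
`place i x` is the translate by `i` sites of the operator `place 0 x`. -/
def place {L n : ℕ} (i : Fin L) : FPoly n →ₐ[ℂ] FockOp (Mode L) :=
  FreeAlgebra.lift ℂ fun g =>
    if g.2.2 then create (toLex (shift i g.1.val, g.2.1))
    else annihilate (toLex (shift i g.1.val, g.2.1))

/-- The translation invariant Hamiltonian of the periodic chain of `L` sites with local term `h`. -/
def hamiltonian {n : ℕ} (h : FPoly n) (L : ℕ) : FockOp (Mode L) := ∑ i : Fin L, place i h

/-- The time evolution operator `e^{-iHτ}`. -/
def evolve {n : ℕ} (h : FPoly n) (L : ℕ) (τ : ℝ) : FockOp (Mode L) :=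
  NormedSpace.exp ((-Complex.I * (τ : ℂ)) • hamiltonian h L)

/-- Self-adjointness of the operator given by a polynomial on `n` sites. -/
def IsSelfAdjointPoly {n : ℕ} (x : FPoly (n + 1)) : Prop :=
  (place (0 : Fin (n + 1)) x).IsHermitian

/-- Unitarity of the operator given by a polynomial on `n` sites. -/
def IsUnitaryPoly {n : ℕ} (x : FPoly (n + 1)) : Prop :=
  place (0 : Fin (n + 1)) x ∈ unitary (FockOp (Mode (n + 1)))

/-- The translates of a two-site gate `g` on the bonds `(0,1), (2,3), …`. -/
def layerA (g : FPoly 2) (L : ℕ) : FockOp (Mode L) :=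
  (List.ofFn fun i : Fin (L / 2) =>
    place (⟨2 * i.val, by have := i.isLt; omega⟩ : Fin L) g).prod

/-- The translates of a two-site gate `g` on the bonds `(1,2), (3,4), …, (L-1,0)`. -/
def layerB (g : FPoly 2) (L : ℕ) : FockOp (Mode L) :=
  (List.ofFn fun i : Fin (L / 2) =>
    place (⟨2 * i.val + 1, by have := i.isLt; omega⟩ : Fin L) g).prod

/-- The brick-wall ansatz of depth `d` on the periodic chain of `L` sites. The gate family `G k`
depends on one real parameter; the `k`-th step uses the parameter `θ_{2k}` on the bonds `(0,1), …`
and the parameter `θ_{2k+1}` on the bonds `(1,2), …`. -/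
def ansatz {d : ℕ} (G : Fin d → ℝ → FPoly 2) (θ : Fin (2 * d) → ℝ) (L : ℕ) : FockOp (Mode L) :=
  (List.ofFn fun k : Fin d =>
    layerB (G k (θ ⟨2 * k.val + 1, by have := k.isLt; omega⟩)) L *
      layerA (G k (θ ⟨2 * k.val, by have := k.isLt; omega⟩)) L).prod

/-! ### The Lieb-Robinson bound -/

/-- The distance of two sites on the periodic chain. -/
def siteDist {L : ℕ} (x y : Fin L) : ℕ :=
  min ((x.val + (L - y.val)) % L) ((y.val + (L - x.val)) % L)

/-- The distance of two nonempty sets of sites. -/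
def setDist {L : ℕ} (X Y : Set (Fin L)) : ℕ :=
  sInf {n | ∃ x ∈ X, ∃ y ∈ Y, n = siteDist x y}

/-- A domain of the periodic chain: a nonempty set of consecutive sites. -/
def IsDomain {L : ℕ} (X : Set (Fin L)) : Prop :=
  ∃ (a : Fin L) (n : ℕ), X = {x | ∃ k ≤ n, x = shift a k}

/-- The algebra generated by the products of two of the operators `c_{iσ}`, `c_{iσ}†` with `i ∈ X`. -/
def evenOn {L : ℕ} (X : Set (Fin L)) : Subalgebra ℂ (FockOp (Mode L)) :=
  Algebra.adjoin ℂ {x | ∃ a b : FockOp (Mode L),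
    (∃ i ∈ X, ∃ σ, a = annihilate (toLex (i, σ)) ∨ a = create (toLex (i, σ))) ∧
    (∃ i ∈ X, ∃ σ, b = annihilate (toLex (i, σ)) ∨ b = create (toLex (i, σ))) ∧ x = a * b}

open scoped Matrix.Norms.L2Operator in
/-- The Lieb-Robinson bound, uniform in the length of the chain, with coefficient `C τ`, velocity `v`
and length `ξ`. The norm is the operator norm. -/
def LiebRobinsonBound {n : ℕ} (h : FPoly n) (C : ℝ → ℝ) (v ξ : ℝ) : Prop :=
  0 ≤ v ∧ 0 < ξ ∧
  ∀ L : ℕ, n ≤ L → ∀ X Y : Set (Fin L), IsDomain X → IsDomain Y →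
    ∀ A ∈ evenOn X, ∀ B ∈ evenOn Y, ‖A‖ = 1 → ‖B‖ = 1 → ∀ τ : ℝ, 0 ≤ τ →
      ‖((evolve h L τ)ᴴ * A * evolve h L τ) * B - B * ((evolve h L τ)ᴴ * A * evolve h L τ)‖
        ≤ C τ * Real.exp (-((setDist X Y : ℝ) - v * τ) / ξ)

end LVQC

end

noncomputable section

set_option linter.unusedSectionVars false

/-! Write `ntr` for the normalized trace and W = U V†. In matrix form the Bell state is a diagonal
phase commuting with all even operators, and the projection onto the Bell pair of a mode μ acts on W
as the conditional expectation E_μ onto the commutant of c_μ, c_μ†. The E_μ are commuting orthogonal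
projections for the Hilbert–Schmidt product. The local cost is 1 − ‖E_μ W‖², and the global cost is
1 − |ntr W|².

Comparison of the costs. Since ntr W = ntr (E_μ W), each local cost is at most the global one. The
product of all E_μ is W ↦ (ntr W)·1, because the Fock representation is irreducible; telescoping
over the commuting projections bounds the global cost by the sum of the 2L local costs
(`hsSq_sub_listExp_le`). The statement on C_HST thus reduces to that on C_LHST.

Comparison of the lengths. Expanding E_μ in the four matrix units e of the mode, the local cost is 1
− ½ Σ Re ntr((U†eU)(V†e†V)). Up to an error δ, U†eU may be replaced by its evolution under the terms
of the Hamiltonian near the site (`exists_truncation_bound`). Half of the 2d layers of V is moved by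
cyclicity onto the evolved operator, so each factor is widened by only d sites. Both factors then
lie in a window of 2r+1 sites that fits into either ring. The CAR algebra of the window embeds into
that of the ring by a *-homomorphism preserving `ntr` (`IsCAR.rep`, `ntr_map`), so the approximate
overlap depends only on the parity of the site (`norm_overlap_sub_le`). Averaging over an even ring,
both lengths approximate the same number.

Dynamics. Weight the commutators of the evolved local terms with B by exp(μ·distance to the support
of B). Their supremum satisfies a linear differential inequality with constants independent of L, so
Grönwall applies (`weighted_lieb_robinson`), and Duhamel's formula bounds the effect of removing
terms (`norm_flow_neg_flow_sub_le`). The rate μ is free at fixed time. Removing only the boundedly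
many terms crossing the boundary of X confines A to X, which gives a Lieb–Robinson bound uniform in
the sizes of X and Y. -/

namespace LVQC

/-! ### Anticommutation relations and irreducibility of the Fock representation -/

section CAR

variable {ι : Type*} [LinearOrder ι]

/-- The Jordan-Wigner sign of the mode `μ` in the configuration `s`. -/
def jwSign (μ : ι) (s : Finset ι) : ℂ := (-1) ^ (s.filter (· < μ)).card

lemma jwSign_mul_self (μ : ι) (s : Finset ι) : jwSign μ s * jwSign μ s = 1 := by
  rw [jwSign, ← pow_add, ← two_mul, pow_mul]; simp

lemma jwSign_insert {μ ν : ι} {s : Finset ι} (h : ν ∉ s) :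
    jwSign μ (insert ν s) = if ν < μ then - jwSign μ s else jwSign μ s := by
  unfold jwSign
  rw [Finset.filter_insert]
  split_ifs with hlt
  · rw [Finset.card_insert_of_notMem (by simp [h]), pow_succ]; ring
  · rfl

lemma jwSign_erase {μ ν : ι} {s : Finset ι} (h : ν ∈ s) :
    jwSign μ (s.erase ν) = if ν < μ then - jwSign μ s else jwSign μ s := by
  have := jwSign_insert (μ := μ) (Finset.notMem_erase ν s)
  rw [Finset.insert_erase h] at this
  rw [this]; split_ifs <;> simp

variable [Fintype ι]

lemma annihilate_apply (μ : ι) (s t : Finset ι) :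
    annihilate μ s t = if μ ∉ s ∧ t = insert μ s then jwSign μ s else 0 := by
  unfold annihilate
  rw [Matrix.of_apply]
  by_cases h : μ ∈ t ∧ s = t.erase μ
  · obtain ⟨h1, rfl⟩ := h
    rw [if_pos ⟨h1, rfl⟩, if_pos ⟨Finset.notMem_erase _ _, (Finset.insert_erase h1).symm⟩,
      jwSign_erase h1]
    simp [jwSign]
  · rw [if_neg h, if_neg]
    rintro ⟨h1, rfl⟩
    exact h ⟨Finset.mem_insert_self _ _, (Finset.erase_insert h1).symm⟩

lemma create_apply (μ : ι) (s t : Finset ι) :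
    create μ s t = if μ ∈ s ∧ t = s.erase μ then jwSign μ s else 0 := by
  unfold create
  rw [Matrix.conjTranspose_apply]
  unfold annihilate
  rw [Matrix.of_apply]
  split_ifs <;> simp [jwSign]

lemma annihilate_mul_apply (μ : ι) (A : FockOp ι) (s t : Finset ι) :
    (annihilate μ * A) s t = if μ ∈ s then 0 else jwSign μ s * A (insert μ s) t := by
  rw [Matrix.mul_apply]
  simp only [annihilate_apply]
  split_ifs with h
  · simp [h]
  · simp [h]

lemma create_mul_apply (μ : ι) (A : FockOp ι) (s t : Finset ι) :
    (create μ * A) s t = if μ ∈ s then jwSign μ s * A (s.erase μ) t else 0 := by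
  rw [Matrix.mul_apply]
  simp only [create_apply]
  split_ifs with h
  · simp [h]
  · simp [h]

lemma conjTranspose_annihilate (μ : ι) : (annihilate μ)ᴴ = create μ := rfl

lemma conjTranspose_create (μ : ι) : (create μ)ᴴ = annihilate μ := by
  simp [create]

/-- The canonical anticommutation relations of a family of elements of a `*`-ring. -/
structure IsCAR {κ B : Type*} [DecidableEq κ] [Ring B] [StarRing B] (a : κ → B) : Prop where
  anti : ∀ k l, a k * a l + a l * a k = 0
  anti_star : ∀ k l, a k * star (a l) + star (a l) * a k = if k = l then 1 else 0

lemma mul_annihilate_apply (μ : ι) (A : FockOp ι) (s t : Finset ι) :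
    (A * annihilate μ) s t = if μ ∈ t then jwSign μ t * A s (t.erase μ) else 0 := by
  have h := congr_arg star (create_mul_apply μ Aᴴ t s)
  rw [← conjTranspose_annihilate, ← Matrix.conjTranspose_mul, Matrix.conjTranspose_apply,
    star_star] at h
  rw [h]
  split_ifs <;> simp [jwSign, mul_comm]

lemma mul_create_apply (μ : ι) (A : FockOp ι) (s t : Finset ι) :
    (A * create μ) s t = if μ ∈ t then 0 else jwSign μ t * A s (insert μ t) := by
  have h := congr_arg star (annihilate_mul_apply μ Aᴴ t s)
  rw [← conjTranspose_create, ← Matrix.conjTranspose_mul, Matrix.conjTranspose_apply,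
    star_star] at h
  rw [h]
  split_ifs <;> simp [jwSign, mul_comm]

/-- For μ < ν, changing the occupation of μ flips the sign attached to ν, while changing ν leaves
the sign of μ alone. Hence the two orders of application differ by −1; for equal modes the squared
sign is 1. -/
lemma isCAR_annihilate : IsCAR (annihilate : ι → FockOp ι) where
  anti μ ν := by
    have key : ∀ μ ν : ι, (annihilate μ * annihilate ν : FockOp ι)
        = annihilate μ * (annihilate ν * 1) := fun μ ν => by rw [mul_one]
    ext s t
    rw [key, key ν, Matrix.add_apply]
    simp only [annihilate_mul_apply, Finset.mem_insert]
    rcases lt_trichotomy μ ν with h | rfl | h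
    · by_cases h1 : μ ∈ s <;> by_cases h2 : ν ∈ s <;>
        simp [h1, h2, h.ne, h.ne', jwSign_insert, h, h.not_gt]
      rw [Finset.insert_comm μ ν]
      ring
    · simp
    · by_cases h1 : μ ∈ s <;> by_cases h2 : ν ∈ s <;>
        simp [h1, h2, h.ne, h.ne', jwSign_insert, h, h.not_gt]
      rw [Finset.insert_comm μ ν]
      ring
  anti_star μ ν := by
    have key : ∀ μ ν : ι, (annihilate μ * create ν : FockOp ι)
        = annihilate μ * (create ν * 1) := fun μ ν => by rw [mul_one]
    have key' : ∀ μ ν : ι, (create μ * annihilate ν : FockOp ι)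
        = create μ * (annihilate ν * 1) := fun μ ν => by rw [mul_one]
    rw [Matrix.star_eq_conjTranspose, conjTranspose_annihilate]
    ext s t
    rw [key, key', Matrix.add_apply]
    simp only [annihilate_mul_apply, create_mul_apply, Finset.mem_insert]
    rcases lt_trichotomy μ ν with h | rfl | h
    · by_cases h1 : μ ∈ s <;> by_cases h2 : ν ∈ s <;>
        simp [h1, h2, h.ne, h.ne', jwSign_insert, jwSign_erase, h, h.not_gt]
      rw [Finset.erase_insert_of_ne h.ne]
      ring
    · by_cases h1 : μ ∈ s
      · simp [h1, ← mul_assoc, jwSign_erase, jwSign_mul_self]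
        rw [Finset.insert_erase h1]
      · simp [h1, ← mul_assoc, jwSign_insert, jwSign_mul_self]
        rw [Finset.erase_insert h1]
    · by_cases h1 : μ ∈ s <;> by_cases h2 : ν ∈ s <;>
        simp [h1, h2, h.ne, h.ne', jwSign_insert, jwSign_erase, h, h.not_gt]
      rw [Finset.erase_insert_of_ne h.ne']
      ring

lemma parity_mul_apply (A : FockOp ι) (s t : Finset ι) :
    (parity ι * A) s t = (-1) ^ s.card * A s t := by
  simp [parity]

lemma mul_parity_apply (A : FockOp ι) (s t : Finset ι) :
    (A * parity ι) s t = A s t * (-1) ^ t.card := by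
  simp [parity]

lemma parity_mul_parity : parity ι * parity ι = 1 := by
  ext s t
  rw [parity_mul_apply, parity, Matrix.diagonal_apply, Matrix.one_apply]
  split_ifs with h
  · rw [h, ← pow_add, ← two_mul, pow_mul]; simp
  · simp

lemma conjTranspose_parity : (parity ι)ᴴ = parity ι := by
  simp [parity, Matrix.diagonal_conjTranspose, Pi.star_def]

lemma parity_mul_annihilate (μ : ι) : parity ι * annihilate μ = - (annihilate μ * parity ι) := by
  ext s t
  rw [Matrix.neg_apply, parity_mul_apply, mul_parity_apply, annihilate_apply]
  split_ifs with h
  · rw [h.2, Finset.card_insert_of_notMem h.1, pow_succ]; ring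
  · simp

lemma parity_mul_create (μ : ι) : parity ι * create μ = - (create μ * parity ι) := by
  have := congr_arg Matrix.conjTranspose (parity_mul_annihilate μ)
  rw [Matrix.conjTranspose_neg, Matrix.conjTranspose_mul, Matrix.conjTranspose_mul,
    conjTranspose_parity, conjTranspose_annihilate] at this
  rw [this, neg_neg]

/-- Irreducibility of the Fock representation. -/
lemma eq_smul_one_of_commute {X : FockOp ι} (h : ∀ μ, Commute (annihilate μ) X)
    (h' : ∀ μ, Commute (create μ) X) : X = X ∅ ∅ • 1 := by
  -- Commuting with c_μ identifies the diagonal entries at s and at s with μ added.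
  have hdiag : ∀ s, X s s = X ∅ ∅ := by
    intro s
    induction s using Finset.induction_on with
    | empty => rfl
    | insert μ s hμ ih =>
      have := congr_fun (congr_fun (h μ).eq s) (insert μ s)
      rw [annihilate_mul_apply, mul_annihilate_apply, if_neg hμ,
        if_pos (Finset.mem_insert_self _ _), Finset.erase_insert hμ, jwSign_insert hμ,
        if_neg (lt_irrefl μ)] at this
      rw [← ih]
      exact mul_left_cancel₀ (by simp [jwSign]) this
  have hl : ∀ (s t : Finset ι) (μ : ι), μ ∈ s → (create μ * (annihilate μ * X) : FockOp ι) s t = X s t := by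
    intro s t μ hs
    rw [create_mul_apply, if_pos hs, annihilate_mul_apply, if_neg (by simp),
      Finset.insert_erase hs, jwSign_erase hs, if_neg (lt_irrefl μ), ← mul_assoc, jwSign_mul_self,
      one_mul]
  have hl' : ∀ (s t : Finset ι) (μ : ι), μ ∉ s → (create μ * (annihilate μ * X) : FockOp ι) s t = 0 := by
    intro s t μ hs
    rw [create_mul_apply, if_neg hs]
  have hr : ∀ (s t : Finset ι) (μ : ι), μ ∈ t → (X * create μ * annihilate μ : FockOp ι) s t = X s t := by
    intro s t μ ht
    rw [mul_annihilate_apply, if_pos ht, mul_create_apply, if_neg (by simp),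
      Finset.insert_erase ht, jwSign_erase ht, if_neg (lt_irrefl μ), ← mul_assoc, jwSign_mul_self,
      one_mul]
  have hr' : ∀ (s t : Finset ι) (μ : ι), μ ∉ t → (X * create μ * annihilate μ : FockOp ι) s t = 0 := by
    intro s t μ ht
    rw [mul_annihilate_apply, if_neg ht]
  -- X commutes with every number operator, so it cannot connect configurations that differ in the
  -- occupation of some mode.
  have hn : ∀ μ, create μ * (annihilate μ * X) = X * create μ * annihilate μ := fun μ => by
    rw [(h μ).eq, ← mul_assoc, (h' μ).eq]
  ext s t
  rw [Matrix.smul_apply, Matrix.one_apply]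
  split_ifs with hst
  · rw [hst, hdiag]; simp
  · rw [smul_zero]
    obtain ⟨μ, hμ⟩ : ∃ μ, ¬ (μ ∈ s ↔ μ ∈ t) := by
      by_contra! hc
      exact hst (Finset.ext hc)
    by_cases h1 : μ ∈ s
    · rw [← hl s t μ h1, hn, hr' s t μ fun h2 => hμ ⟨fun _ => h2, fun _ => h1⟩]
    · rw [← hr s t μ (by tauto), ← hn, hl' s t μ h1]

end CAR

/-! ### Universality of the CAR algebra through matrix units -/

section CARRepresentation

variable {κ B : Type*} [LinearOrder κ] [Ring B] [StarRing B] {a : κ → B}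

namespace IsCAR

lemma mul_star (ha : IsCAR a) (k : κ) : a k * star (a k) = 1 - star (a k) * a k := by
  have := ha.anti_star k k
  rw [if_pos rfl] at this
  exact eq_sub_of_add_eq this

lemma mul_star_of_ne (ha : IsCAR a) {k l : κ} (h : k ≠ l) :
    a k * star (a l) = - (star (a l) * a k) := by
  have := ha.anti_star k l
  rw [if_neg h] at this
  exact eq_neg_of_add_eq_zero_left this

lemma mul_self [Algebra ℂ B] (ha : IsCAR a) (k : κ) : a k * a k = 0 := by
  have := ha.anti k k
  rw [← two_smul ℂ] at this
  exact (smul_eq_zero.1 this).resolve_left two_ne_zero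

lemma swap (ha : IsCAR a) (k l : κ) : a k * a l = - (a l * a k) :=
  eq_neg_of_add_eq_zero_left (ha.anti k l)

lemma swap_star (ha : IsCAR a) (k l : κ) :
    star (a k) * star (a l) = - (star (a l) * star (a k)) := by
  have := congr_arg star (ha.swap l k)
  simpa using this

end IsCAR

/-- The projection onto the states without particles in the modes of `l`. -/
def vacProj (a : κ → B) (l : List κ) : B := (l.map fun k => a k * star (a k)).prod

/-- The ordered product of the creation operators of the modes of `s`. -/
def createProd (a : κ → B) (s : Finset κ) : B := ((s.sort (· ≤ ·)).map fun k => star (a k)).prod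

lemma createProd_empty : createProd a ∅ = 1 := by simp [createProd]

lemma createProd_insert {m : κ} {s : Finset κ} (h : ∀ k ∈ s, m < k) :
    createProd a (insert m s) = star (a m) * createProd a s := by
  rw [createProd, Finset.sort_insert (· ≤ ·) (fun k hk => (h k hk).le)
    (fun hm => lt_irrefl m (h m hm))]
  rfl

namespace IsCAR

variable [Algebra ℂ B]

lemma commute_hole (ha : IsCAR a) {k j : κ} (h : k ≠ j) : Commute (a k) (a j * star (a j)) := by
  rw [Commute, SemiconjBy, ← mul_assoc, ha.swap k j, neg_mul, mul_assoc, ha.mul_star_of_ne h]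
  noncomm_ring

lemma commute_star_hole (ha : IsCAR a) {k j : κ} (h : k ≠ j) :
    Commute (star (a k)) (a j * star (a j)) := by
  have := (ha.commute_hole h).star_star
  simpa using this

lemma mul_vacProj (ha : IsCAR a) {k : κ} {l : List κ} (hk : k ∈ l) : a k * vacProj a l = 0 := by
  induction l with
  | nil => simp at hk
  | cons j l ih =>
    rw [vacProj, List.map_cons, List.prod_cons, ← mul_assoc]
    by_cases h : k = j
    · rw [h, ← mul_assoc, ha.mul_self]; simp
    · rw [(ha.commute_hole h).eq, mul_assoc, ← vacProj, ih (by simpa [h] using hk), mul_zero]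

lemma vacProj_mul_vacProj (ha : IsCAR a) {l l' : List κ} (h : l ⊆ l') :
    vacProj a l * vacProj a l' = vacProj a l' := by
  induction l with
  | nil => simp [vacProj]
  | cons j l ih =>
    rw [List.cons_subset] at h
    rw [vacProj, List.map_cons, List.prod_cons, mul_assoc, ← vacProj, ih h.2, ha.mul_star, sub_mul,
      mul_assoc, ha.mul_vacProj h.1]
    simp

/-- The adjoint is the product in reverse order, over the same modes, and either product absorbs the
other. So p*p = p, and p*p is self-adjoint. -/
lemma star_vacProj (ha : IsCAR a) (l : List κ) : star (vacProj a l) = vacProj a l := by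
  have h : star (vacProj a l) = vacProj a l.reverse := by
    induction l with
    | nil => simp [vacProj]
    | cons j l ih => simp_all [vacProj]
  have h1 : star (vacProj a l) * vacProj a l = vacProj a l := by
    rw [h]; exact ha.vacProj_mul_vacProj (by simp)
  have h2 := congr_arg star h1
  rw [star_mul, star_star, h1] at h2
  exact h2.symm

lemma vacProj_mul_star (ha : IsCAR a) {k : κ} {l : List κ} (hk : k ∈ l) :
    vacProj a l * star (a k) = 0 := by
  have := congr_arg star (ha.mul_vacProj hk)
  rwa [star_mul, ha.star_vacProj, star_zero] at this

/-- Anticommuting a_k to the right through the ordered creation operators gives the Jordan–Wigner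
sign, until it meets its partner or the vacuum projection, which it kills. Thus the action on
abstract vectors has the same coefficients as on Fock space. -/
lemma mul_createProd_mul_vacProj (ha : IsCAR a) {l : List κ} (k : κ) (hk : k ∈ l) (s : Finset κ) :
    a k * (createProd a s * vacProj a l) =
      if k ∈ s then jwSign k s • (createProd a (s.erase k) * vacProj a l) else 0 := by
  induction s using Finset.induction_on_min with
  | empty => simp [createProd_empty, ha.mul_vacProj hk]
  | insert m s hm ih =>
    have hms : m ∉ s := fun h => lt_irrefl m (hm m h)
    rw [createProd_insert hm, mul_assoc, ← mul_assoc]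
    by_cases h : k = m
    · subst h
      rw [ha.mul_star, sub_mul, mul_assoc, ih, if_neg hms, if_pos (Finset.mem_insert_self _ _),
        Finset.erase_insert hms, jwSign, Finset.filter_eq_empty_iff.2]
      · simp
      · intro x hx
        rcases Finset.mem_insert.1 hx with rfl | hx
        · exact lt_irrefl _
        · exact (hm x hx).not_gt
    · rw [ha.mul_star_of_ne h, neg_mul, mul_assoc, ih]
      by_cases hks : k ∈ s
      · rw [if_pos hks, if_pos (Finset.mem_insert_of_mem hks), Finset.erase_insert_of_ne (Ne.symm h),
          createProd_insert fun x hx => hm x (Finset.mem_of_mem_erase hx), jwSign_insert hms,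
          if_pos (hm k hks), mul_smul_comm, mul_assoc, neg_smul]
      · rw [if_neg hks, if_neg (by simp [h, hks])]; simp

/-- Orthonormality of the occupation vectors in algebraic form; it is what makes `unit` a system of
matrix units. -/
lemma vacProj_mul_createProd_mul_vacProj (ha : IsCAR a) {l : List κ} (hl : ∀ k, k ∈ l)
    (s t : Finset κ) :
    vacProj a l * (star (createProd a s) * (createProd a t * vacProj a l)) =
      if s = t then vacProj a l else 0 := by
  induction s using Finset.induction_on_min generalizing t with
  | empty =>
    induction t using Finset.induction_on_min with
    | empty => simp [createProd_empty, ha.vacProj_mul_vacProj (List.Subset.refl l)]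
    | insert m t hm ih =>
      rw [createProd_insert hm, if_neg (Finset.insert_ne_empty _ _).symm, createProd_empty, star_one,
        one_mul, mul_assoc, ← mul_assoc, ha.vacProj_mul_star (hl m), zero_mul]
  | insert m s hm ih =>
    have hms : m ∉ s := fun h => lt_irrefl m (hm m h)
    rw [createProd_insert hm, star_mul, star_star, mul_assoc, ha.mul_createProd_mul_vacProj m (hl m)]
    by_cases hmt : m ∈ t
    · rw [if_pos hmt, mul_smul_comm, mul_smul_comm, ih]
      by_cases h : s = t.erase m
      · have h' : insert m s = t := by rw [h, Finset.insert_erase hmt]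
        rw [if_pos h, if_pos h', ← h', jwSign, Finset.filter_eq_empty_iff.2]
        · simp
        · intro x hx
          rcases Finset.mem_insert.1 hx with rfl | hx
          · exact lt_irrefl _
          · exact (hm x hx).not_gt
      · rw [if_neg h, if_neg, smul_zero]
        rintro rfl
        exact h (Finset.erase_insert hms).symm
    · rw [if_neg hmt, if_neg]
      · simp
      · rintro rfl
        exact hmt (Finset.mem_insert_self _ _)

lemma commute_createProd_hole (ha : IsCAR a) {m : κ} {s : Finset κ} (h : m ∉ s) :
    Commute (createProd a s) (a m * star (a m)) := by
  refine Commute.list_prod_left _ _ fun x hx => ?_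
  obtain ⟨k, hk, rfl⟩ := List.mem_map.1 hx
  refine ha.commute_star_hole ?_
  rintro rfl
  exact h (by simpa using hk)

/-- Completeness of the occupation vectors. A new smallest mode m splits the sum according to its
occupation, and a a* + a* a = 1 recombines the two halves. -/
lemma sum_createProd (ha : IsCAR a) (K : Finset κ) :
    ∑ s ∈ K.powerset, createProd a s * vacProj a (K.sort (· ≤ ·)) * star (createProd a s) = 1 := by
  induction K using Finset.induction_on_min with
  | empty => simp [createProd_empty, vacProj]
  | insert m K hm ih =>
    have hmK : m ∉ K := fun h => lt_irrefl m (hm m h)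
    set Q := vacProj a (K.sort (· ≤ ·)) with hQ
    have hP : vacProj a ((insert m K).sort (· ≤ ·)) = a m * star (a m) * Q := by
      rw [Finset.sort_insert (· ≤ ·) (fun k hk => (hm k hk).le) hmK]
      rfl
    have h1 : ∀ s ∈ K.powerset, createProd a s * (a m * star (a m) * Q) * star (createProd a s)
        = a m * star (a m) * (createProd a s * Q * star (createProd a s)) := by
      intro s hs
      have hms : m ∉ s := fun h => hmK (Finset.mem_powerset.1 hs h)
      rw [← mul_assoc, (ha.commute_createProd_hole hms).eq]
      simp only [mul_assoc]
    have h2 : ∀ s ∈ K.powerset, createProd a (insert m s) * (a m * star (a m) * Q)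
        * star (createProd a (insert m s))
        = star (a m) * (a m * star (a m)) * (createProd a s * Q * star (createProd a s)) * a m := by
      intro s hs
      rw [createProd_insert fun k hk => hm k (Finset.mem_powerset.1 hs hk), star_mul, star_star,
        mul_assoc (star (a m)), ← mul_assoc _ _ (a m), mul_assoc (star (a m)), h1 s hs]
      simp only [mul_assoc]
    rw [Finset.sum_powerset_insert hmK, hP, Finset.sum_congr rfl h1, Finset.sum_congr rfl h2,
      ← Finset.mul_sum, ← Finset.sum_mul, ← Finset.mul_sum, ih, mul_one, mul_one, ha.mul_star,
      mul_sub, mul_one, ← mul_assoc, ← star_mul, ha.mul_self]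
    simp

variable [Fintype κ]

/-- The matrix units defined by a CAR family. -/
def unit (a : κ → B) (s t : Finset κ) : B :=
  createProd a s * vacProj a ((Finset.univ : Finset κ).sort (· ≤ ·)) * star (createProd a t)

lemma unit_mul_unit (ha : IsCAR a) (s t u v : Finset κ) :
    unit a s t * unit a u v = if t = u then unit a s v else 0 := by
  have := ha.vacProj_mul_createProd_mul_vacProj
    (l := (Finset.univ : Finset κ).sort (· ≤ ·)) (by simp) t u
  unfold unit
  calc _ = createProd a s * (vacProj a ((Finset.univ : Finset κ).sort (· ≤ ·)) *
      (star (createProd a t) * (createProd a u * vacProj a ((Finset.univ : Finset κ).sort (· ≤ ·)))))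
        * star (createProd a v) := by simp only [mul_assoc]
    _ = _ := by rw [this]; split_ifs <;> simp

lemma star_unit (ha : IsCAR a) (s t : Finset κ) : star (unit a s t) = unit a t s := by
  unfold unit
  rw [star_mul, star_mul, star_star, ha.star_vacProj, mul_assoc]

lemma sum_unit (ha : IsCAR a) : ∑ s, unit a s s = 1 := by
  have := ha.sum_createProd Finset.univ
  simpa [unit] using this

lemma mul_unit (ha : IsCAR a) (k : κ) (s t : Finset κ) :
    a k * unit a s t = if k ∈ s then jwSign k s • unit a (s.erase k) t else 0 := by
  unfold unit
  rw [← mul_assoc, ha.mul_createProd_mul_vacProj k (by simp)]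
  split_ifs <;> simp

variable [StarModule ℂ B]

/-- The representation of the operators on the Fock space defined by a CAR family. -/
def rep (ha : IsCAR a) : FockOp κ →⋆ₐ[ℂ] B where
  toFun M := ∑ s, ∑ t, M s t • unit a s t
  map_one' := by
    rw [← ha.sum_unit]
    refine Finset.sum_congr rfl fun s _ => ?_
    rw [Finset.sum_eq_single s] <;> simp +contextual [eq_comm]
  map_mul' M N := by
    have h : ∀ s t, (M s t • unit a s t) * ∑ u, ∑ v, N u v • unit a u v
        = ∑ v, (M s t * N t v) • unit a s v := by
      intro s t
      rw [Finset.mul_sum, Finset.sum_eq_single t]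
      · rw [Finset.mul_sum]
        refine Finset.sum_congr rfl fun v _ => ?_
        rw [smul_mul_smul_comm, ha.unit_mul_unit, if_pos rfl]
      · intro u _ hu
        rw [Finset.mul_sum]
        refine Finset.sum_eq_zero fun v _ => ?_
        rw [smul_mul_smul_comm, ha.unit_mul_unit, if_neg hu.symm, smul_zero]
      · simp
    rw [Finset.sum_mul]
    refine Finset.sum_congr rfl fun s _ => ?_
    rw [Finset.sum_mul, Finset.sum_congr rfl fun t _ => h s t, Finset.sum_comm]
    refine Finset.sum_congr rfl fun v _ => ?_
    rw [Matrix.mul_apply, Finset.sum_smul]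
  map_zero' := by simp
  map_add' M N := by simp [add_smul, Finset.sum_add_distrib]
  commutes' c := by
    rw [Algebra.algebraMap_eq_smul_one, Algebra.algebraMap_eq_smul_one, ← ha.sum_unit,
      Finset.smul_sum]
    refine Finset.sum_congr rfl fun s _ => ?_
    rw [Finset.sum_eq_single s] <;> simp +contextual [eq_comm]
  map_star' M := by
    rw [star_sum, Finset.sum_comm]
    refine Finset.sum_congr rfl fun s _ => ?_
    rw [star_sum]
    refine Finset.sum_congr rfl fun t _ => ?_
    rw [star_smul, ha.star_unit, Matrix.star_apply]

lemma rep_annihilate (ha : IsCAR a) (k : κ) : ha.rep (annihilate k) = a k := by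
  have h1 : a k = ∑ t, a k * unit a t t := by rw [← Finset.mul_sum, ha.sum_unit, mul_one]
  rw [h1]
  change ∑ s, ∑ t, annihilate k s t • unit a s t = _
  rw [Finset.sum_comm]
  refine Finset.sum_congr rfl fun t _ => ?_
  rw [ha.mul_unit, Finset.sum_eq_single (t.erase k)]
  · by_cases h : k ∈ t <;> simp [annihilate, h, jwSign]
  · intro s _ hs
    simp [annihilate, hs]
  · simp

lemma rep_create (ha : IsCAR a) (k : κ) : ha.rep (create k) = star (a k) := by
  rw [← conjTranspose_annihilate, ← Matrix.star_eq_conjTranspose, map_star, ha.rep_annihilate]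

end IsCAR

end CARRepresentation

/-! ### The normalized trace and its invariance under embeddings -/

section Trace

/-- Uniqueness of the normalized trace of a matrix algebra. -/
lemma trace_unique {n : Type*} [Fintype n] [DecidableEq n] (f : Matrix n n ℂ →ₗ[ℂ] ℂ)
    (hf : ∀ X Y, f (X * Y) = f (Y * X)) (X : Matrix n n ℂ) :
    Fintype.card n * f X = X.trace * f 1 := by
  -- An off-diagonal unit is a commutator, E_ss E_st − E_st E_ss.
  have hoff : ∀ s t : n, s ≠ t → f (Matrix.single s t 1) = 0 := by
    intro s t hst
    have := hf (Matrix.single s s 1) (Matrix.single s t 1)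
    simpa [Matrix.single_mul_single_of_ne _ _ _ _ hst.symm] using this
  have hdiag : ∀ s t : n, f (Matrix.single s s 1) = f (Matrix.single t t 1) := by
    intro s t
    have := hf (Matrix.single s t 1) (Matrix.single t s 1)
    simpa using this
  have hX : ∀ t, f X = X.trace * f (Matrix.single t t 1) := by
    intro t
    conv_lhs => rw [Matrix.matrix_eq_sum_single X]
    rw [map_sum, Matrix.trace, Finset.sum_mul]
    refine Finset.sum_congr rfl fun s _ => ?_
    rw [map_sum, Finset.sum_eq_single s]
    · rw [← hdiag s t, ← mul_one (X s s), ← smul_eq_mul, ← Matrix.smul_single, map_smul]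
      simp
    · intro u _ hu
      rw [← mul_one (X s u), ← smul_eq_mul, ← Matrix.smul_single, map_smul, hoff s u hu.symm,
        smul_zero]
    · simp
  have h1 : f 1 = ∑ t, f (Matrix.single t t 1) := by
    rw [← map_sum, Matrix.sum_single_one]
  rw [h1, Finset.mul_sum, ← Finset.sum_congr rfl fun t _ => hX t]
  simp

variable {ι κ : Type*} [Fintype ι] [LinearOrder ι] [Fintype κ] [LinearOrder κ]

/-- The normalized trace. -/
def ntr (X : FockOp ι) : ℂ := X.trace / 2 ^ Fintype.card ι

lemma ntr_one : ntr (1 : FockOp ι) = 1 := by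
  simp [ntr]

lemma ntr_mul_comm (X Y : FockOp ι) : ntr (X * Y) = ntr (Y * X) := by
  rw [ntr, ntr, Matrix.trace_mul_comm]

/-- The pullback of the trace is again tracial and takes the value 1 at 1, so uniqueness applies.
This removes the size of the surrounding ring from expectation values in a window. -/
lemma ntr_map (φ : FockOp κ →⋆ₐ[ℂ] FockOp ι) (X : FockOp κ) : ntr (φ X) = ntr X := by
  let f : FockOp κ →ₗ[ℂ] ℂ :=
    { toFun := fun X => ntr (φ X)
      map_add' := fun X Y => by simp [ntr, add_div]
      map_smul' := fun c X => by simp [ntr, mul_div_assoc] }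
  have hf : ∀ X, f X = ntr (φ X) := fun _ => rfl
  have := trace_unique f (fun X Y => by rw [hf, hf, map_mul, map_mul, ntr_mul_comm]) X
  rw [hf, hf, map_one, ntr_one, mul_one, Fintype.card_finset] at this
  rw [ntr.eq_1 X, eq_div_iff (by simp), ← this]
  push_cast
  ring

end Trace

/-! ### Propagation estimates in a C*-algebra -/

section Dynamics

variable {𝔄 : Type*} [CStarAlgebra 𝔄]

/-- The automorphism group `X ↦ e^{-tG} X e^{tG}`. -/
def flow (G : 𝔄) (t : ℝ) (X : 𝔄) : 𝔄 :=
  NormedSpace.exp ((-t) • G) * X * NormedSpace.exp (t • G)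

lemma exp_smul_mul_exp_neg (G : 𝔄) (t : ℝ) :
    NormedSpace.exp (t • G) * NormedSpace.exp ((-t) • G) = 1 := by
  let _ : NormedAlgebra ℚ 𝔄 := NormedAlgebra.restrictScalars ℚ ℂ 𝔄
  rw [← NormedSpace.exp_add_of_commute, ← add_smul, add_neg_cancel, zero_smul,
    NormedSpace.exp_zero]
  exact ((Commute.refl G).smul_left _).smul_right _

lemma exp_neg_mul_exp_smul (G : 𝔄) (t : ℝ) :
    NormedSpace.exp ((-t) • G) * NormedSpace.exp (t • G) = 1 := by
  simpa using exp_smul_mul_exp_neg G (-t)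

lemma flow_zero (G X : 𝔄) : flow G 0 X = X := by simp [flow]

lemma flow_mul (G : 𝔄) (t : ℝ) (X Y : 𝔄) : flow G t (X * Y) = flow G t X * flow G t Y := by
  unfold flow
  calc _ = NormedSpace.exp ((-t) • G) * X * 1 * Y * NormedSpace.exp (t • G) := by
        simp only [mul_one, mul_assoc]
    _ = _ := by rw [← exp_smul_mul_exp_neg G t]; simp only [mul_assoc]

lemma flow_sub (G : 𝔄) (t : ℝ) (X Y : 𝔄) : flow G t (X - Y) = flow G t X - flow G t Y := by
  simp [flow, mul_sub, sub_mul]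

lemma flow_smul (G : 𝔄) (t : ℝ) (c : ℂ) (X : 𝔄) : flow G t (c • X) = c • flow G t X := by
  simp [flow]

lemma flow_sum (G : 𝔄) (t : ℝ) {J : Type*} (s : Finset J) (X : J → 𝔄) :
    flow G t (∑ j ∈ s, X j) = ∑ j ∈ s, flow G t (X j) := by
  simp [flow, Finset.mul_sum, Finset.sum_mul]

lemma flow_neg_flow (G : 𝔄) (t : ℝ) (X : 𝔄) : flow G (-t) (flow G t X) = X := by
  unfold flow
  rw [neg_neg]
  calc _ = (NormedSpace.exp (t • G) * NormedSpace.exp ((-t) • G)) * X *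
      (NormedSpace.exp (t • G) * NormedSpace.exp ((-t) • G)) := by simp only [mul_assoc]
    _ = X := by rw [exp_smul_mul_exp_neg]; simp

lemma flow_neg_left (G : 𝔄) (t : ℝ) (X : 𝔄) : flow (-G) t X = flow G (-t) X := by
  simp [flow]

lemma exp_smul_mem_unitary {G : 𝔄} (hG : star G = -G) (t : ℝ) :
    NormedSpace.exp (t • G) ∈ unitary 𝔄 := by
  let _ : NormedAlgebra ℚ 𝔄 := NormedAlgebra.restrictScalars ℚ ℂ 𝔄
  apply NormedSpace.exp_mem_unitary_of_mem_skewAdjoint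
  rw [skewAdjoint.mem_iff]
  simp [hG]

lemma norm_flow {G : 𝔄} (hG : star G = -G) (t : ℝ) (X : 𝔄) : ‖flow G t X‖ = ‖X‖ := by
  unfold flow
  rw [CStarRing.norm_mul_mem_unitary _ (exp_smul_mem_unitary hG t),
    CStarRing.norm_mem_unitary_mul _ (exp_smul_mem_unitary hG (-t))]

lemma hasDerivAt_flow (G X : 𝔄) (t : ℝ) :
    HasDerivAt (fun t => flow G t X) (flow G t (X * G - G * X)) t := by
  have h1 : HasDerivAt (fun u : ℝ => NormedSpace.exp (u • G)) (G * NormedSpace.exp (t • G)) t :=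
    hasDerivAt_exp_smul_const' (𝕂 := ℝ) G t
  have h2 : HasDerivAt (fun u : ℝ => NormedSpace.exp ((-u) • G))
      (-(NormedSpace.exp ((-t) • G) * G)) t := by
    have := (hasDerivAt_exp_smul_const (𝕂 := ℝ) G (-t)).scomp t (hasDerivAt_neg t)
    simpa [Function.comp_def] using this
  refine HasDerivAt.congr_deriv (f := fun t => flow G t X) ((h2.mul_const X).mul h1) ?_
  unfold flow
  generalize NormedSpace.exp ((-t) • G) = e
  generalize NormedSpace.exp (t • G) = e'
  noncomm_ring

/-- The derivative of a path conjugated by a one-parameter group. -/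
lemma hasDerivAt_flow_neg_comp (G : 𝔄) {f : ℝ → 𝔄} {f' : 𝔄} {t : ℝ} (hf : HasDerivAt f f' t) :
    HasDerivAt (fun t => flow G (-t) (f t)) (flow G (-t) (f' + G * f t - f t * G)) t := by
  have h1 : HasDerivAt (fun u : ℝ => NormedSpace.exp ((- -u) • G))
      (NormedSpace.exp ((- -t) • G) * G) t := by
    simpa using hasDerivAt_exp_smul_const (𝕂 := ℝ) G t
  have h2 : HasDerivAt (fun u : ℝ => NormedSpace.exp ((-u) • G))
      (-(G * NormedSpace.exp ((-t) • G))) t := by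
    have := (hasDerivAt_exp_smul_const' (𝕂 := ℝ) G (-t)).scomp t (hasDerivAt_neg t)
    simpa [Function.comp_def] using this
  refine HasDerivAt.congr_deriv (f := fun t => flow G (-t) (f t)) ((h1.mul hf).mul h2) ?_
  rw [flow, Pi.mul_apply]
  generalize NormedSpace.exp ((-t) • G) = e
  generalize NormedSpace.exp ((- -t) • G) = e'
  noncomm_ring

/-- Jacobi identity: [[x,y],B] = [x,[y,B]] − [y,[x,B]]. -/
lemma norm_commutator_commutator_le (x y B : 𝔄) :
    ‖(x * y - y * x) * B - B * (x * y - y * x)‖ ≤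
      2 * ‖x‖ * ‖y * B - B * y‖ + 2 * ‖y‖ * ‖x * B - B * x‖ := by
  have h : (x * y - y * x) * B - B * (x * y - y * x) =
      x * (y * B - B * y) - (y * B - B * y) * x - (y * (x * B - B * x) - (x * B - B * x) * y) := by
    noncomm_ring
  rw [h]
  refine (norm_sub_le _ _).trans (add_le_add ((norm_sub_le _ _).trans ?_)
    ((norm_sub_le _ _).trans ?_))
  · nlinarith [norm_mul_le x (y * B - B * y), norm_mul_le (y * B - B * y) x]
  · nlinarith [norm_mul_le y (x * B - B * x), norm_mul_le (x * B - B * x) y]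

/-- Comparison with a dynamics that does not spread `A` to the support of `B`. -/
lemma norm_commutator_flow_le {G G' : 𝔄} (hG : star G = -G) (hG' : star G' = -G') (τ : ℝ) {A B : 𝔄}
    (h : Commute (flow G' τ A) B) :
    ‖flow G τ A * B - B * flow G τ A‖ ≤ 2 * ‖A‖ * ‖flow G' τ (flow G (-τ) B) - B‖ := by
  set D := flow G' τ (flow G (-τ) B) with hD
  -- The two isometric automorphisms turn the commutator of the evolved A with B into that of `flow
  -- G' τ A` with D. By hypothesis only the deviation D − B contributes.
  have h1 : flow G' τ (flow G (-τ) (flow G τ A * B - B * flow G τ A)) =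
      flow G' τ A * (D - B) - (D - B) * flow G' τ A := by
    rw [flow_sub, flow_mul, flow_mul, flow_neg_flow, flow_sub, flow_mul, flow_mul, ← hD,
      mul_sub, sub_mul, h.eq]
    abel
  rw [← norm_flow hG (-τ), ← norm_flow hG' τ, h1]
  refine (norm_sub_le _ _).trans ?_
  have h4 := norm_mul_le (flow G' τ A) (D - B)
  have h5 := norm_mul_le (D - B) (flow G' τ A)
  rw [norm_flow hG'] at h4 h5
  linarith

variable {J : Type*} [Fintype J] {h : J → 𝔄} {z : ℂ}

lemma star_smul_sum (hh : ∀ j, IsSelfAdjoint (h j)) (hz : star z = -z) (S : Finset J) :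
    star (z • ∑ j ∈ S, h j) = -(z • ∑ j ∈ S, h j) := by
  rw [star_smul, star_sum, hz, neg_smul]
  simp only [(hh _).star_eq]

/-- A Lieb-Robinson bound with a slowly varying weight `w`. -/
theorem weighted_lieb_robinson (hh : ∀ j, IsSelfAdjoint (h j)) (hz : star z = -z) (hz1 : ‖z‖ = 1)
    (S : Finset J) {κ : ℝ} (hκ : ∀ j, ‖h j‖ ≤ κ) (B : 𝔄) {w : J → ℝ} (hw : ∀ j, 0 < w j)
    {N : J → Finset J} (hN : ∀ j, ∀ k ∉ N j, Commute (h j) (h k)) {m : ℕ}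
    (hm : ∀ j, (N j).card ≤ m) {q : ℝ} (hq0 : 0 ≤ q) (hq : ∀ j, ∀ k ∈ N j, w j ≤ q * w k) {b : ℝ}
    (hb0 : 0 ≤ b) (hb : ∀ j, w j * ‖h j * B - B * h j‖ ≤ b) {t : ℝ} (ht : 0 ≤ t) (j : J) :
    w j * ‖flow (z • ∑ k ∈ S, h k) t (h j) * B - B * flow (z • ∑ k ∈ S, h k) t (h j)‖ ≤
      b * Real.exp (2 * κ * (1 + q) * m * t) := by
  classical
  set G := z • ∑ k ∈ S, h k with hG
  have hGs : star G = -G := star_smul_sum hh hz S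
  have hκ0 : 0 ≤ κ := (norm_nonneg _).trans (hκ j)
  let g : ℝ → J → 𝔄 := fun t j => flow G t (h j) * B - B * flow G t (h j)
  -- All weighted commutators form one vector-valued path; its supremum norm is the quantity
  -- controlled by Grönwall.
  let F : ℝ → J → 𝔄 := fun t j => w j • g t j
  let g' : ℝ → J → 𝔄 := fun t j => flow G t (h j * G - G * h j) * B
    - B * flow G t (h j * G - G * h j)
  have hF : ∀ t, HasDerivAt F (fun j => w j • g' t j) t := fun t =>
    hasDerivAt_pi.2 fun j => (((hasDerivAt_flow G (h j) t).mul_const B).sub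
      ((hasDerivAt_flow G (h j) t).const_mul B)).const_smul (w j)
  have hFn : ∀ t j, w j * ‖g t j‖ ≤ ‖F t‖ := by
    intro t j
    have := norm_le_pi_norm (F t) j
    rwa [norm_smul, Real.norm_of_nonneg (hw j).le] at this
  -- Only the neighbours of j fail to commute with `h j`, and the flow is an automorphism, so the
  -- derivative is a sum of double commutators of evolved terms.
  have hg' : ∀ t j, g' t j = z • ∑ k ∈ S with k ∈ N j,
      ((flow G t (h j) * flow G t (h k) - flow G t (h k) * flow G t (h j)) * B
        - B * (flow G t (h j) * flow G t (h k) - flow G t (h k) * flow G t (h j))) := by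
    intro t j
    have h1 : h j * G - G * h j = z • ∑ k ∈ S with k ∈ N j, (h j * h k - h k * h j) := by
      rw [hG, mul_smul_comm, smul_mul_assoc, ← smul_sub, Finset.mul_sum, Finset.sum_mul,
        ← Finset.sum_sub_distrib, Finset.sum_filter]
      congr 1
      refine Finset.sum_congr rfl fun k _ => ?_
      split_ifs with hk
      · rfl
      · rw [(hN j k hk).eq, sub_self]
    simp only [g']
    rw [h1]
    simp only [flow_smul, flow_sum, flow_sub, flow_mul, smul_mul_assoc, mul_smul_comm,
      ← smul_sub, Finset.sum_mul, Finset.mul_sum, ← Finset.sum_sub_distrib]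
  -- The Jacobi bound gives one commutator of `h k` and one of `h j`. Passing from the weight of j
  -- to that of k costs q for the former and nothing for the latter, hence the factor 1 + q.
  have hbound : ∀ t, ‖fun j => w j • g' t j‖ ≤ 2 * κ * (1 + q) * m * ‖F t‖ + 0 := by
    intro t
    rw [add_zero]
    refine (pi_norm_le_iff_of_nonneg (by positivity)).2 fun j => ?_
    rw [norm_smul, Real.norm_of_nonneg (hw j).le, hg', norm_smul, hz1, one_mul]
    have h1 : ∀ k ∈ S.filter (· ∈ N j), w j * ‖(flow G t (h j) * flow G t (h k)
        - flow G t (h k) * flow G t (h j)) * B - B * (flow G t (h j) * flow G t (h k)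
          - flow G t (h k) * flow G t (h j))‖ ≤ 2 * κ * (1 + q) * ‖F t‖ := by
      intro k hk
      have hk' := (Finset.mem_filter.1 hk).2
      have h2 := norm_commutator_commutator_le (flow G t (h j)) (flow G t (h k)) B
      rw [norm_flow hGs, norm_flow hGs] at h2
      have h3 : w j * ‖g t k‖ ≤ q * ‖F t‖ :=
        calc w j * ‖g t k‖ ≤ q * w k * ‖g t k‖ := by gcongr; exact hq j k hk'
          _ = q * (w k * ‖g t k‖) := by ring
          _ ≤ _ := by gcongr; exact hFn t k
      have h4 := hFn t j
      have h5 : 0 ≤ w j * ‖g t k‖ := by have := hw j; positivity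
      have h6 : 0 ≤ w j * ‖g t j‖ := by have := hw j; positivity
      calc _ ≤ w j * (2 * ‖h j‖ * ‖g t k‖ + 2 * ‖h k‖ * ‖g t j‖) := by
            gcongr
            exact (hw j).le
        _ = 2 * ‖h j‖ * (w j * ‖g t k‖) + 2 * ‖h k‖ * (w j * ‖g t j‖) := by ring
        _ ≤ 2 * κ * (q * ‖F t‖) + 2 * κ * ‖F t‖ := by
            have := hκ j; have := hκ k
            gcongr
        _ = _ := by ring
    calc _ ≤ w j * ∑ k ∈ S with k ∈ N j, ‖(flow G t (h j) * flow G t (h k)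
        - flow G t (h k) * flow G t (h j)) * B - B * (flow G t (h j) * flow G t (h k)
          - flow G t (h k) * flow G t (h j))‖ := by
          gcongr
          · exact (hw j).le
          · exact norm_sum_le _ _
      _ ≤ ∑ k ∈ S with k ∈ N j, 2 * κ * (1 + q) * ‖F t‖ := by
          rw [Finset.mul_sum]; exact Finset.sum_le_sum h1
      _ = (S.filter (· ∈ N j)).card * (2 * κ * (1 + q) * ‖F t‖) := by simp
      _ ≤ m * (2 * κ * (1 + q) * ‖F t‖) := by
          gcongr
          refine (Finset.card_le_card ?_).trans (hm j)
          intro k hk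
          exact (Finset.mem_filter.1 hk).2
      _ = _ := by ring
  have hF0 : ‖F 0‖ ≤ b := by
    refine (pi_norm_le_iff_of_nonneg hb0).2 fun j => ?_
    rw [norm_smul, Real.norm_of_nonneg (hw j).le]
    simpa [g, flow_zero] using hb j
  have := norm_le_gronwallBound_of_norm_deriv_right_le (a := 0) (b := t)
    (fun s _ => (hF s).continuousAt.continuousWithinAt) (fun s _ => (hF s).hasDerivWithinAt) hF0
    (fun s _ => hbound s) t ⟨ht, le_rfl⟩
  rw [gronwallBound_ε0, sub_zero] at this
  exact (hFn t j).trans this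

/-- Two dynamics whose generators differ by terms of large weight act nearly in the same way. -/
theorem norm_flow_neg_flow_sub_le [DecidableEq J] (hh : ∀ j, IsSelfAdjoint (h j)) (hz : star z = -z)
    (hz1 : ‖z‖ = 1)
    (S S' : Finset J) {κ : ℝ} (hκ : ∀ j, ‖h j‖ ≤ κ) (B : 𝔄) {w : J → ℝ} (hw : ∀ j, 0 < w j)
    {N : J → Finset J} (hN : ∀ j, ∀ k ∉ N j, Commute (h j) (h k)) {m : ℕ}
    (hm : ∀ j, (N j).card ≤ m) {q : ℝ} (hq0 : 0 ≤ q) (hq : ∀ j, ∀ k ∈ N j, w j ≤ q * w k) {b : ℝ}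
    (hb0 : 0 ≤ b) (hb : ∀ j, w j * ‖h j * B - B * h j‖ ≤ b) {τ : ℝ} (hτ : 0 ≤ τ) :
    ‖flow (z • ∑ k ∈ S, h k) (-τ) (flow (z • ∑ k ∈ S', h k) τ B) - B‖ ≤
      τ * (b * Real.exp (2 * κ * (1 + q) * m * τ) * ∑ j ∈ symmDiff S S', (w j)⁻¹) := by
  set G := z • ∑ k ∈ S, h k with hG
  set G' := z • ∑ k ∈ S', h k with hG'
  have hGs : star G = -G := star_smul_sum hh hz S
  have hGs' : star G' = -G' := star_smul_sum hh hz S'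
  -- Nonnegativity of κ is read off from one of the terms, so the empty family is separate.
  rcases isEmpty_or_nonempty J with hJ | ⟨⟨j₀⟩⟩
  · have h1 : G = 0 := by simp [hG, Finset.eq_empty_of_isEmpty]
    have h2 : G' = 0 := by simp [hG', Finset.eq_empty_of_isEmpty]
    simp [h1, h2, flow, Finset.eq_empty_of_isEmpty]
  have hκ0 : 0 ≤ κ := (norm_nonneg _).trans (hκ j₀)
  -- Undoing the flow of B moves it onto `h j` with the opposite generator, which is the preceding
  -- theorem with −z in place of z.
  have hcomm : ∀ t, 0 ≤ t → t ≤ τ → ∀ j, ‖h j * flow G' t B - flow G' t B * h j‖ ≤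
      b * Real.exp (2 * κ * (1 + q) * m * τ) * (w j)⁻¹ := by
    intro t ht htτ j
    have h1 : ‖h j * flow G' t B - flow G' t B * h j‖ =
        ‖flow (-G') t (h j) * B - B * flow (-G') t (h j)‖ := by
      rw [← norm_flow hGs' (-t), flow_sub, flow_mul, flow_mul, flow_neg_flow, flow_neg_left]
    have h2 := weighted_lieb_robinson (z := -z) hh (by simp [hz]) (by simpa using hz1) S' hκ B hw hN
      hm hq0 hq hb0 hb ht j
    rw [neg_smul, ← hG', ← h1] at h2
    have hw' := hw j
    rw [← div_eq_mul_inv, le_div_iff₀ hw', mul_comm]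
    refine h2.trans ?_
    gcongr
  -- Duhamel interpolation: the path is B at t = 0 and the doubly evolved operator at t = τ.
  have hder : ∀ t, HasDerivAt (fun t => flow G (-t) (flow G' t B))
      (flow G (-t) (flow G' t (B * G' - G' * B) + G * flow G' t B - flow G' t B * G)) t :=
    fun t => hasDerivAt_flow_neg_comp G (hasDerivAt_flow G' B t)
  -- G' is fixed by its own flow, so the derivative involves only the commutator with G − G'.
  have hG'f : ∀ t, flow G' t G' = G' := by
    intro t
    let _ : NormedAlgebra ℚ 𝔄 := NormedAlgebra.restrictScalars ℚ ℂ 𝔄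
    have : Commute (NormedSpace.exp ((-t) • G')) G' :=
      ((Commute.refl G').smul_left (-t)).exp_left
    rw [flow, this.eq, mul_assoc, exp_neg_mul_exp_smul, mul_one]
  have hbound : ∀ t, 0 ≤ t → t ≤ τ →
      ‖flow G (-t) (flow G' t (B * G' - G' * B) + G * flow G' t B - flow G' t B * G)‖ ≤
        b * Real.exp (2 * κ * (1 + q) * m * τ) * ∑ j ∈ symmDiff S S', (w j)⁻¹ := by
    intro t ht htτ
    rw [norm_flow hGs, flow_sub, flow_mul, flow_mul, hG'f]
    set X := flow G' t B with hX
    have h1 : X * G' - G' * X + G * X - X * G = (G - G') * X - X * (G - G') := by noncomm_ring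
    have h2 : G - G' = z • (∑ j ∈ S \ S', h j - ∑ j ∈ S' \ S, h j) := by
      rw [hG, hG', ← smul_sub, ← Finset.sum_sdiff_sub_sum_sdiff]
    rw [h1, h2, smul_mul_assoc, mul_smul_comm, ← smul_sub, norm_smul, hz1, one_mul]
    have h3 : (∑ j ∈ S \ S', h j - ∑ j ∈ S' \ S, h j) * X - X * (∑ j ∈ S \ S', h j
        - ∑ j ∈ S' \ S, h j) = ∑ j ∈ S \ S', (h j * X - X * h j)
          - ∑ j ∈ S' \ S, (h j * X - X * h j) := by
      simp only [sub_mul, mul_sub, Finset.sum_mul, Finset.mul_sum, Finset.sum_sub_distrib]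
      abel
    have h4 : symmDiff S S' = (S \ S').disjUnion (S' \ S) disjoint_sdiff_sdiff := by
      rw [Finset.disjUnion_eq_union]; rfl
    rw [h3, h4, Finset.sum_disjUnion, mul_add, Finset.mul_sum, Finset.mul_sum]
    refine (norm_sub_le _ _).trans (add_le_add ?_ ?_) <;>
      exact (norm_sum_le _ _).trans (Finset.sum_le_sum fun j _ => hcomm t ht htτ j)
  have := norm_image_sub_le_of_norm_deriv_le_segment' (a := 0) (b := τ)
    (fun t _ => (hder t).hasDerivWithinAt) (fun t ht => hbound t ht.1 ht.2.le) τ ⟨hτ, le_rfl⟩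
  rw [neg_zero, flow_zero, flow_zero, sub_zero, mul_comm] at this
  exact this

end Dynamics

/-! ### Geometry of the ring -/

section Sites

variable {L : ℕ}

lemma shift_shift (a : Fin L) (j k : ℕ) : shift (shift a j) k = shift a (j + k) := by
  simp [shift, add_assoc]

lemma shift_zero (a : Fin L) : shift a 0 = a := by
  ext
  simp [shift, Nat.mod_eq_of_lt a.isLt]

lemma shift_congr_int (a : Fin L) (k : ℕ) : ((shift a k : Fin L) : ℤ) ≡ a + k [ZMOD L] := by
  simp only [shift]
  push_cast
  exact Int.mod_modEq _ _

lemma eq_of_int_modEq {x y : Fin L} (h : (x : ℤ) ≡ y [ZMOD L]) : x = y := by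
  have h' : (x : ℕ) ≡ y [MOD L] := Int.natCast_modEq_iff.1 h
  exact Fin.ext (h'.eq_of_lt_of_lt x.isLt y.isLt)

lemma shift_injective (a : Fin L) {j k : ℕ} (hj : j < L) (hk : k < L)
    (h : shift a j = shift a k) : j = k := by
  have h1 := (shift_congr_int a j).symm.trans ((congr_arg (fun x : Fin L => (x : ℤ)) h) ▸
    shift_congr_int a k)
  have h2 : (j : ℤ) ≡ k [ZMOD L] := Int.ModEq.add_left_cancel' _ h1
  exact (Int.natCast_modEq_iff.1 h2).eq_of_lt_of_lt hj hk

/-- Replaces the minimum of two remainders by an integer displacement modulo L. The triangle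
inequality and the counting of balls then become statements about integers. -/
lemma siteDist_le_iff {x y : Fin L} {m : ℕ} :
    siteDist x y ≤ m ↔ ∃ k : ℤ, |k| ≤ m ∧ (y : ℤ) ≡ x + k [ZMOD L] := by
  have hx := x.isLt
  have hy := y.isLt
  constructor
  · intro h
    unfold siteDist at h
    rcases min_le_iff.1 h with h | h
    · refine ⟨-(((x.val + (L - y.val)) % L : ℕ) : ℤ), by rw [abs_neg, Nat.abs_cast]; exact_mod_cast h, ?_⟩
      have h1 : (((x.val + (L - y.val)) % L : ℕ) : ℤ) ≡ x + (L - y) [ZMOD L] := by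
        push_cast [Nat.cast_sub hy.le]
        exact Int.mod_modEq _ _
      have h2 := (Int.ModEq.refl (x : ℤ)).sub h1
      rw [← sub_eq_add_neg]
      refine Int.ModEq.trans ?_ h2.symm
      refine Int.modEq_iff_dvd.2 ⟨-1, by ring⟩
    · refine ⟨(((y.val + (L - x.val)) % L : ℕ) : ℤ), by rw [Nat.abs_cast]; exact_mod_cast h, ?_⟩
      have h1 : (((y.val + (L - x.val)) % L : ℕ) : ℤ) ≡ y + (L - x) [ZMOD L] := by
        push_cast [Nat.cast_sub hx.le]
        exact Int.mod_modEq _ _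
      refine Int.ModEq.trans ?_ ((Int.ModEq.refl (x : ℤ)).add h1).symm
      refine Int.modEq_iff_dvd.2 ⟨1, by ring⟩
  · rintro ⟨k, hk, h⟩
    unfold siteDist
    rw [abs_le] at hk
    rcases le_total 0 k with h0 | h0
    · lift k to ℕ using h0
      refine (min_le_right _ _).trans ?_
      have h1 : ((y.val + (L - x.val) : ℕ) : ℤ) ≡ (k : ℕ) [ZMOD L] := by
        push_cast [Nat.cast_sub hx.le]
        refine (h.add_right _).trans (Int.modEq_iff_dvd.2 ⟨-1, by ring⟩)
      have h2 : (y.val + (L - x.val)) % L = k % L := Int.natCast_modEq_iff.1 h1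
      rw [h2]
      exact (Nat.mod_le _ _).trans (by exact_mod_cast hk.2)
    · obtain ⟨k, rfl⟩ : ∃ k' : ℤ, k = -k' := ⟨-k, by ring⟩
      lift k to ℕ using (by omega)
      refine (min_le_left _ _).trans ?_
      have h1 : ((x.val + (L - y.val) : ℕ) : ℤ) ≡ (k : ℕ) [ZMOD L] := by
        push_cast [Nat.cast_sub hy.le]
        refine (((Int.ModEq.refl (L : ℤ)).sub h).add_left _).trans
          (Int.modEq_iff_dvd.2 ⟨-1, by ring⟩)
      have h2 : (x.val + (L - y.val)) % L = k % L := Int.natCast_modEq_iff.1 h1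
      rw [h2]
      exact (Nat.mod_le _ _).trans (by omega)

lemma siteDist_triangle (x y z : Fin L) : siteDist x z ≤ siteDist x y + siteDist y z := by
  obtain ⟨k, hk, h⟩ := siteDist_le_iff.1 (le_refl (siteDist x y))
  obtain ⟨k', hk', h'⟩ := siteDist_le_iff.1 (le_refl (siteDist y z))
  refine siteDist_le_iff.2 ⟨k + k', (abs_add_le _ _).trans (by push_cast; exact add_le_add hk hk'),
    h'.trans ?_⟩
  rw [← add_assoc]
  exact h.add_right _

lemma siteDist_comm (x y : Fin L) : siteDist x y = siteDist y x := min_comm _ _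

lemma siteDist_self (x : Fin L) : siteDist x x = 0 :=
  Nat.le_zero.1 (siteDist_le_iff.2 ⟨0, by simp⟩)

lemma siteDist_shift_le (a : Fin L) (k : ℕ) : siteDist a (shift a k) ≤ k :=
  siteDist_le_iff.2 ⟨k, by simp, shift_congr_int a k⟩

lemma siteDist_le_of_shift_eq {a b : Fin L} {j k m : ℕ} (hj : j ≤ m) (hk : k ≤ m)
    (h : shift a j = shift b k) : siteDist a b ≤ m := by
  refine siteDist_le_iff.2 ⟨(j : ℤ) - k, by rw [abs_le]; constructor <;> omega, ?_⟩
  have h1 := (shift_congr_int b k).symm.trans (h ▸ shift_congr_int a j)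
  have h2 := h1.sub_right (k : ℤ)
  rwa [add_sub_cancel_right, add_sub_assoc] at h2

/-- A site is determined by its displacement from x, which can be chosen in [−m, m]. -/
lemma card_siteDist_le (x : Fin L) (m : ℕ) :
    (Finset.univ.filter fun y => siteDist x y ≤ m).card ≤ 2 * m + 1 := by
  have hcard : (Finset.Icc (-(m : ℤ)) m).card = 2 * m + 1 := by
    rw [Int.card_Icc]; omega
  rw [← hcard]
  choose! f hf using fun (y : Fin L) (h : siteDist x y ≤ m) => siteDist_le_iff.1 h
  refine Finset.card_le_card_of_injOn f (fun y hy => ?_) (fun y hy y' hy' h => ?_)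
  · have := (hf y (by simpa using hy)).1
    rw [abs_le] at this
    simpa using this
  · have h1 := (hf y (by simpa using hy)).2
    have h2 := (hf y' (by simpa using hy')).2
    rw [← h] at h2
    exact eq_of_int_modEq (h1.trans h2.symm)

lemma setDist_le {X Y : Set (Fin L)} {x y : Fin L} (hx : x ∈ X) (hy : y ∈ Y) :
    setDist X Y ≤ siteDist x y := Nat.sInf_le ⟨x, hx, y, hy, rfl⟩

lemma exists_setDist {X Y : Set (Fin L)} (hX : X.Nonempty) (hY : Y.Nonempty) :
    ∃ x ∈ X, ∃ y ∈ Y, setDist X Y = siteDist x y := by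
  obtain ⟨x, hx⟩ := hX
  obtain ⟨y, hy⟩ := hY
  exact Nat.sInf_mem (s := {n | ∃ x ∈ X, ∃ y ∈ Y, n = siteDist x y}) ⟨_, x, hx, y, hy, rfl⟩

lemma setDist_singleton_le {Y : Set (Fin L)} (hY : Y.Nonempty) (x x' : Fin L) :
    setDist {x} Y ≤ siteDist x x' + setDist {x'} Y := by
  obtain ⟨_, rfl, y, hy, h⟩ := exists_setDist (Set.singleton_nonempty x') hY
  rw [h]
  exact (setDist_le (Set.mem_singleton x) hy).trans (siteDist_triangle _ _ _)

lemma setDist_singleton_singleton (x y : Fin L) : setDist {x} {y} = siteDist x y := by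
  obtain ⟨_, rfl, _, rfl, h⟩ := exists_setDist (Set.singleton_nonempty x) (Set.singleton_nonempty y)
  exact h

/-- The distance is one of two cyclic displacements, and each of these runs once over 0, …, L−1 as z
varies. Two geometric series give a bound independent of L. -/
lemma sum_pow_siteDist_le {r : ℝ} (h0 : 0 ≤ r) (h1 : r < 1) (i : Fin L) :
    ∑ z : Fin L, r ^ siteDist z i ≤ 2 * (1 - r)⁻¹ := by
  have hgeom : ∑ k : Fin L, r ^ (k : ℕ) ≤ (1 - r)⁻¹ := by
    rw [Fin.sum_univ_eq_sum_range (fun k => r ^ k) L, ← tsum_geometric_of_lt_one h0 h1]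
    exact (summable_geometric_of_lt_one h0 h1).sum_le_tsum _ fun k _ => pow_nonneg h0 k
  have hi := i.isLt
  have hf : Function.Injective fun z : Fin L => shift z (L - i.val) := by
    intro z z' h
    have h2 := (shift_congr_int z (L - i.val)).symm.trans
      ((congr_arg (fun x : Fin L => (x : ℤ)) h) ▸ shift_congr_int z' (L - i.val))
    exact eq_of_int_modEq (Int.ModEq.add_right_cancel' _ h2)
  have hg : Function.Injective fun z : Fin L => shift i (L - z.val) := by
    intro z z' h
    have h2 := (shift_congr_int i (L - z.val)).symm.trans
      ((congr_arg (fun x : Fin L => (x : ℤ)) h) ▸ shift_congr_int i (L - z'.val))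
    have h3 := Int.ModEq.add_left_cancel' _ h2
    rw [Nat.cast_sub z.isLt.le, Nat.cast_sub z'.isLt.le] at h3
    have h4 := (Int.ModEq.refl (L : ℤ)).sub h3
    exact eq_of_int_modEq (by simpa using h4)
  have hle : ∀ z : Fin L, r ^ siteDist z i ≤
      r ^ (shift z (L - i.val)).val + r ^ (shift i (L - z.val)).val := by
    intro z
    unfold siteDist
    rcases min_choice ((z.val + (L - i.val)) % L) ((i.val + (L - z.val)) % L) with h | h <;>
      rw [h]
    · exact le_add_of_nonneg_right (pow_nonneg h0 _)
    · exact le_add_of_nonneg_left (pow_nonneg h0 _)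
  calc _ ≤ ∑ z : Fin L, (r ^ (shift z (L - i.val)).val + r ^ (shift i (L - z.val)).val) :=
        Finset.sum_le_sum fun z _ => hle z
    _ = ∑ k : Fin L, r ^ (k : ℕ) + ∑ k : Fin L, r ^ (k : ℕ) := by
        rw [Finset.sum_add_distrib,
          Function.Bijective.sum_comp (Finite.injective_iff_bijective.1 hf)
            (fun k : Fin L => r ^ (k : ℕ)),
          Function.Bijective.sum_comp (Finite.injective_iff_bijective.1 hg)
            (fun k : Fin L => r ^ (k : ℕ))]
    _ ≤ _ := by linarith

end Sites

/-! ### Local algebras and commutation at disjoint supports -/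

section LocalAlgebras

variable {L : ℕ}

/-- The algebra generated by the operators `c_{iσ}`, `c_{iσ}†` with `i ∈ S`. -/
def localAlg (S : Set (Fin L)) : Subalgebra ℂ (FockOp (Mode L)) :=
  Algebra.adjoin ℂ {x | ∃ i ∈ S, ∃ σ, x = annihilate (toLex (i, σ)) ∨ x = create (toLex (i, σ))}

lemma localAlg_mono {S T : Set (Fin L)} (h : S ⊆ T) : localAlg S ≤ localAlg T :=
  Algebra.adjoin_mono fun _ ⟨i, hi, hx⟩ => ⟨i, h hi, hx⟩

lemma annihilate_mem_localAlg {S : Set (Fin L)} {i : Fin L} (hi : i ∈ S) (σ : Fin 2) :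
    annihilate (toLex (i, σ)) ∈ localAlg S :=
  Algebra.subset_adjoin ⟨i, hi, σ, Or.inl rfl⟩

lemma create_mem_localAlg {S : Set (Fin L)} {i : Fin L} (hi : i ∈ S) (σ : Fin 2) :
    create (toLex (i, σ)) ∈ localAlg S :=
  Algebra.subset_adjoin ⟨i, hi, σ, Or.inr rfl⟩

lemma evenOn_le_localAlg (S : Set (Fin L)) : evenOn S ≤ localAlg S := by
  refine Algebra.adjoin_le ?_
  rintro x ⟨a, b, ⟨i, hi, σ, ha⟩, ⟨j, hj, σ', hb⟩, rfl⟩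
  exact mul_mem (Algebra.subset_adjoin ⟨i, hi, σ, ha⟩) (Algebra.subset_adjoin ⟨j, hj, σ', hb⟩)

lemma evenOn_mono {S T : Set (Fin L)} (h : S ⊆ T) : evenOn S ≤ evenOn T :=
  Algebra.adjoin_mono fun _ ⟨a, b, ⟨i, hi, ha⟩, ⟨j, hj, hb⟩, hx⟩ =>
    ⟨a, b, ⟨i, h hi, ha⟩, ⟨j, h hj, hb⟩, hx⟩

lemma anticommute_of_ne {ι : Type*} [Fintype ι] [LinearOrder ι] {μ ν : ι} (h : μ ≠ ν)
    {a b : FockOp ι} (ha : a = annihilate μ ∨ a = create μ) (hb : b = annihilate ν ∨ b = create ν) :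
    a * b = -(b * a) := by
  have hc := isCAR_annihilate (ι := ι)
  rcases ha with rfl | rfl <;> rcases hb with rfl | rfl
  · exact hc.swap μ ν
  · exact hc.mul_star_of_ne h
  · have := hc.mul_star_of_ne h.symm
    rw [Matrix.star_eq_conjTranspose, conjTranspose_annihilate] at this
    rw [this, neg_neg]
  · exact hc.swap_star μ ν

/-- Passing a generator at another site through a product of two costs two signs. Evenness is needed
on one side only; the other may be a single fermion operator, as for the matrix units of a mode. -/
lemma commute_of_disjoint {S T : Set (Fin L)} (h : Disjoint S T) {x y : FockOp (Mode L)}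
    (hx : x ∈ evenOn S) (hy : y ∈ localAlg T) : Commute x y := by
  induction hx using Algebra.adjoin_induction with
  | algebraMap r => exact Algebra.commutes r y
  | add x x' _ _ h1 h2 => exact h1.add_left h2
  | mul x x' _ _ h1 h2 => exact h1.mul_left h2
  | mem x hx =>
    obtain ⟨a, b, ⟨i, hi, σ, ha⟩, ⟨j, hj, σ', hb⟩, rfl⟩ := hx
    induction hy using Algebra.adjoin_induction with
    | algebraMap r => exact (Algebra.commutes r _).symm
    | add y y' _ _ h1 h2 => exact h1.add_right h2
    | mul y y' _ _ h1 h2 => exact h1.mul_right h2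
    | mem y hy =>
      obtain ⟨k, hk, σ'', hy⟩ := hy
      have hik : (toLex (i, σ) : Mode L) ≠ toLex (k, σ'') := by
        intro he
        have : i = k := congr_arg (fun p : Mode L => (ofLex p).1) he
        exact Set.disjoint_left.1 h hi (this ▸ hk)
      have hjk : (toLex (j, σ') : Mode L) ≠ toLex (k, σ'') := by
        intro he
        have : j = k := congr_arg (fun p : Mode L => (ofLex p).1) he
        exact Set.disjoint_left.1 h hj (this ▸ hk)
      change a * b * y = y * (a * b)
      rw [mul_assoc, anticommute_of_ne hjk hb hy, mul_neg, ← mul_assoc,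
        anticommute_of_ne hik ha hy, neg_mul, neg_neg, mul_assoc]

lemma commute_parity_of_mem_evenOn {S : Set (Fin L)} {x : FockOp (Mode L)} (hx : x ∈ evenOn S) :
    Commute (parity (Mode L)) x := by
  induction hx using Algebra.adjoin_induction with
  | algebraMap r => exact (Algebra.commutes r _).symm
  | add x x' _ _ h1 h2 => exact h1.add_right h2
  | mul x x' _ _ h1 h2 => exact h1.mul_right h2
  | mem x hx =>
    obtain ⟨a, b, ⟨i, hi, σ, ha⟩, ⟨j, hj, σ', hb⟩, rfl⟩ := hx
    have key : ∀ (μ : Mode L) (a : FockOp (Mode L)), a = annihilate μ ∨ a = create μ →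
        parity (Mode L) * a = -(a * parity (Mode L)) := by
      rintro μ a (rfl | rfl)
      · exact parity_mul_annihilate μ
      · exact parity_mul_create μ
    change _ * _ = _ * _
    rw [← mul_assoc, key _ a ha, neg_mul, mul_assoc, key _ b hb, mul_neg, neg_neg, mul_assoc]

/-- The sites `i, i+1, …, i+n-1`. -/
def block (i : Fin L) (n : ℕ) : Set (Fin L) := {x | ∃ k < n, x = shift i k}

lemma place_mem_evenOn {n : ℕ} (i : Fin L) {x : FPoly n} (hx : x ∈ evenPoly n) :
    place i x ∈ evenOn (block i n) := by
  induction hx using Algebra.adjoin_induction with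
  | algebraMap r => rw [AlgHom.commutes]; exact algebraMap_mem _ r
  | add x x' _ _ h1 h2 => rw [map_add]; exact add_mem h1 h2
  | mul x x' _ _ h1 h2 => rw [map_mul]; exact mul_mem h1 h2
  | mem x hx =>
    obtain ⟨a, b, rfl⟩ := hx
    have key : ∀ a : Fin n × Fin 2 × Bool, ∃ j ∈ block i n, ∃ σ,
        place i (FreeAlgebra.ι ℂ a) = annihilate (toLex (j, σ)) ∨
          place i (FreeAlgebra.ι ℂ a) = create (toLex (j, σ)) := by
      rintro ⟨k, σ, t⟩
      refine ⟨shift i k, ⟨k, k.isLt, rfl⟩, σ, ?_⟩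
      rw [place, FreeAlgebra.lift_ι_apply]
      cases t
      · left; simp
      · right; simp
    rw [map_mul]
    exact Algebra.subset_adjoin ⟨_, _, key a, key b, rfl⟩

end LocalAlgebras

/-! ### Embedding an open chain into the ring -/

section Window

variable {L n : ℕ}

/-- For n ≤ L the shifted sites are distinct. A window may wrap around the ring and then does not
preserve the order of the modes; only the relations matter, so no Jordan–Wigner strings have to be
compared. -/
lemma isCAR_window (hn : n ≤ L) (b : Fin L) :
    IsCAR fun p : Mode n => annihilate (toLex (shift b (ofLex p).1.val, (ofLex p).2) : Mode L) where
  anti p q := isCAR_annihilate.anti _ _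
  anti_star p q := by
    rw [isCAR_annihilate.anti_star]
    refine if_congr ⟨fun h => ?_, fun h => by rw [h]⟩ rfl rfl
    have h1 : shift b (ofLex p).1.val = shift b (ofLex q).1.val :=
      congr_arg (fun p : Mode L => (ofLex p).1) h
    have h2 : (ofLex p).2 = (ofLex q).2 := congr_arg (fun p : Mode L => (ofLex p).2) h
    have h3 := shift_injective b ((ofLex p).1.isLt.trans_le hn) ((ofLex q).1.isLt.trans_le hn) h1
    exact ofLex.injective (Prod.ext (Fin.ext h3) h2)

/-- The embedding of the operators of an open chain of `n` sites into those of the periodic chain of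
`L` sites which puts the sites at `b, b+1, …, b+n-1`. -/
def window (hn : n ≤ L) (b : Fin L) : FockOp (Mode n) →⋆ₐ[ℂ] FockOp (Mode L) :=
  (isCAR_window hn b).rep

lemma window_annihilate (hn : n ≤ L) (b : Fin L) (k : Fin n) (σ : Fin 2) :
    window hn b (annihilate (toLex (k, σ))) = annihilate (toLex (shift b k, σ)) :=
  (isCAR_window hn b).rep_annihilate _

lemma window_create (hn : n ≤ L) (b : Fin L) (k : Fin n) (σ : Fin 2) :
    window hn b (create (toLex (k, σ))) = create (toLex (shift b k, σ)) :=
  (isCAR_window hn b).rep_create _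

/-- The condition j + m ≤ n keeps the translated polynomial from wrapping around in the small chain,
whose sites 0 and n−1 need not be neighbours in the ring. -/
lemma window_place (hn : n ≤ L) (b : Fin L) {m : ℕ} (j : Fin n) (hj : j.val + m ≤ n) (x : FPoly m) :
    window hn b (place j x) = place (shift b j) x := by
  have : ((window hn b : FockOp (Mode n) →⋆ₐ[ℂ] FockOp (Mode L)).toAlgHom.comp (place j) :
      FPoly m →ₐ[ℂ] FockOp (Mode L)) = place (shift b j) := by
    refine FreeAlgebra.hom_ext (funext fun g => ?_)
    obtain ⟨k, σ, t⟩ := g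
    have hk : ((shift j k : Fin n) : ℕ) = j + k :=
      Nat.mod_eq_of_lt (by have := k.isLt; omega)
    change window hn b (place j (FreeAlgebra.ι ℂ (k, σ, t)))
      = place (shift b j) (FreeAlgebra.ι ℂ (k, σ, t))
    rw [place, place, FreeAlgebra.lift_ι_apply, FreeAlgebra.lift_ι_apply]
    cases t
    · simp only [Bool.false_eq_true, if_false]
      rw [window_annihilate, hk, shift_shift]
    · simp only [if_true]
      rw [window_create, hk, shift_shift]
  exact DFunLike.congr_fun this x

/-- Self-adjointness, unitarity and norm bounds, known for the operator on its own m+1 sites, pass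
to every position in every ring. -/
lemma place_eq_window {m : ℕ} (hm : m + 1 ≤ L) (i : Fin L) (x : FPoly (m + 1)) :
    place i x = window hm i (place (0 : Fin (m + 1)) x) := by
  rw [window_place hm i 0 (by simp)]
  simp [shift_zero]

lemma IsSelfAdjointPoly.place {m : ℕ} (hm : m + 1 ≤ L) (i : Fin L) {x : FPoly (m + 1)}
    (hx : IsSelfAdjointPoly x) : IsSelfAdjoint (place i x) := by
  rw [place_eq_window hm]
  exact IsSelfAdjoint.map (show IsSelfAdjoint (LVQC.place (0 : Fin (m + 1)) x) from hx) _

lemma IsUnitaryPoly.place {m : ℕ} (hm : m + 1 ≤ L) (i : Fin L) {x : FPoly (m + 1)}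
    (hx : IsUnitaryPoly x) : place i x ∈ unitary (FockOp (Mode L)) := by
  rw [place_eq_window hm]
  exact Unitary.map_mem _ hx

open scoped Matrix.Norms.L2Operator in
lemma norm_place_le {m : ℕ} (hm : m + 1 ≤ L) (i : Fin L) (x : FPoly (m + 1)) :
    ‖place i x‖ ≤ ‖place (0 : Fin (m + 1)) x‖ := by
  rw [place_eq_window hm]
  exact NonUnitalStarAlgHom.norm_apply_le _ _

lemma window_mem_localAlg (hn : n ≤ L) (b : Fin L) {S : Set (Fin n)} {T : Set (Fin L)}
    (h : ∀ k ∈ S, shift b k.val ∈ T) {x : FockOp (Mode n)} (hx : x ∈ localAlg S) :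
    window hn b x ∈ localAlg T := by
  induction hx using Algebra.adjoin_induction with
  | algebraMap r => rw [AlgHomClass.commutes]; exact algebraMap_mem _ r
  | add x x' _ _ h1 h2 => rw [map_add]; exact add_mem h1 h2
  | mul x x' _ _ h1 h2 => rw [map_mul]; exact mul_mem h1 h2
  | mem x hx =>
    obtain ⟨k, hk, σ, rfl | rfl⟩ := hx
    · rw [window_annihilate]; exact annihilate_mem_localAlg (h k hk) σ
    · rw [window_create]; exact create_mem_localAlg (h k hk) σ

end Window

/-! ### Truncated dynamics on the ring and the Lieb–Robinson bound -/

section ChainDynamics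

open scoped Matrix.Norms.L2Operator

variable {dH L : ℕ} {h : FPoly (dH + 1)}

/-- The generator `z ∑_{j ∈ S} h_j`. -/
def generator (h : FPoly (dH + 1)) (z : ℂ) (S : Finset (Fin L)) : FockOp (Mode L) :=
  z • ∑ j ∈ S, place j h

lemma generator_neg (z : ℂ) (S : Finset (Fin L)) : generator h (-z) S = -generator h z S := by
  simp [generator]

lemma star_generator (hsa : IsSelfAdjointPoly h) (hL : dH + 1 ≤ L) {z : ℂ} (hz : star z = -z)
    (S : Finset (Fin L)) : star (generator h z S) = -generator h z S :=
  star_smul_sum (fun j => hsa.place hL j) hz S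

lemma star_neg_I : star (-Complex.I) = - -Complex.I := by simp

lemma star_I : star Complex.I = -Complex.I := by simp

lemma evolve_eq_exp (τ : ℝ) :
    evolve h L τ = NormedSpace.exp (τ • generator h (-Complex.I) (Finset.univ : Finset (Fin L))) := by
  rw [evolve, generator, hamiltonian, ← Complex.coe_smul, smul_smul, mul_comm (τ : ℂ)]

lemma conjTranspose_evolve (hsa : IsSelfAdjointPoly h) (hL : dH + 1 ≤ L) (τ : ℝ) :
    (evolve h L τ)ᴴ =
      NormedSpace.exp ((-τ) • generator h (-Complex.I) (Finset.univ : Finset (Fin L))) := by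
  rw [evolve_eq_exp, ← Matrix.star_eq_conjTranspose, NormedSpace.star_exp, star_smul,
    star_generator hsa hL star_neg_I]
  simp

lemma evolve_conj (hsa : IsSelfAdjointPoly h) (hL : dH + 1 ≤ L) (τ : ℝ) (A : FockOp (Mode L)) :
    (evolve h L τ)ᴴ * A * evolve h L τ =
      flow (generator h (-Complex.I) (Finset.univ : Finset (Fin L))) τ A := by
  rw [conjTranspose_evolve hsa hL, evolve_eq_exp, flow]

lemma evolve_mem_unitary (hsa : IsSelfAdjointPoly h) (hL : dH + 1 ≤ L) (τ : ℝ) :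
    evolve h L τ ∈ unitary (FockOp (Mode L)) := by
  rw [evolve_eq_exp]
  exact exp_smul_mem_unitary (star_generator hsa hL star_neg_I _) τ

lemma block_disjoint {j k : Fin L} (hjk : ¬ siteDist j k ≤ dH) :
    Disjoint (block j (dH + 1)) (block k (dH + 1)) := by
  rw [Set.disjoint_left]
  rintro x ⟨p, hp, rfl⟩ ⟨q, hq, hpq⟩
  exact hjk (siteDist_le_of_shift_eq (Nat.lt_succ_iff.1 hp) (Nat.lt_succ_iff.1 hq) hpq)

/-- Truncations of the Hamiltonian hardly change the dynamics far from the removed terms. -/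
theorem norm_generator_flow_sub_le (hev : h ∈ evenPoly (dH + 1)) (hsa : IsSelfAdjointPoly h)
    (hL : dH + 1 ≤ L) {z : ℂ} (hz : star z = -z) (hz1 : ‖z‖ = 1) (S S' : Finset (Fin L))
    {Y : Set (Fin L)} (hY : Y.Nonempty) {B : FockOp (Mode L)} (hB : B ∈ localAlg Y) {μ : ℝ}
    (hμ : 0 ≤ μ) {τ : ℝ} (hτ : 0 ≤ τ) :
    ‖flow (generator h z S) (-τ) (flow (generator h z S') τ B) - B‖ ≤
      τ * (Real.exp (μ * dH) * (2 * ‖place (0 : Fin (dH + 1)) h‖ * ‖B‖) *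
        Real.exp (2 * ‖place (0 : Fin (dH + 1)) h‖ * (1 + Real.exp (μ * dH)) *
          (2 * dH + 1 : ℕ) * τ) *
        ∑ j ∈ symmDiff S S', (Real.exp (μ * setDist {j} Y))⁻¹) := by
  -- The weight of j is exp(μ·dist(j, Y)). Terms that fail to commute start within distance dH of
  -- each other, so each has at most 2dH+1 neighbours and weights of neighbours have ratio at most
  -- exp(μ·dH).
  refine norm_flow_neg_flow_sub_le (fun j => hsa.place hL j) hz hz1 S S'
    (fun j => norm_place_le hL j h) B (fun j => Real.exp_pos _)
    (N := fun j => Finset.univ.filter fun k => siteDist j k ≤ dH) (fun j k hk => ?_)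
    (fun j => card_siteDist_le j dH) (Real.exp_pos _).le (fun j k hk => ?_) (by positivity)
    (fun j => ?_) hτ
  · exact commute_of_disjoint (block_disjoint (by simpa using hk)) (place_mem_evenOn j hev)
      (evenOn_le_localAlg _ (place_mem_evenOn k hev))
  · rw [← Real.exp_add, ← mul_add]
    have h1 : siteDist j k ≤ dH := by simpa using hk
    have h2 := setDist_singleton_le hY j k
    gcongr
    exact_mod_cast h2.trans (by omega)
  -- At time zero only terms meeting Y contribute; these start within dH of Y, so their weight is at
  -- most exp(μ·dH).
  · by_cases hd : Disjoint (block j (dH + 1)) Y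
    · rw [(commute_of_disjoint hd (place_mem_evenOn j hev) hB).eq, sub_self, norm_zero, mul_zero]
      positivity
    · obtain ⟨y, ⟨k, hk, rfl⟩, hy⟩ := Set.not_disjoint_iff.1 hd
      have h1 : setDist {j} Y ≤ dH := (setDist_le (Set.mem_singleton j) hy).trans
        ((siteDist_shift_le j k).trans (by omega))
      have h2 : ‖place j h * B - B * place j h‖ ≤ 2 * ‖place (0 : Fin (dH + 1)) h‖ * ‖B‖ := by
        have h3 := norm_place_le hL j h
        refine (norm_sub_le _ _).trans ?_
        have h4 := norm_mul_le (place j h) B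
        have h5 := norm_mul_le B (place j h)
        nlinarith [mul_le_mul_of_nonneg_right h3 (norm_nonneg B)]
      gcongr

open Classical in
/-- The terms of the Hamiltonian that cross the boundary of `X`. -/
def crossing (dH : ℕ) (X : Set (Fin L)) : Finset (Fin L) :=
  Finset.univ.filter fun j => ¬ block j (dH + 1) ⊆ X ∧ ¬ Disjoint (block j (dH + 1)) X

lemma mem_crossing {X : Set (Fin L)} {j : Fin L} :
    j ∈ crossing dH X ↔ ¬ block j (dH + 1) ⊆ X ∧ ¬ Disjoint (block j (dH + 1)) X := by
  simp [crossing]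

/-- A block can enter the interval only at its first site and leave it only at its last one. A
crossing block therefore starts within dH of one of the two ends, whatever the length of the
interval. -/
lemma card_crossing_le {X : Set (Fin L)} (hX : IsDomain X) :
    (crossing dH X).card ≤ 2 * (2 * dH + 1) := by
  obtain ⟨a, n, rfl⟩ := hX
  have hsub : crossing dH {x | ∃ k ≤ n, x = shift a k} ⊆
      (Finset.univ.filter fun j => siteDist a j ≤ dH) ∪
        (Finset.univ.filter fun j => siteDist (shift a n) j ≤ dH) := by
    intro j hj
    obtain ⟨h1, h2⟩ := mem_crossing.1 hj
    obtain ⟨x, ⟨p, hp, rfl⟩, hpX⟩ := Set.not_subset.1 h1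
    obtain ⟨y, ⟨q, hq, rfl⟩, hqX⟩ := Set.not_disjoint_iff.1 h2
    rw [Finset.mem_union, Finset.mem_filter, Finset.mem_filter]
    by_contra! hc
    have h3 := hc.1 (Finset.mem_univ _)
    have h4 := hc.2 (Finset.mem_univ _)
    -- Away from both ends, membership in X does not change between consecutive sites of the block.
    have hstep : ∀ k < dH, (shift j k ∈ {x | ∃ k ≤ n, x = shift a k} ↔
        shift j (k + 1) ∈ {x | ∃ k ≤ n, x = shift a k}) := by
      intro k hk
      constructor
      · rintro ⟨m, hm, hjm⟩
        rcases hm.lt_or_eq with hm | rfl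
        · exact ⟨m + 1, hm, by rw [← shift_shift, ← shift_shift, hjm]⟩
        · rw [← hjm, siteDist_comm] at h4
          exact absurd (siteDist_shift_le j k) (by omega)
      · rintro ⟨m, hm, hjm⟩
        rcases m with _ | m
        · rw [shift_zero] at hjm
          rw [← hjm, siteDist_comm] at h3
          exact absurd (siteDist_shift_le j (k + 1)) (by omega)
        · refine ⟨m, by omega, ?_⟩
          have h5 := (shift_congr_int j (k + 1)).symm.trans
            ((congr_arg (fun x : Fin L => (x : ℤ)) hjm) ▸ shift_congr_int a (m + 1))
          push_cast at h5
          rw [← add_assoc, ← add_assoc] at h5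
          exact eq_of_int_modEq ((shift_congr_int j k).trans
            ((Int.ModEq.add_right_cancel' _ h5).trans (shift_congr_int a m).symm))
    have hall : ∀ k ≤ dH, (shift j k ∈ {x | ∃ k ≤ n, x = shift a k} ↔
        shift j 0 ∈ {x | ∃ k ≤ n, x = shift a k}) := by
      intro k
      induction k with
      | zero => simp
      | succ k ih => intro hk; rw [← hstep k hk, ih (by omega)]
    exact hpX ((hall p (by omega)).2 ((hall q (by omega)).1 hqX))
  refine (Finset.card_le_card hsub).trans ((Finset.card_union_le _ _).trans ?_)
  have h1 := card_siteDist_le a dH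
  have h2 := card_siteDist_le (shift a n) dH
  omega

/-- Without the terms crossing the boundary of `X` the operators on `X` stay there. -/
lemma commute_flow_compl_crossing (hev : h ∈ evenPoly (dH + 1)) {X Y : Set (Fin L)}
    (hd : Disjoint X Y) {A B : FockOp (Mode L)} (hA : A ∈ evenOn X) (hB : B ∈ localAlg Y) (z : ℂ)
    (τ : ℝ) : Commute (flow (generator h z (crossing dH X)ᶜ) τ A) B := by
  classical
  set Sin := Finset.univ.filter fun j : Fin L => block j (dH + 1) ⊆ X with hSin
  set Sout := Finset.univ.filter fun j : Fin L => ¬ block j (dH + 1) ⊆ X ∧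
    Disjoint (block j (dH + 1)) X with hSout
  have hSd : Disjoint Sin Sout := by
    rw [Finset.disjoint_left]
    intro j h1 h2
    exact (Finset.mem_filter.1 h2).2.1 (Finset.mem_filter.1 h1).2
  have hS : (crossing dH X)ᶜ = Sin ∪ Sout := by
    ext j
    rw [Finset.mem_compl, mem_crossing, Finset.mem_union, Finset.mem_filter, Finset.mem_filter]
    have := Finset.mem_univ j
    tauto
  set Gin := generator h z Sin with hGin
  set Gout := generator h z Sout with hGout
  set G' := generator h z (crossing dH X)ᶜ with hG'
  have hG'eq : G' = Gin + Gout := by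
    rw [hG', hS, generator, Finset.sum_union hSd, smul_add]; rfl
  have hinX : Gin ∈ evenOn X := by
    refine Subalgebra.smul_mem _ (Subalgebra.sum_mem _ fun j hj => ?_) _
    exact evenOn_mono (Finset.mem_filter.1 hj).2 (place_mem_evenOn j hev)
  -- The remaining terms split into those inside X and those disjoint from X; the latter commute
  -- with every even operator on X, in particular with A and with the inner generator.
  have hout : ∀ y ∈ evenOn X, Commute Gout y := by
    intro y hy
    refine Commute.smul_left (Commute.sum_left _ _ _ fun j hj => ?_) _
    exact commute_of_disjoint (Finset.mem_filter.1 hj).2.2 (place_mem_evenOn j hev)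
      (evenOn_le_localAlg _ hy)
  have h1 : Commute Gin Gout := (hout Gin hinX).symm
  let _ : NormedAlgebra ℚ (FockOp (Mode L)) := NormedAlgebra.restrictScalars ℚ ℂ _
  have h2 : ∀ t : ℝ, NormedSpace.exp (t • G') =
      NormedSpace.exp (t • Gin) * NormedSpace.exp (t • Gout) := by
    intro t
    rw [hG'eq, smul_add, NormedSpace.exp_add_of_commute ((h1.smul_left t).smul_right t)]
  -- The outer exponentials cancel, leaving A conjugated by exponentials of an even operator on X.
  have h3 : flow G' τ A = flow Gin τ A := by
    have h4 : Commute (NormedSpace.exp ((-τ) • Gout)) A :=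
      ((hout A hA).smul_left (-τ)).exp_left
    have h5 : Commute (NormedSpace.exp ((-τ) • Gout)) (NormedSpace.exp (τ • Gin)) :=
      ((h1.symm.smul_left (-τ)).smul_right τ).exp
    unfold flow
    rw [h2, h2]
    calc _ = NormedSpace.exp ((-τ) • Gin) * (NormedSpace.exp ((-τ) • Gout) * A) *
          NormedSpace.exp (τ • Gin) * NormedSpace.exp (τ • Gout) := by simp only [mul_assoc]
      _ = NormedSpace.exp ((-τ) • Gin) * A * (NormedSpace.exp ((-τ) • Gout) *
          NormedSpace.exp (τ • Gin)) * NormedSpace.exp (τ • Gout) := by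
            rw [h4.eq]; simp only [mul_assoc]
      _ = NormedSpace.exp ((-τ) • Gin) * A * NormedSpace.exp (τ • Gin) *
          (NormedSpace.exp ((-τ) • Gout) * NormedSpace.exp (τ • Gout)) := by
            rw [h5.eq]; simp only [mul_assoc]
      _ = _ := by rw [exp_neg_mul_exp_smul, mul_one]
  rw [h3]
  have h6 : Commute Gin B := commute_of_disjoint hd hinX hB
  exact (((h6.smul_left (-τ)).exp_left).mul_left (commute_of_disjoint hd hA hB)).mul_left
    ((h6.smul_left τ).exp_left)

/-- A crossing block has a site of X within dH of its start, so its distance to Y is at least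
dist(X, Y) − dH. The number of such blocks is bounded uniformly. -/
lemma sum_crossing_le {X Y : Set (Fin L)} (hX : IsDomain X) (hY : Y.Nonempty) :
    ∑ j ∈ crossing dH X, (Real.exp (1 * setDist {j} Y))⁻¹ ≤
      (2 * (2 * dH + 1) : ℕ) * (Real.exp dH * Real.exp (-(setDist X Y : ℝ))) := by
  have hterm : ∀ j ∈ crossing dH X, (Real.exp (1 * setDist {j} Y))⁻¹ ≤
      Real.exp dH * Real.exp (-(setDist X Y : ℝ)) := by
    intro j hj
    obtain ⟨x, ⟨k, hk, rfl⟩, hx⟩ := Set.not_disjoint_iff.1 (mem_crossing.1 hj).2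
    obtain ⟨j', hj', y, hy, hdy⟩ := exists_setDist (Set.singleton_nonempty j) hY
    rw [Set.mem_singleton_iff.1 hj'] at hdy
    have h1 := (setDist_le hx hy).trans (siteDist_triangle _ j _)
    have h2 := siteDist_shift_le j k
    rw [siteDist_comm] at h2
    rw [← hdy] at h1
    rw [one_mul, ← Real.exp_neg, ← Real.exp_add]
    apply Real.exp_le_exp.2
    have h3 : (setDist X Y : ℝ) ≤ dH + setDist {j} Y := by exact_mod_cast h1.trans (by omega)
    linarith
  refine (Finset.sum_le_card_nsmul _ _ _ hterm).trans ?_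
  rw [nsmul_eq_mul]
  have := card_crossing_le (dH := dH) hX
  gcongr

/-- The Lieb-Robinson bound, uniform in the length of the chain and in the size of the domains. -/
theorem exists_liebRobinsonBound (hev : h ∈ evenPoly (dH + 1)) (hsa : IsSelfAdjointPoly h) :
    ∃ C v ξ : ℝ, LiebRobinsonBound h (fun _ => C) v ξ := by
  set κ := ‖place (0 : Fin (dH + 1)) h‖ with hκ
  set c := 2 * κ * (1 + Real.exp (1 * dH)) * (2 * dH + 1 : ℕ) with hc
  have hκ0 : 0 ≤ κ := norm_nonneg _
  have hc0 : 0 ≤ c := by positivity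
  set K := Real.exp (1 * dH) * (2 * κ) * ((2 * (2 * dH + 1) : ℕ) * Real.exp dH) with hK
  have hK0 : 0 ≤ K := by positivity
  -- With μ = 1 the length is 1. The velocity is the Grönwall rate c, plus 1 to absorb the prefactor
  -- through τ ≤ e^τ. In the coefficient, 2 handles overlapping domains by the trivial commutator
  -- bound, and 2K comes from the comparison of the two dynamics.
  refine ⟨2 + 2 * K, c + 1, 1, by positivity, one_pos, ?_⟩
  intro L hL X Y hX hY A hA B hB hA1 hB1 τ hτ
  have hYne : Y.Nonempty := by
    obtain ⟨a, n, rfl⟩ := hY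
    exact ⟨_, 0, Nat.zero_le _, rfl⟩
  rw [evolve_conj hsa hL]
  set G := generator h (-Complex.I) (Finset.univ : Finset (Fin L)) with hG
  have hGs : star G = -G := star_generator hsa hL star_neg_I _
  set E := Real.exp (-((setDist X Y : ℝ) - (c + 1) * τ) / 1) with hE
  have hE0 : 0 < E := Real.exp_pos _
  by_cases hd : Disjoint X Y
  swap
  · obtain ⟨x, hxX, hxY⟩ := Set.not_disjoint_iff.1 hd
    have h0 : setDist X Y = 0 := Nat.le_zero.1 ((setDist_le hxX hxY).trans (siteDist_self x).le)
    have h1 : ‖flow G τ A * B - B * flow G τ A‖ ≤ 2 := by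
      refine (norm_sub_le _ _).trans ?_
      have h4 := norm_mul_le (flow G τ A) B
      have h5 := norm_mul_le B (flow G τ A)
      rw [norm_flow hGs, hA1, hB1] at h4 h5
      linarith
    have h2 : 1 ≤ E := by
      rw [hE, h0]
      apply Real.one_le_exp
      have : 0 ≤ (c + 1) * τ := by positivity
      simpa using this
    nlinarith
  set G' := generator h (-Complex.I) (crossing dH X)ᶜ with hG'
  have hG's : star G' = -G' := star_generator hsa hL star_neg_I _
  have hBY := evenOn_le_localAlg _ hB
  set D := flow G' τ (flow G (-τ) B) with hD
  have hDB : ‖D - B‖ ≤ τ * (Real.exp (1 * dH) * (2 * κ * ‖B‖) *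
        Real.exp (c * τ) *
        ∑ j ∈ symmDiff (crossing dH X)ᶜ Finset.univ, (Real.exp (1 * setDist {j} Y))⁻¹) := by
    -- Taking z = i instead of −i reverses both flows and puts them in the order required by D.
    have := norm_generator_flow_sub_le hev hsa hL star_I Complex.norm_I (crossing dH X)ᶜ Finset.univ
      hYne hBY zero_le_one hτ
    have h1 : generator h Complex.I (crossing dH X)ᶜ = -G' := by
      rw [hG', generator_neg, neg_neg]
    have h2 : generator h Complex.I (Finset.univ : Finset (Fin L)) = -G := by
      rw [hG, generator_neg, neg_neg]
    rwa [h1, h2, flow_neg_left, flow_neg_left, neg_neg, ← hD] at this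
  have hS : symmDiff (crossing dH X)ᶜ Finset.univ = crossing dH X := by
    ext j
    simp [Finset.mem_symmDiff]
  rw [hS, hB1, mul_one] at hDB
  have hsum := sum_crossing_le (dH := dH) hX hYne
  have hτe : τ ≤ Real.exp τ := by linarith [Real.add_one_le_exp τ]
  have hfin : ‖D - B‖ ≤ K * E := by
    refine hDB.trans ?_
    have h1 : E = Real.exp τ * Real.exp (c * τ) * Real.exp (-(setDist X Y : ℝ)) := by
      rw [hE, ← Real.exp_add, ← Real.exp_add]; congr 1; ring
    rw [h1, hK]
    calc _ ≤ Real.exp τ * (Real.exp (1 * dH) * (2 * κ) * Real.exp (c * τ) *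
          ((2 * (2 * dH + 1) : ℕ) * (Real.exp dH * Real.exp (-(setDist X Y : ℝ))))) := by
          gcongr
      _ = _ := by ring
  have h4 := norm_commutator_flow_le hGs hG's τ (commute_flow_compl_crossing hev hd hA hBY _ τ)
  rw [← hD, hA1] at h4
  linarith

/-- The Heisenberg dynamics of an operator at the site `i` is determined up to an error `e^{-2R/ξ}`
by the terms of the Hamiltonian within the distance `R`. -/
theorem exists_truncation_bound (hev : h ∈ evenPoly (dH + 1)) (hsa : IsSelfAdjointPoly h) {ξ : ℝ}
    (hξ : 0 < ξ) {τ : ℝ} (hτ : 0 ≤ τ) :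
    ∃ K : ℝ, 0 ≤ K ∧ ∀ (L : ℕ), dH + 1 ≤ L → ∀ (i : Fin L) (e : FockOp (Mode L)),
      e ∈ localAlg {i} → ‖e‖ ≤ 1 → ∀ (S : Finset (Fin L)) (R : ℝ),
      (∀ j ∉ S, R ≤ siteDist j i) →
      ‖flow (generator h (-Complex.I) Finset.univ) τ e - flow (generator h (-Complex.I) S) τ e‖ ≤
        K * Real.exp (-(2 * R) / ξ) := by
  -- Half of this rate yields exp(−2R/ξ) from the terms beyond R; the other half makes the sum over
  -- their positions converge uniformly in L.
  set μ : ℝ := 4 / ξ with hμ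
  have hμ0 : 0 < μ := by positivity
  set κ := ‖place (0 : Fin (dH + 1)) h‖ with hκ
  set r := Real.exp (-(μ / 2)) with hr
  have hr0 : 0 ≤ r := (Real.exp_pos _).le
  have hr1 : r < 1 := Real.exp_lt_one_iff.2 (by linarith)
  set a := τ * (Real.exp (μ * dH) * (2 * κ * 1) *
        Real.exp (2 * κ * (1 + Real.exp (μ * dH)) * (2 * dH + 1 : ℕ) * τ)) with ha
  have ha0 : 0 ≤ a := by positivity
  have hr2 : 0 < 1 - r := by linarith
  refine ⟨a * (2 * (1 - r)⁻¹), by positivity, ?_⟩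
  intro L hL i e he he1 S R hS
  set G := generator h (-Complex.I) (Finset.univ : Finset (Fin L)) with hG
  set G' := generator h (-Complex.I) S with hG'
  have hGs : star G = -G := star_generator hsa hL star_neg_I _
  have h1 := norm_generator_flow_sub_le hev hsa hL star_neg_I (by simp) Finset.univ S
    (Set.singleton_nonempty i) he hμ0.le hτ
  rw [← hG, ← hG', ← hκ] at h1
  have h2 : ‖flow G (-τ) (flow G' τ e) - e‖ = ‖flow G τ e - flow G' τ e‖ := by
    rw [norm_sub_rev, ← norm_flow hGs (-τ) (flow G τ e - _), flow_sub, flow_neg_flow]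
  rw [h2] at h1
  have hsum : ∑ j ∈ symmDiff Finset.univ S, (Real.exp (μ * setDist {j} {i}))⁻¹ ≤
      Real.exp (-(2 * R) / ξ) * (2 * (1 - r)⁻¹) := by
    calc _ ≤ ∑ j ∈ symmDiff Finset.univ S, Real.exp (-(2 * R) / ξ) * r ^ siteDist j i := by
          refine Finset.sum_le_sum fun j hj => ?_
          have hj' : j ∉ S := by
            rcases Finset.mem_symmDiff.1 hj with h | h
            · exact h.2
            · exact absurd (Finset.mem_univ j) h.2
          rw [setDist_singleton_singleton, ← Real.exp_neg, hr, ← Real.exp_nat_mul, ← Real.exp_add]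
          apply Real.exp_le_exp.2
          have h3 := hS j hj'
          have h4 : -(2 * R) / ξ = -(μ / 2 * R) := by rw [hμ]; field_simp; ring
          rw [h4]
          nlinarith
      _ ≤ ∑ j : Fin L, Real.exp (-(2 * R) / ξ) * r ^ siteDist j i :=
          Finset.sum_le_sum_of_subset_of_nonneg (Finset.subset_univ _) fun j _ _ => by positivity
      _ = Real.exp (-(2 * R) / ξ) * ∑ j : Fin L, r ^ siteDist j i := by rw [Finset.mul_sum]
      _ ≤ _ := by gcongr; exact sum_pow_siteDist_le hr0 hr1 i
  refine h1.trans ?_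
  calc _ ≤ τ * (Real.exp (μ * dH) * (2 * κ * 1) *
        Real.exp (2 * κ * (1 + Real.exp (μ * dH)) * (2 * dH + 1 : ℕ) * τ) *
        (Real.exp (-(2 * R) / ξ) * (2 * (1 - r)⁻¹))) := by gcongr
    _ = _ := by rw [ha]; ring

end ChainDynamics

/-! ### Bell states as matrices and the local cost as a conditional expectation -/

section BellState

variable {ι : Type*} [Fintype ι] [LinearOrder ι]

/-- A vector of the doubled system as a matrix. -/
def toMat (v : Finset ι × Finset ι → ℂ) : FockOp ι := Matrix.of fun s t => v (s, t)

lemma toMat_apply (v : Finset ι × Finset ι → ℂ) (s t : Finset ι) : toMat v s t = v (s, t) := rfl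

lemma toMat_add (v w : Finset ι × Finset ι → ℂ) : toMat (v + w) = toMat v + toMat w := rfl

lemma toMat_smul (c : ℂ) (v : Finset ι × Finset ι → ℂ) : toMat (c • v) = c • toMat v := rfl

lemma toMat_kronecker_mulVec (X Y : FockOp ι) (v : Finset ι × Finset ι → ℂ) :
    toMat ((X ⊗ₖ Y) *ᵥ v) = X * toMat v * Yᵀ := by
  ext s t
  simp only [toMat_apply, Matrix.mulVec, dotProduct, Matrix.mul_apply, Finset.sum_mul,
    Fintype.sum_prod_type, Matrix.kronecker_apply, Matrix.transpose_apply]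
  rw [Finset.sum_comm]
  refine Finset.sum_congr rfl fun u _ => Finset.sum_congr rfl fun w _ => ?_
  ring

lemma star_dotProduct_eq_trace (v w : Finset ι × Finset ι → ℂ) :
    star v ⬝ᵥ w = ((toMat v)ᴴ * toMat w).trace := by
  simp only [dotProduct, Matrix.trace, Matrix.diag, Matrix.mul_apply, Fintype.sum_prod_type,
    Matrix.conjTranspose_apply, toMat_apply, Pi.star_apply]
  rw [Finset.sum_comm]

lemma transpose_create (μ : ι) : (create μ : FockOp ι)ᵀ = annihilate μ := by
  ext s t
  rw [create, Matrix.transpose_apply, Matrix.conjTranspose_apply, annihilate_apply]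
  split_ifs <;> simp [jwSign]

lemma transpose_annihilate (μ : ι) : (annihilate μ : FockOp ι)ᵀ = create μ := by
  rw [← transpose_create, Matrix.transpose_transpose]

/-- The phases of the Bell state. -/
def phase (ι : Type*) [Fintype ι] [LinearOrder ι] : FockOp ι :=
  Matrix.diagonal fun s => if Even s.card then 1 else Complex.I

lemma phase_eq : phase ι = ((1 + Complex.I) / 2) • 1 + ((1 - Complex.I) / 2) • parity ι := by
  rw [phase, parity, ← Matrix.diagonal_one, ← Matrix.diagonal_smul, ← Matrix.diagonal_smul,
    Matrix.diagonal_add]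
  congr 1
  ext s
  rcases Nat.even_or_odd s.card with h | h
  · simp only [h, if_true, Pi.smul_apply, smul_eq_mul, h.neg_one_pow]
    ring
  · simp only [Nat.not_even_iff_odd.2 h, if_false, Pi.smul_apply, smul_eq_mul, h.neg_one_pow]
    ring

lemma phase_mul_conjTranspose : phase ι * (phase ι)ᴴ = 1 := by
  rw [phase, Matrix.diagonal_conjTranspose, Matrix.diagonal_mul_diagonal, ← Matrix.diagonal_one]
  congr 1
  ext s
  rw [Pi.star_apply]
  split_ifs <;> simp

lemma annA_conj_mul_annB_conj (μ : ι) :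
    (annA μ)ᴴ * (annB μ)ᴴ = Complex.I • ((create μ * parity ι) ⊗ₖ create μ) := by
  rw [annA, annB, Matrix.conjTranspose_smul, Matrix.conjTranspose_kronecker,
    Matrix.conjTranspose_kronecker, conjTranspose_parity, conjTranspose_annihilate,
    Matrix.conjTranspose_one, mul_smul_comm, ← Matrix.mul_kronecker_mul, one_mul]
  simp

lemma toMat_bellCreate_mulVec (μ : ι) (v : Finset ι × Finset ι → ℂ) :
    toMat (bellCreate μ *ᵥ v) = ((Real.sqrt 2 : ℂ)⁻¹) •
      (toMat v + Complex.I • (create μ * (parity ι * (toMat v * annihilate μ)))) := by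
  rw [bellCreate, annA_conj_mul_annB_conj, Matrix.smul_mulVec, Matrix.add_mulVec,
    Matrix.smul_mulVec, Matrix.one_mulVec, toMat_smul, toMat_add, toMat_smul,
    toMat_kronecker_mulVec, transpose_create]
  simp only [mul_assoc]

/-- Each pair operator fills μ in both copies, and the two Jordan–Wigner signs cancel on the
diagonal. The factor i and the parity send the phase 1 of an even configuration to i, and the phase
i of an odd one to i·(−1)·i = 1. -/
lemma toMat_list_bellCreate (l : List ι) (hl : l.Nodup) :
    toMat ((l.map bellCreate).prod *ᵥ doubledVac) = Matrix.diagonal fun s =>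
      if s ⊆ l.toFinset then ((Real.sqrt 2 : ℂ)⁻¹) ^ l.length *
        (if Even s.card then 1 else Complex.I) else 0 := by
  induction l with
  | nil =>
    ext s t
    simp only [List.map_nil, List.prod_nil, Matrix.one_mulVec, toMat_apply, doubledVac,
      List.toFinset_nil, Finset.subset_empty, List.length_nil, pow_zero, Matrix.diagonal_apply]
    by_cases hs : s = ∅
    · subst hs
      by_cases ht : ∅ = t
      · subst ht; simp
      · simp [ht, Ne.symm ht]
    · simp [hs]
  | cons μ l ih =>
    rw [List.nodup_cons] at hl
    rw [List.map_cons, List.prod_cons, ← Matrix.mulVec_mulVec, toMat_bellCreate_mulVec, ih hl.2]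
    ext s t
    have hμl : μ ∉ l.toFinset := by simpa using hl.1
    rw [Matrix.smul_apply, Matrix.add_apply, Matrix.smul_apply, create_mul_apply,
      parity_mul_apply, mul_annihilate_apply, List.toFinset_cons, List.length_cons,
      Matrix.diagonal_apply, Matrix.diagonal_apply, Matrix.diagonal_apply, smul_eq_mul, smul_eq_mul]
    by_cases hst : s = t
    · subst hst
      simp only [if_true]
      by_cases hs : μ ∈ s
      · have h1 : ¬ s ⊆ l.toFinset := fun h => hμl (h hs)
        rw [if_neg h1, if_pos hs, if_pos hs]
        simp only [Finset.subset_insert_iff]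
        by_cases h2 : s.erase μ ⊆ l.toFinset
        · rw [if_pos h2, if_pos h2]
          have h3 : s.card = (s.erase μ).card + 1 := (Finset.card_erase_add_one hs).symm
          have h4 := jwSign_mul_self μ s
          rcases Nat.even_or_odd (s.erase μ).card with h | h
          · rw [if_pos h, if_neg (by rw [h3]; simpa [Nat.even_add_one] using h), h.neg_one_pow,
              pow_succ]
            linear_combination (Complex.I * ((Real.sqrt 2 : ℂ)⁻¹) ^ l.length *
              ((Real.sqrt 2 : ℂ)⁻¹)) * h4
          · rw [if_neg (Nat.not_even_iff_odd.2 h), if_pos (by rw [h3]; exact h.add_one),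
              h.neg_one_pow, pow_succ]
            linear_combination (-(Complex.I * Complex.I) * ((Real.sqrt 2 : ℂ)⁻¹) ^ l.length *
              ((Real.sqrt 2 : ℂ)⁻¹)) * h4 - ((Real.sqrt 2 : ℂ)⁻¹) ^ l.length *
              ((Real.sqrt 2 : ℂ)⁻¹) * Complex.I_mul_I
        · rw [if_neg h2, if_neg h2]; simp
      · simp only [if_neg hs, Finset.subset_insert_iff, Finset.erase_eq_of_notMem hs, pow_succ]
        split_ifs <;> ring
    · rw [if_neg hst, if_neg hst]
      by_cases h1 : μ ∈ s
      · by_cases h2 : μ ∈ t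
        · have h3 : s.erase μ ≠ t.erase μ := fun h3 =>
            hst (by rw [← Finset.insert_erase h1, ← Finset.insert_erase h2, h3])
          rw [if_neg h3]; simp
        · rw [if_neg h2]; simp
      · rw [if_neg h1]; simp

lemma toMat_bellState :
    toMat (bellState ι) = ((Real.sqrt 2 : ℂ)⁻¹) ^ Fintype.card ι • phase ι := by
  rw [bellState, toMat_list_bellCreate _ (Finset.sort_nodup _ _), phase, ← Matrix.diagonal_smul]
  congr 1
  ext s
  simp only [Finset.sort_toFinset, Finset.length_sort, Finset.card_univ, Finset.subset_univ, if_true,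
    Pi.smul_apply, smul_eq_mul]

lemma phase_commute {X : FockOp ι} (hX : Commute (parity ι) X) : Commute (phase ι) X := by
  rw [phase_eq]
  exact ((Commute.one_left X).smul_left _).add_left (hX.smul_left _)

/-- The conjugate V* on the second factor acts as V† from the right, and an even V† passes through
the phase. -/
lemma toMat_testState (U : FockOp ι) {V : FockOp ι} (hV : Commute (parity ι) V) :
    toMat (testState U V) = ((Real.sqrt 2 : ℂ)⁻¹) ^ Fintype.card ι • (U * Vᴴ * phase ι) := by
  have h1 : (V.map (starRingEnd ℂ))ᵀ = Vᴴ := rfl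
  have h2 : Commute (parity ι) Vᴴ := by
    have := congr_arg Matrix.conjTranspose hV.eq
    rw [Matrix.conjTranspose_mul, Matrix.conjTranspose_mul, conjTranspose_parity] at this
    exact this.symm
  rw [testState, toMat_kronecker_mulVec, toMat_bellState, h1, mul_smul_comm, smul_mul_assoc,
    mul_assoc, mul_assoc, (phase_commute h2).eq]

/-- The four matrix units of a mode. -/
def modeOp (μ : ι) : Fin 4 → FockOp ι :=
  ![create μ * annihilate μ, annihilate μ * create μ, annihilate μ, create μ]

/-- The conditional expectation onto the commutant of the mode `μ`. -/
def modeExp (μ : ι) : FockOp ι →ₗ[ℂ] FockOp ι where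
  toFun X := (1 / 2 : ℂ) • ∑ k, modeOp μ k * X * (modeOp μ k)ᴴ
  map_add' X Y := by simp [mul_add, add_mul, Finset.sum_add_distrib]
  map_smul' c X := by
    simp only [mul_smul_comm, smul_mul_assoc, ← Finset.smul_sum, RingHom.id_apply]
    rw [smul_comm]

lemma modeExp_eq_sum (μ : ι) (X : FockOp ι) :
    modeExp μ X = (1 / 2 : ℂ) • ∑ k, modeOp μ k * X * (modeOp μ k)ᴴ := rfl

lemma modeExp_apply (μ : ι) (X : FockOp ι) : modeExp μ X = (1 / 2 : ℂ) •
    (create μ * annihilate μ * X * (create μ * annihilate μ) +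
      annihilate μ * create μ * X * (annihilate μ * create μ) +
      annihilate μ * X * create μ + create μ * X * annihilate μ) := by
  rw [modeExp_eq_sum, Fin.sum_univ_four]
  simp [modeOp, Matrix.conjTranspose_mul, conjTranspose_create, conjTranspose_annihilate]

lemma annihilate_mul_self (μ : ι) : (annihilate μ * annihilate μ : FockOp ι) = 0 :=
  isCAR_annihilate.mul_self μ

lemma create_mul_self (μ : ι) : (create μ * create μ : FockOp ι) = 0 := by
  have := congr_arg Matrix.conjTranspose (annihilate_mul_self μ)
  simpa [Matrix.conjTranspose_mul, conjTranspose_annihilate] using this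

lemma annihilate_mul_create (μ : ι) :
    (annihilate μ * create μ : FockOp ι) = 1 - create μ * annihilate μ :=
  isCAR_annihilate.mul_star μ

lemma bellProj_eq (μ : ι) : bellProj μ = (1 / 2 : ℂ) •
    ((annihilate μ * create μ) ⊗ₖ (annihilate μ * create μ) +
      Complex.I • ((create μ * parity ι) ⊗ₖ create μ) +
      (-Complex.I) • ((parity ι * annihilate μ) ⊗ₖ annihilate μ) +
      (create μ * annihilate μ) ⊗ₖ (create μ * annihilate μ)) := by
  have hA : (annA μ)ᴴ * annA μ = (create μ * annihilate μ) ⊗ₖ (1 : FockOp ι) := by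
    rw [annA, Matrix.conjTranspose_kronecker, conjTranspose_annihilate, Matrix.conjTranspose_one,
      ← Matrix.mul_kronecker_mul, one_mul]
  have hB : (annB μ)ᴴ * annB μ = (1 : FockOp ι) ⊗ₖ (create μ * annihilate μ) := by
    rw [annB, Matrix.conjTranspose_smul, Matrix.conjTranspose_kronecker, conjTranspose_annihilate,
      conjTranspose_parity, smul_mul_smul_comm, ← Matrix.mul_kronecker_mul, parity_mul_parity]
    simp
  have hBA : annB μ * annA μ = (-Complex.I) • ((parity ι * annihilate μ) ⊗ₖ annihilate μ) := by
    rw [annB, annA, smul_mul_assoc, ← Matrix.mul_kronecker_mul, mul_one]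
  have h1 : (1 : DoubledOp ι) - (create μ * annihilate μ) ⊗ₖ (1 : FockOp ι) =
      (annihilate μ * create μ) ⊗ₖ (1 : FockOp ι) := by
    rw [annihilate_mul_create, sub_eq_iff_eq_add, ← Matrix.add_kronecker, sub_add_cancel,
      Matrix.one_kronecker_one]
  have h2 : (1 : DoubledOp ι) - (1 : FockOp ι) ⊗ₖ (create μ * annihilate μ) =
      (1 : FockOp ι) ⊗ₖ (annihilate μ * create μ) := by
    rw [annihilate_mul_create, sub_eq_iff_eq_add, ← Matrix.kronecker_add, sub_add_cancel,
      Matrix.one_kronecker_one]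
  rw [bellProj, hA, hB, hBA, annA_conj_mul_annB_conj, h1, h2, ← Matrix.mul_kronecker_mul,
    ← Matrix.mul_kronecker_mul]
  simp only [mul_one, one_mul]

/-- An odd operator exchanges the sectors with phases 1 and i. The ratio of the two phases is i or
−i, that is, i times the parity. -/
lemma phase_mul_annihilate (μ : ι) :
    phase ι * annihilate μ = Complex.I • (annihilate μ * parity ι * phase ι) := by
  rw [phase_eq, add_mul, smul_mul_assoc, smul_mul_assoc, one_mul, parity_mul_annihilate, mul_add,
    mul_smul_comm, mul_smul_comm, mul_one, mul_assoc _ (parity ι) (parity ι), parity_mul_parity,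
    mul_one, smul_add, smul_smul, smul_smul, smul_neg, ← neg_smul, add_comm]
  congr 2
  · linear_combination (-1 / 2 : ℂ) * Complex.I_mul_I
  · linear_combination (1 / 2 : ℂ) * Complex.I_mul_I

lemma phase_mul_create (μ : ι) :
    phase ι * create μ = Complex.I • (create μ * parity ι * phase ι) := by
  rw [phase_eq, add_mul, smul_mul_assoc, smul_mul_assoc, one_mul, parity_mul_create, mul_add,
    mul_smul_comm, mul_smul_comm, mul_one, mul_assoc _ (parity ι) (parity ι), parity_mul_parity,
    mul_one, smul_add, smul_smul, smul_smul, smul_neg, ← neg_smul, add_comm]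
  congr 2
  · linear_combination (-1 / 2 : ℂ) * Complex.I_mul_I
  · linear_combination (1 / 2 : ℂ) * Complex.I_mul_I

lemma commute_parity_number (μ : ι) : Commute (parity ι) (create μ * annihilate μ) := by
  change _ * _ = _ * _
  rw [← mul_assoc, parity_mul_create, neg_mul, mul_assoc, parity_mul_annihilate, mul_neg, neg_neg,
    mul_assoc]

/-- The factors on B act by their transposes from the right and must cross the phase. The number
terms commute with it; the pairing terms acquire an i and a parity, which cancel those coming from
`annB`. What remains is the sum over the four matrix units. -/
lemma toMat_bellProj_mulVec (μ : ι) {W : FockOp ι} (hW : Commute (parity ι) W)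
    {v : Finset ι × Finset ι → ℂ} (hv : toMat v = W * phase ι) :
    toMat (bellProj μ *ᵥ v) = modeExp μ W * phase ι := by
  have hn : (create μ * annihilate μ : FockOp ι)ᵀ = create μ * annihilate μ := by
    rw [Matrix.transpose_mul, transpose_create, transpose_annihilate]
  have hh : (annihilate μ * create μ : FockOp ι)ᵀ = annihilate μ * create μ := by
    rw [Matrix.transpose_mul, transpose_create, transpose_annihilate]
  have hnp := phase_commute (commute_parity_number μ)
  have hhp : Commute (phase ι) (annihilate μ * create μ) := by
    rw [annihilate_mul_create]; exact (Commute.one_right _).sub_right hnp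
  rw [bellProj_eq, Matrix.smul_mulVec, Matrix.add_mulVec, Matrix.add_mulVec, Matrix.add_mulVec,
    Matrix.smul_mulVec, Matrix.smul_mulVec, toMat_smul, toMat_add, toMat_add, toMat_add, toMat_smul,
    toMat_smul, toMat_kronecker_mulVec, toMat_kronecker_mulVec, toMat_kronecker_mulVec,
    toMat_kronecker_mulVec, hn, hh, transpose_create, transpose_annihilate, hv, modeExp_apply,
    smul_mul_assoc]
  congr 1
  have h1 : annihilate μ * create μ * (W * phase ι) * (annihilate μ * create μ) =
      annihilate μ * create μ * W * (annihilate μ * create μ) * phase ι := by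
    calc _ = annihilate μ * create μ * W * (phase ι * (annihilate μ * create μ)) := by
          simp only [mul_assoc]
      _ = _ := by rw [hhp.eq]; simp only [mul_assoc]
  have h2 : create μ * annihilate μ * (W * phase ι) * (create μ * annihilate μ) =
      create μ * annihilate μ * W * (create μ * annihilate μ) * phase ι := by
    calc _ = create μ * annihilate μ * W * (phase ι * (create μ * annihilate μ)) := by
          simp only [mul_assoc]
      _ = _ := by rw [hnp.eq]; simp only [mul_assoc]
  have h3 : Complex.I • (create μ * parity ι * (W * phase ι) * annihilate μ) =
      create μ * W * annihilate μ * phase ι := by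
    calc _ = Complex.I • (create μ * (parity ι * W) * (phase ι * annihilate μ)) := by
          simp only [mul_assoc]
      _ = (Complex.I * Complex.I) • (create μ * W * (parity ι * annihilate μ) * parity ι *
          phase ι) := by
          rw [phase_mul_annihilate, hW.eq, mul_smul_comm, smul_smul]; simp only [mul_assoc]
      _ = create μ * W * annihilate μ * (parity ι * parity ι) * phase ι := by
          rw [parity_mul_annihilate, Complex.I_mul_I, mul_neg, neg_mul, neg_mul, smul_neg, neg_smul,
            neg_neg, one_smul]; simp only [mul_assoc]
      _ = _ := by rw [parity_mul_parity, mul_one]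
  have h4 : (-Complex.I) • (parity ι * annihilate μ * (W * phase ι) * create μ) =
      annihilate μ * W * create μ * phase ι := by
    calc _ = (-Complex.I) • ((parity ι * annihilate μ) * W * (phase ι * create μ)) := by
          simp only [mul_assoc]
      _ = (-Complex.I * Complex.I) • -(annihilate μ * (parity ι * W) * create μ * parity ι *
          phase ι) := by
          rw [phase_mul_create, parity_mul_annihilate, mul_smul_comm, smul_smul]
          simp only [mul_assoc, neg_mul]
      _ = -(annihilate μ * W * (parity ι * create μ) * parity ι * phase ι) := by
          rw [hW.eq, neg_mul, Complex.I_mul_I, neg_neg, one_smul]; simp only [mul_assoc]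
      _ = annihilate μ * W * create μ * (parity ι * parity ι) * phase ι := by
          rw [parity_mul_create, mul_neg, neg_mul, neg_mul, neg_neg]; simp only [mul_assoc]
      _ = _ := by rw [parity_mul_parity, mul_one]
  rw [h1, h2, h3, h4]
  simp only [add_mul]
  abel

lemma costLHSTMode_eq (μ : ι) {U V : FockOp ι} (hU : Commute (parity ι) U)
    (hV : Commute (parity ι) V) :
    costLHSTMode μ U V = 1 - (ntr ((U * Vᴴ)ᴴ * modeExp μ (U * Vᴴ))).re := by
  have hV' : Commute (parity ι) Vᴴ := by
    have := congr_arg Matrix.conjTranspose hV.eq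
    rw [Matrix.conjTranspose_mul, Matrix.conjTranspose_mul, conjTranspose_parity] at this
    exact this.symm
  set a : ℂ := ((Real.sqrt 2 : ℂ)⁻¹) ^ Fintype.card ι with ha
  -- The normalization of the Bell state turns the trace into the normalized trace.
  have ha2 : star a * a = (2 ^ Fintype.card ι)⁻¹ := by
    have h1 : star ((Real.sqrt 2 : ℂ)⁻¹) = (Real.sqrt 2 : ℂ)⁻¹ := by
      rw [← Complex.ofReal_inv]; exact Complex.conj_ofReal _
    rw [ha, star_pow, h1, ← mul_pow, ← mul_inv, ← Complex.ofReal_mul, Real.mul_self_sqrt two_pos.le,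
      inv_pow]
    simp
  have h1 : toMat (testState U V) = a • (U * Vᴴ) * phase ι := by
    rw [toMat_testState U hV, smul_mul_assoc]
  have h2 := toMat_bellProj_mulVec μ ((hU.mul_right hV').smul_right a) h1
  have h3 : ((phase ι)ᴴ * (star a • (U * Vᴴ)ᴴ) * (a • modeExp μ (U * Vᴴ) * phase ι)).trace =
      star a * a * ((U * Vᴴ)ᴴ * modeExp μ (U * Vᴴ)).trace := by
    rw [mul_assoc, Matrix.trace_mul_comm]
    simp only [smul_mul_assoc, mul_smul_comm, smul_smul, mul_assoc, phase_mul_conjTranspose, mul_one,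
      Matrix.trace_smul, smul_eq_mul]
    ring
  rw [costLHSTMode, star_dotProduct_eq_trace, h2, h1, map_smul, Matrix.conjTranspose_mul,
    Matrix.conjTranspose_smul, h3, ntr, ha2, div_eq_inv_mul]

end BellState

/-! ### Conditional expectations of modes and the order of the two costs -/

section CostInequalities

variable {ι : Type*} [Fintype ι] [LinearOrder ι]

lemma conjTranspose_modeExp (μ : ι) (X : FockOp ι) : (modeExp μ X)ᴴ = modeExp μ Xᴴ := by
  have h : star (1 / 2 : ℂ) = 1 / 2 := by simp
  rw [modeExp_eq_sum, modeExp_eq_sum, Matrix.conjTranspose_smul, Matrix.conjTranspose_sum, h]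
  refine congr_arg _ (Finset.sum_congr rfl fun k _ => ?_)
  rw [Matrix.conjTranspose_mul, Matrix.conjTranspose_mul, Matrix.conjTranspose_conjTranspose,
    mul_assoc]

lemma commute_annihilate_modeExp (μ : ι) (X : FockOp ι) : Commute (annihilate μ) (modeExp μ X) := by
  have h0 := annihilate_mul_self μ
  have h0' := create_mul_self μ
  have h1 : (annihilate μ * create μ * annihilate μ : FockOp ι) = annihilate μ := by
    rw [annihilate_mul_create, sub_mul, mul_assoc, h0]; simp
  have h2 : annihilate μ * (create μ * annihilate μ * X * (create μ * annihilate μ)) =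
      annihilate μ * X * (create μ * annihilate μ) := by
    calc _ = annihilate μ * create μ * annihilate μ * X * (create μ * annihilate μ) := by
          simp only [mul_assoc]
      _ = _ := by rw [h1]
  have h3 : annihilate μ * (annihilate μ * create μ * X * (annihilate μ * create μ)) = 0 := by
    calc _ = annihilate μ * annihilate μ * create μ * X * (annihilate μ * create μ) := by
          simp only [mul_assoc]
      _ = _ := by rw [h0]; simp
  have h4 : annihilate μ * (annihilate μ * X * create μ) = 0 := by
    calc _ = annihilate μ * annihilate μ * X * create μ := by simp only [mul_assoc]
      _ = _ := by rw [h0]; simp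
  have h2' : create μ * annihilate μ * X * (create μ * annihilate μ) * annihilate μ = 0 := by
    calc _ = create μ * annihilate μ * X * create μ * (annihilate μ * annihilate μ) := by
          simp only [mul_assoc]
      _ = _ := by rw [h0, mul_zero]
  have h3' : annihilate μ * create μ * X * (annihilate μ * create μ) * annihilate μ =
      annihilate μ * create μ * X * annihilate μ := by
    rw [mul_assoc, h1]
  have h4' : create μ * X * annihilate μ * annihilate μ = 0 := by
    rw [mul_assoc, h0, mul_zero]
  change _ * _ = _ * _
  rw [modeExp_apply, mul_smul_comm, smul_mul_assoc]
  congr 1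
  rw [mul_add, mul_add, mul_add, add_mul, add_mul, add_mul, h2, h3, h4, h2', h3', h4']
  simp only [mul_assoc, add_zero, zero_add]
  abel

lemma commute_create_modeExp (μ : ι) (X : FockOp ι) : Commute (create μ) (modeExp μ X) := by
  have := congr_arg Matrix.conjTranspose (commute_annihilate_modeExp μ Xᴴ).eq
  rw [Matrix.conjTranspose_mul, Matrix.conjTranspose_mul, conjTranspose_modeExp,
    Matrix.conjTranspose_conjTranspose, conjTranspose_annihilate] at this
  exact this.symm

lemma modeExp_of_commute (μ : ι) {X : FockOp ι} (h : Commute (annihilate μ) X)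
    (h' : Commute (create μ) X) : modeExp μ X = X := by
  have h1 : (create μ * annihilate μ * (create μ * annihilate μ) : FockOp ι)
      = create μ * annihilate μ := by
    rw [mul_assoc, ← mul_assoc (annihilate μ), annihilate_mul_create, sub_mul, mul_sub, mul_assoc,
      annihilate_mul_self]
    simp
  have h2 : (annihilate μ * create μ * (annihilate μ * create μ) : FockOp ι)
      = annihilate μ * create μ := by
    rw [annihilate_mul_create, sub_mul, mul_sub, mul_sub, h1]
    simp
  rw [modeExp_apply, ((h'.mul_left h).eq), ((h.mul_left h').eq), mul_assoc X, h1, mul_assoc X, h2,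
    h.eq, h'.eq, mul_assoc X, mul_assoc X, annihilate_mul_create, mul_sub, mul_one, add_assoc,
    sub_add_cancel, add_sub_cancel, ← two_smul ℂ, smul_smul]
  norm_num

lemma modeExp_one (μ : ι) : modeExp μ (1 : FockOp ι) = 1 :=
  modeExp_of_commute μ (Commute.one_right _) (Commute.one_right _)

lemma modeExp_modeExp (μ : ι) (X : FockOp ι) : modeExp μ (modeExp μ X) = modeExp μ X :=
  modeExp_of_commute μ (commute_annihilate_modeExp μ X) (commute_create_modeExp μ X)

lemma modeOp_mul_modeOp {μ ν : ι} (h : μ ≠ ν) (k l : Fin 4) :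
    modeOp μ k * modeOp ν l = modeOp ν l * modeOp μ k ∨
      modeOp μ k * modeOp ν l = -(modeOp ν l * modeOp μ k) := by
  have h1 : annihilate μ * annihilate ν = -(annihilate ν * annihilate μ) :=
    isCAR_annihilate.swap μ ν
  have h2 : annihilate μ * create ν = -(create ν * annihilate μ) :=
    isCAR_annihilate.mul_star_of_ne h
  have h3 : create μ * annihilate ν = -(annihilate ν * create μ) := by
    have : annihilate ν * create μ = -(create μ * annihilate ν) :=
      isCAR_annihilate.mul_star_of_ne h.symm
    rw [this, neg_neg]
  have h4 : create μ * create ν = -(create ν * create μ) := isCAR_annihilate.swap_star μ ν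
  have hodd : ∀ {a b c : FockOp ι}, a * c = -(c * a) → b * c = -(c * b) → Commute (a * b) c := by
    intro a b c ha hb
    change a * b * c = c * (a * b)
    rw [mul_assoc, hb, mul_neg, ← mul_assoc, ha, neg_mul, neg_neg, mul_assoc]
  have na := hodd h3 h1
  have nc := hodd h4 h2
  have ha := hodd h1 h3
  have hc := hodd h2 h4
  have na' : Commute (annihilate μ) (create ν * annihilate ν) :=
    (hodd (a := create ν) (b := annihilate ν) (c := annihilate μ) (by rw [h2, neg_neg])
      (by rw [h1, neg_neg])).symm
  have nc' : Commute (create μ) (create ν * annihilate ν) :=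
    (hodd (a := create ν) (b := annihilate ν) (c := create μ) (by rw [h4, neg_neg])
      (by rw [h3, neg_neg])).symm
  have ha' : Commute (annihilate μ) (annihilate ν * create ν) :=
    (hodd (a := annihilate ν) (b := create ν) (c := annihilate μ) (by rw [h1, neg_neg])
      (by rw [h2, neg_neg])).symm
  have hc' : Commute (create μ) (annihilate ν * create ν) :=
    (hodd (a := annihilate ν) (b := create ν) (c := create μ) (by rw [h3, neg_neg])
      (by rw [h4, neg_neg])).symm
  fin_cases k <;> fin_cases l
  · exact Or.inl (nc.mul_right na)
  · exact Or.inl (na.mul_right nc)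
  · exact Or.inl na
  · exact Or.inl nc
  · exact Or.inl (hc.mul_right ha)
  · exact Or.inl (ha.mul_right hc)
  · exact Or.inl ha
  · exact Or.inl hc
  · exact Or.inl na'
  · exact Or.inl ha'
  · exact Or.inr h1
  · exact Or.inr h2
  · exact Or.inl nc'
  · exact Or.inl hc'
  · exact Or.inr h3
  · exact Or.inr h4

lemma modeExp_modeExp_eq_sum (μ ν : ι) (X : FockOp ι) :
    modeExp μ (modeExp ν X) = (1 / 2 : ℂ) • (1 / 2 : ℂ) • ∑ k, ∑ l,
      (modeOp μ k * modeOp ν l) * X * (modeOp μ k * modeOp ν l)ᴴ := by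
  rw [modeExp_eq_sum μ, modeExp_eq_sum ν, Finset.smul_sum (r := (1 / 2 : ℂ)) (s := Finset.univ)
    (f := fun k => ∑ l, (modeOp μ k * modeOp ν l) * X * (modeOp μ k * modeOp ν l)ᴴ)]
  refine congr_arg _ (Finset.sum_congr rfl fun k _ => ?_)
  rw [mul_smul_comm, smul_mul_assoc, Finset.mul_sum, Finset.sum_mul]
  refine congr_arg _ (Finset.sum_congr rfl fun l _ => ?_)
  rw [Matrix.conjTranspose_mul]
  simp only [mul_assoc]

/-- Matrix units of different modes commute or anticommute, and a sign disappears because each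
product occurs together with its adjoint. -/
lemma modeExp_comm (μ ν : ι) (X : FockOp ι) :
    modeExp μ (modeExp ν X) = modeExp ν (modeExp μ X) := by
  by_cases h : μ = ν
  · rw [h]
  rw [modeExp_modeExp_eq_sum, modeExp_modeExp_eq_sum, Finset.sum_comm]
  refine congr_arg _ (congr_arg _ (Finset.sum_congr rfl fun k _ => Finset.sum_congr rfl fun l _ => ?_))
  rcases modeOp_mul_modeOp h l k with h | h <;> rw [h]
  rw [Matrix.conjTranspose_neg, neg_mul, neg_mul, mul_neg, neg_neg]

lemma ntr_add (X Y : FockOp ι) : ntr (X + Y) = ntr X + ntr Y := by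
  simp [ntr, add_div]

lemma ntr_sub (X Y : FockOp ι) : ntr (X - Y) = ntr X - ntr Y := by
  simp [ntr, sub_div]

lemma ntr_smul (c : ℂ) (X : FockOp ι) : ntr (c • X) = c * ntr X := by
  simp [ntr, mul_div_assoc]

lemma ntr_conjTranspose (X : FockOp ι) : ntr Xᴴ = star (ntr X) := by
  simp [ntr, Matrix.trace_conjTranspose]

/-- Taking adjoints permutes the four matrix units, so cyclicity of the trace makes `modeExp`
symmetric. With idempotence it is an orthogonal projection for the Hilbert–Schmidt product. -/
lemma ntr_conj_mul_modeExp (μ : ι) (X Y : FockOp ι) :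
    ntr (Xᴴ * modeExp μ Y) = ntr ((modeExp μ X)ᴴ * Y) := by
  rw [conjTranspose_modeExp, modeExp_apply, modeExp_apply, mul_smul_comm, smul_mul_assoc, ntr_smul,
    ntr_smul]
  simp only [mul_add, add_mul, ntr_add]
  have key : ∀ a b : FockOp ι, ntr (Xᴴ * (a * Y * b)) = ntr (b * Xᴴ * a * Y) := by
    intro a b
    rw [← mul_assoc, ntr_mul_comm, ← mul_assoc, ← mul_assoc]
  rw [key, key, key, key]
  ring

/-- The squared normalized Hilbert-Schmidt norm. -/
def hsSq (X : FockOp ι) : ℝ := (ntr (Xᴴ * X)).re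

lemma hsSq_nonneg (X : FockOp ι) : 0 ≤ hsSq X := by
  have h1 : (Xᴴ * X).trace = ((∑ i, ∑ j, ‖X j i‖ ^ 2 : ℝ) : ℂ) := by
    simp only [Matrix.trace, Matrix.diag, Matrix.mul_apply, Matrix.conjTranspose_apply]
    push_cast
    refine Finset.sum_congr rfl fun i _ => Finset.sum_congr rfl fun j _ => ?_
    rw [mul_comm]
    exact Complex.mul_conj' _
  have h2 : hsSq X = (∑ i, ∑ j, ‖X j i‖ ^ 2) / 2 ^ Fintype.card ι := by
    rw [hsSq, ntr, h1]
    norm_cast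
  rw [h2]
  positivity

lemma hsSq_modeExp (μ : ι) (X : FockOp ι) : hsSq (modeExp μ X) = (ntr (Xᴴ * modeExp μ X)).re := by
  rw [hsSq, ← ntr_conj_mul_modeExp, modeExp_modeExp]

lemma hsSq_sub_modeExp (μ : ι) (X : FockOp ι) :
    hsSq (X - modeExp μ X) = hsSq X - hsSq (modeExp μ X) := by
  have h1 := ntr_conj_mul_modeExp μ X (modeExp μ X)
  rw [modeExp_modeExp] at h1
  have h2 := ntr_conj_mul_modeExp μ X X
  have h3 : hsSq (X - modeExp μ X) = (ntr (Xᴴ * X)).re - (ntr (Xᴴ * modeExp μ X)).re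
      - (ntr ((modeExp μ X)ᴴ * X)).re + (ntr ((modeExp μ X)ᴴ * modeExp μ X)).re := by
    rw [hsSq, Matrix.conjTranspose_sub, mul_sub, sub_mul, sub_mul, ntr_sub, ntr_sub, ntr_sub]
    simp only [Complex.sub_re]
    ring
  rw [h3, ← h2, ← h1, hsSq_modeExp, hsSq]
  ring

lemma hsSq_modeExp_le (μ : ι) (X : FockOp ι) : hsSq (modeExp μ X) ≤ hsSq X := by
  have := hsSq_nonneg (X - modeExp μ X)
  rw [hsSq_sub_modeExp] at this
  linarith

lemma ntr_modeExp (μ : ι) (X : FockOp ι) : ntr (modeExp μ X) = ntr X := by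
  have := ntr_conj_mul_modeExp μ 1 X
  rwa [modeExp_one, Matrix.conjTranspose_one, one_mul, one_mul] at this

/-- Pythagoras for the component of X along the identity. -/
lemma norm_ntr_sq_le (X : FockOp ι) : ‖ntr X‖ ^ 2 ≤ hsSq X := by
  have h := hsSq_nonneg (X - ntr X • 1)
  have h1 : hsSq (X - ntr X • 1) = hsSq X - ‖ntr X‖ ^ 2 := by
    have h2 : ntr ((X - ntr X • 1)ᴴ * (X - ntr X • 1)) = ntr (Xᴴ * X) - star (ntr X) * ntr X := by
      rw [Matrix.conjTranspose_sub, Matrix.conjTranspose_smul, Matrix.conjTranspose_one, mul_sub,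
        sub_mul, sub_mul, ntr_sub, ntr_sub, ntr_sub]
      simp only [smul_mul_assoc, mul_smul_comm, one_mul, mul_one, ntr_smul, ntr_one,
        ntr_conjTranspose]
      ring
    have h3 : star (ntr X) * ntr X = ((‖ntr X‖ ^ 2 : ℝ) : ℂ) := by
      push_cast; exact Complex.conj_mul' _
    rw [hsSq, h2, h3, Complex.sub_re, Complex.ofReal_re]; rfl
  linarith

/-- The composition of the conditional expectations of the modes of `l`. -/
def listExp (l : List ι) (X : FockOp ι) : FockOp ι := l.foldr (fun μ => modeExp μ) X

lemma listExp_cons (μ : ι) (l : List ι) (X : FockOp ι) :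
    listExp (μ :: l) X = modeExp μ (listExp l X) := rfl

lemma listExp_modeExp (l : List ι) (μ : ι) (X : FockOp ι) :
    listExp l (modeExp μ X) = modeExp μ (listExp l X) := by
  induction l with
  | nil => rfl
  | cons ν l ih => rw [listExp_cons, ih, modeExp_comm, listExp_cons]

lemma listExp_sub (l : List ι) (X Y : FockOp ι) :
    listExp l (X - Y) = listExp l X - listExp l Y := by
  induction l with
  | nil => rfl
  | cons ν l ih => rw [listExp_cons, ih, map_sub, listExp_cons, listExp_cons]

lemma hsSq_listExp_le (l : List ι) (X : FockOp ι) : hsSq (listExp l X) ≤ hsSq X := by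
  induction l with
  | nil => exact le_rfl
  | cons ν l ih => exact (hsSq_modeExp_le ν _).trans ih

lemma ntr_listExp (l : List ι) (X : FockOp ι) : ntr (listExp l X) = ntr X := by
  induction l with
  | nil => rfl
  | cons ν l ih => rw [listExp_cons, ntr_modeExp, ih]

lemma modeExp_listExp_of_mem {l : List ι} {μ : ι} (h : μ ∈ l) (X : FockOp ι) :
    modeExp μ (listExp l X) = listExp l X := by
  induction l with
  | nil => simp at h
  | cons ν l ih =>
    rw [listExp_cons]
    rcases List.mem_cons.1 h with rfl | h
    · exact modeExp_modeExp _ _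
    · rw [modeExp_comm, ih h]

/-- A union bound for commuting projections: one more projection removes the norm of the projected X
− E_μ X, which is at most that of X − E_μ X itself. -/
lemma hsSq_sub_listExp_le (l : List ι) (X : FockOp ι) :
    hsSq X - hsSq (listExp l X) ≤ (l.map fun μ => hsSq X - hsSq (modeExp μ X)).sum := by
  induction l with
  | nil => simp [listExp]
  | cons μ l ih =>
    rw [List.map_cons, List.sum_cons, listExp_cons]
    have h1 := hsSq_sub_modeExp μ (listExp l X)
    have h2 : listExp l X - modeExp μ (listExp l X) = listExp l (X - modeExp μ X) := by
      rw [listExp_sub, listExp_modeExp]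
    have h3 := hsSq_listExp_le l (X - modeExp μ X)
    rw [← h2, h1, hsSq_sub_modeExp] at h3
    linarith

/-- The image commutes with every mode, hence is scalar by irreducibility, and the preserved trace
identifies the scalar. -/
lemma hsSq_listExp_of_forall_mem {l : List ι} (hl : ∀ μ, μ ∈ l) (X : FockOp ι) :
    hsSq (listExp l X) = ‖ntr X‖ ^ 2 := by
  have h1 : listExp l X = listExp l X ∅ ∅ • 1 := by
    refine eq_smul_one_of_commute (fun μ => ?_) (fun μ => ?_)
    · rw [← modeExp_listExp_of_mem (hl μ)]; exact commute_annihilate_modeExp _ _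
    · rw [← modeExp_listExp_of_mem (hl μ)]; exact commute_create_modeExp _ _
  set c := listExp l X ∅ ∅ with hc
  have h2 : ntr X = c := by rw [← ntr_listExp l, h1, ntr_smul, ntr_one, mul_one]
  have h3 : hsSq (c • (1 : FockOp ι)) = (star c * c).re := by
    rw [hsSq, Matrix.conjTranspose_smul, Matrix.conjTranspose_one, smul_mul_assoc, mul_smul_comm,
      one_mul, ntr_smul, ntr_smul, ntr_one, mul_one]
  have h4 : star c * c = ((‖c‖ ^ 2 : ℝ) : ℂ) := by push_cast; exact Complex.conj_mul' _
  rw [h1, h3, h4, Complex.ofReal_re, h2]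

variable {U V : FockOp ι}

lemma costHST_eq (U V : FockOp ι) : costHST U V = 1 - ‖ntr (U * Vᴴ)‖ ^ 2 := by
  rw [costHST, ntr, norm_div, div_pow, norm_pow, ← pow_mul, mul_comm, pow_mul]
  norm_num

lemma hsSq_mul_conjTranspose (hU : U ∈ unitary (FockOp ι)) (hV : V ∈ unitary (FockOp ι)) :
    hsSq (U * Vᴴ) = 1 := by
  have h := mul_mem hU (Unitary.star_mem hV)
  have h1 : (U * Vᴴ)ᴴ * (U * Vᴴ) = 1 := Unitary.star_mul_self_of_mem h
  rw [hsSq, h1, ntr_one]; simp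

lemma costLHSTMode_eq_hsSq (μ : ι) (hU : Commute (parity ι) U) (hV : Commute (parity ι) V) :
    costLHSTMode μ U V = 1 - hsSq (modeExp μ (U * Vᴴ)) := by
  rw [costLHSTMode_eq μ hU hV, hsSq_modeExp]

lemma costLHST_le_costHST [Nonempty ι] (hU : Commute (parity ι) U) (hV : Commute (parity ι) V) :
    costLHST U V ≤ costHST U V := by
  have hpos : (0 : ℝ) < Fintype.card ι := by exact_mod_cast Fintype.card_pos
  rw [costLHST, one_div, inv_mul_le_iff₀ hpos, costHST_eq]
  have h : ∀ μ ∈ (Finset.univ : Finset ι), costLHSTMode μ U V ≤ 1 - ‖ntr (U * Vᴴ)‖ ^ 2 := by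
    intro μ _
    rw [costLHSTMode_eq_hsSq μ hU hV, ← ntr_modeExp μ]
    have := norm_ntr_sq_le (modeExp μ (U * Vᴴ))
    linarith
  refine (Finset.sum_le_sum h).trans ?_
  rw [Finset.sum_const, nsmul_eq_mul, Finset.card_univ]

lemma costHST_le_card_mul_costLHST [Nonempty ι] (hU : Commute (parity ι) U)
    (hV : Commute (parity ι) V) (hU' : U ∈ unitary (FockOp ι)) (hV' : V ∈ unitary (FockOp ι)) :
    costHST U V ≤ Fintype.card ι * costLHST U V := by
  have hpos : (0 : ℝ) < Fintype.card ι := by exact_mod_cast Fintype.card_pos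
  rw [costLHST, one_div, mul_inv_cancel_left₀ hpos.ne', costHST_eq]
  have h1 := hsSq_sub_listExp_le (Finset.univ : Finset ι).toList (U * Vᴴ)
  rw [hsSq_listExp_of_forall_mem (by simp), hsSq_mul_conjTranspose hU' hV', Finset.sum_map_toList]
    at h1
  refine h1.trans (Finset.sum_le_sum fun μ _ => ?_)
  rw [costLHSTMode_eq_hsSq μ hU hV]

end CostInequalities

/-! ### Conjugation by a layer of gates -/

lemma star_list_prod {B : Type*} [Ring B] [StarRing B] (l : List B) :
    star l.prod = (l.reverse.map star).prod := by
  induction l with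
  | nil => simp
  | cons a l ih => simp [ih]

section Layers

variable {L : ℕ}

lemma star_mem_evenOn {S : Set (Fin L)} {x : FockOp (Mode L)} (hx : x ∈ evenOn S) :
    star x ∈ evenOn S := by
  induction hx using Algebra.adjoin_induction with
  | algebraMap r =>
    rw [← algebraMap_star_comm]; exact algebraMap_mem _ _
  | add x x' _ _ h1 h2 => rw [star_add]; exact add_mem h1 h2
  | mul x x' _ _ h1 h2 => rw [star_mul]; exact mul_mem h2 h1
  | mem x hx =>
    obtain ⟨a, b, ⟨i, hi, σ, ha⟩, ⟨j, hj, σ', hb⟩, rfl⟩ := hx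
    have key : ∀ (μ : Mode L) (a : FockOp (Mode L)), a = annihilate μ ∨ a = create μ →
        star a = annihilate μ ∨ star a = create μ := by
      rintro μ a (rfl | rfl)
      · exact Or.inr rfl
      · exact Or.inl (conjTranspose_create μ)
    rw [star_mul]
    exact Algebra.subset_adjoin ⟨_, _, ⟨j, hj, σ', key _ b hb⟩, ⟨i, hi, σ, key _ a ha⟩, rfl⟩

lemma star_mul_mul_of_commute {B : Type*} [Ring B] [StarRing B] {P z : B} (hP : P ∈ unitary B)
    (h : Commute P z) : star P * z * P = z := by
  rw [mul_assoc, ← h.eq, ← mul_assoc, Unitary.star_mul_self_of_mem hP, one_mul]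

lemma list_map_prod_mem_unitary {J B : Type*} [Ring B] [StarRing B] {l : List J} {u : J → B}
    (h : ∀ j ∈ l, u j ∈ unitary B) : (l.map u).prod ∈ unitary B := by
  refine list_prod_mem fun x hx => ?_
  obtain ⟨j, hj, rfl⟩ := List.mem_map.1 hx
  exact h j hj

/-- A layer of gates acts on an operator on one bond through the gate of that bond. -/
lemma layer_conj_eq {l : List (Fin L)} (hl : l.Nodup) {u : Fin L → FockOp (Mode L)}
    (hu : ∀ j ∈ l, u j ∈ unitary (FockOp (Mode L))) (hev : ∀ j ∈ l, u j ∈ evenOn (block j 2))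
    {j₀ : Fin L} (hj₀ : j₀ ∈ l) (hd : ∀ j ∈ l, j ≠ j₀ → Disjoint (block j 2) (block j₀ 2))
    {y : FockOp (Mode L)} (hy : y ∈ localAlg (block j₀ 2)) :
    star (l.map u).prod * y * (l.map u).prod = star (u j₀) * y * u j₀ := by
  have hy' : star (u j₀) * y * u j₀ ∈ localAlg (block j₀ 2) :=
    mul_mem (mul_mem (evenOn_le_localAlg _ (star_mem_evenOn (hev j₀ hj₀))) hy)
      (evenOn_le_localAlg _ (hev j₀ hj₀))
  have hcomm : ∀ j ∈ l, j ≠ j₀ → ∀ z ∈ localAlg (block j₀ 2), Commute (u j) z :=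
    fun j hj hne z hz => commute_of_disjoint (hd j hj hne) (hev j hj) hz
  clear hev hd
  induction l with
  | nil => simp at hj₀
  | cons j l ih =>
    rw [List.nodup_cons] at hl
    rw [List.map_cons, List.prod_cons, star_mul]
    have hul : ∀ i ∈ l, u i ∈ unitary (FockOp (Mode L)) := fun i hi =>
      hu i (List.mem_cons_of_mem _ hi)
    by_cases h : j = j₀
    · subst h
      -- Once the gate of the bond has acted, the result is still supported on that bond, so the
      -- remaining gates cancel against their adjoints.
      have h1 : Commute (l.map u).prod (star (u j) * y * u j) := by
        refine Commute.list_prod_left _ _ fun x hx => ?_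
        obtain ⟨i, hi, rfl⟩ := List.mem_map.1 hx
        exact hcomm i (List.mem_cons_of_mem _ hi) (fun h => hl.1 (h ▸ hi)) _ hy'
      have h2 := star_mul_mul_of_commute (list_map_prod_mem_unitary hul) h1
      calc _ = star (l.map u).prod * (star (u j) * y * u j) * (l.map u).prod := by
            simp only [mul_assoc]
        _ = _ := h2
    · have h1 := star_mul_mul_of_commute (hu j List.mem_cons_self)
        (hcomm j List.mem_cons_self h y hy)
      calc _ = star (l.map u).prod * (star (u j) * y * u j) * (l.map u).prod := by
            simp only [mul_assoc]
        _ = _ := by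
            rw [h1]
            exact ih hl.2 hul (by simpa [Ne.symm h] using hj₀) fun i hi =>
              hcomm i (List.mem_cons_of_mem _ hi)

end Layers

/-! ### The light cone of the circuit inside a window -/

section LightCone

variable {L r : ℕ}

/-- The sites of an open chain of `2r+1` sites within the distance `m` from the centre. -/
def ball (r m : ℕ) : Set (Fin (2 * r + 1)) := {k | r ≤ k.val + m ∧ k.val ≤ r + m}

/-- The unitary `P` of the ring acts near the centre of the window like the unitary `Q` of the
window, and spreads operators by at most one site. -/
def ActsAs (hL : 2 * r + 1 ≤ L) (b : Fin L) (P : FockOp (Mode L))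
    (Q : FockOp (Mode (2 * r + 1))) : Prop :=
  ∀ m < r, ∀ x ∈ localAlg (ball r m),
    star P * window hL b x * P = window hL b (star Q * x * Q) ∧
      star Q * x * Q ∈ localAlg (ball r (m + 1))

/-- Each layer enlarges the radius by one, so m + l.length ≤ r keeps every intermediate operator
where the next layer of the window acts like that of the ring. -/
lemma actsAs_list {hL : 2 * r + 1 ≤ L} {b : Fin L} {Λ : Type*} (l : List Λ)
    {P : Λ → FockOp (Mode L)} {Q : Λ → FockOp (Mode (2 * r + 1))}
    (h : ∀ a ∈ l, ActsAs hL b (P a) (Q a)) {m : ℕ} (hm : m + l.length ≤ r)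
    {x : FockOp (Mode (2 * r + 1))} (hx : x ∈ localAlg (ball r m)) :
    star (l.map P).prod * window hL b x * (l.map P).prod =
      window hL b (star (l.map Q).prod * x * (l.map Q).prod) := by
  induction l generalizing m x with
  | nil => simp
  | cons a l ih =>
    rw [List.length_cons] at hm
    obtain ⟨h1, h2⟩ := h a List.mem_cons_self m (by omega) x hx
    have h3 := ih (fun a' ha' => h a' (List.mem_cons_of_mem _ ha')) (m := m + 1) (by omega) h2
    simp only [List.map_cons, List.prod_cons, star_mul]
    calc _ = star (l.map P).prod * (star (P a) * window hL b x * P a) * (l.map P).prod := by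
          simp only [mul_assoc]
      _ = _ := by
          rw [h1, h3]
          simp only [mul_assoc]

lemma shift_val_of_lt {n : ℕ} (j : Fin n) {k : ℕ} (h : j.val + k < n) :
    (shift j k).val = j.val + k := Nat.mod_eq_of_lt h

lemma shift_mod_two (hL : Even L) (b : Fin L) (k : ℕ) :
    (shift b k).val % 2 = (b.val + k) % 2 :=
  Nat.mod_mod_of_dvd _ hL.two_dvd

/-- Conjugation by a unitary is multiplicative, so single fermion operators suffice. Their site lies
on exactly one bond of the layer, and m < r places this bond inside the window; bonds cut off at the
ends of the window play no role. -/
lemma actsAs_layer (hLe : Even L) (hL : 2 * r + 1 ≤ L) (b : Fin L) {β p : ℕ}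
    (hb : b.val % 2 = β % 2) {l : List (Fin L)} (hl : l.Nodup) (hlm : ∀ j, j ∈ l ↔ j.val % 2 = p)
    {l' : List (Fin (2 * r + 1))} (hl' : l'.Nodup)
    (hlm' : ∀ k, k ∈ l' ↔ (β + k.val) % 2 = p ∧ k.val + 1 < 2 * r + 1) (hp : p < 2)
    {u : Fin L → FockOp (Mode L)} {u' : Fin (2 * r + 1) → FockOp (Mode (2 * r + 1))}
    (hu : ∀ j ∈ l, u j ∈ unitary (FockOp (Mode L))) (hev : ∀ j ∈ l, u j ∈ evenOn (block j 2))
    (hu' : ∀ k ∈ l', u' k ∈ unitary (FockOp (Mode (2 * r + 1))))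
    (hev' : ∀ k ∈ l', u' k ∈ evenOn (block k 2))
    (huu : ∀ k ∈ l', window hL b (u' k) = u (shift b k)) :
    ActsAs hL b (l.map u).prod (l'.map u').prod := by
  intro m hm x hx
  have hQ := list_map_prod_mem_unitary hu'
  have hP := list_map_prod_mem_unitary hu
  set Q := (l'.map u').prod with hQdef
  set P := (l.map u).prod with hPdef
  induction hx using Algebra.adjoin_induction with
  | algebraMap c =>
    rw [star_mul_mul_of_commute hQ (Algebra.commutes c Q).symm, AlgHomClass.commutes,
      star_mul_mul_of_commute hP (Algebra.commutes c P).symm]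
    exact ⟨rfl, algebraMap_mem _ c⟩
  | add x x' _ _ h1 h2 =>
    rw [map_add, mul_add, mul_add, add_mul, add_mul, map_add, h1.1, h2.1]
    exact ⟨rfl, add_mem h1.2 h2.2⟩
  | mul x x' _ _ h1 h2 =>
    have e1 : star Q * (x * x') * Q = (star Q * x * Q) * (star Q * x' * Q) := by
      calc _ = star Q * x * 1 * x' * Q := by simp only [mul_assoc, mul_one]
        _ = _ := by rw [← Unitary.mul_star_self_of_mem hQ]; simp only [mul_assoc]
    have e2 : star P * (window hL b x * window hL b x') * P =
        (star P * window hL b x * P) * (star P * window hL b x' * P) := by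
      calc _ = star P * window hL b x * 1 * window hL b x' * P := by simp only [mul_assoc, mul_one]
        _ = _ := by rw [← Unitary.mul_star_self_of_mem hP]; simp only [mul_assoc]
    rw [map_mul, e1, e2, map_mul, h1.1, h2.1]
    exact ⟨rfl, mul_mem h1.2 h2.2⟩
  | mem x hx =>
    obtain ⟨k, hk, σ, hx⟩ := hx
    obtain ⟨hk1, hk2⟩ : r ≤ k.val + m ∧ k.val ≤ r + m := hk
    -- The parity decides whether k is the left or the right end of its bond; since m < r, both k−1
    -- and k+1 are sites of the window.
    obtain ⟨k₀, hk₀, hk₀l⟩ : ∃ k₀ : Fin (2 * r + 1), (k.val = k₀.val ∨ k.val = k₀.val + 1) ∧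
        k₀ ∈ l' := by
      by_cases h : (β + k.val) % 2 = p
      · exact ⟨k, Or.inl rfl, (hlm' k).2 ⟨h, by omega⟩⟩
      · exact ⟨⟨k.val - 1, by omega⟩, Or.inr (by simp only; omega),
          (hlm' _).2 ⟨by simp only; omega, by simp only; omega⟩⟩
    obtain ⟨hk₀p, hk₀1⟩ := (hlm' k₀).1 hk₀l
    have hkb : k ∈ block k₀ 2 := by
      rcases hk₀ with h | h
      · exact ⟨0, two_pos, Fin.ext (by rw [shift_zero, h])⟩
      · exact ⟨1, one_lt_two, Fin.ext (by rw [shift_val_of_lt k₀ hk₀1, h])⟩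
    have hxl : x ∈ localAlg (block k₀ 2) := Algebra.subset_adjoin ⟨k, hkb, σ, hx⟩
    have hj₀ : shift b k₀ ∈ l := (hlm _).2 (by rw [shift_mod_two hLe]; omega)
    have hd' : ∀ k ∈ l', k ≠ k₀ → Disjoint (block k 2) (block k₀ 2) := by
      intro k' hk' hne
      obtain ⟨h1, h2⟩ := (hlm' k').1 hk'
      rw [Set.disjoint_left]
      rintro z ⟨q, hq, rfl⟩ ⟨q', hq', hz⟩
      have h3 := congr_arg Fin.val hz
      rw [shift_val_of_lt k' (by omega), shift_val_of_lt k₀ (by omega)] at h3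
      exact hne (Fin.ext (by omega))
    -- On an even ring parity survives wrapping around, so two left ends of equal parity can share a
    -- site only at equal offsets, and then coincide.
    have hd : ∀ j ∈ l, j ≠ shift b k₀ → Disjoint (block j 2) (block (shift b k₀) 2) := by
      intro j hj hne
      have h1 := (hlm j).1 hj
      have h2 := (hlm _).1 hj₀
      rw [Set.disjoint_left]
      rintro z ⟨q, hq, rfl⟩ ⟨q', hq', hz⟩
      have h3 := congr_arg (fun x : Fin L => x.val % 2) hz
      simp only [shift_mod_two hLe _ q, shift_mod_two hLe _ q'] at h3
      have h4 : q = q' := by omega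
      subst h4
      have h5 := (shift_congr_int j q).symm.trans
        ((congr_arg (fun x : Fin L => (x : ℤ)) hz) ▸ shift_congr_int (shift b k₀) q)
      exact hne (eq_of_int_modEq (Int.ModEq.add_right_cancel' _ h5))
    have hwx : window hL b x ∈ localAlg (block (shift b k₀) 2) := by
      refine window_mem_localAlg hL b ?_ hxl
      rintro z ⟨q, hq, rfl⟩
      exact ⟨q, hq, by rw [shift_val_of_lt k₀ (by omega), shift_shift]⟩
    have e1 := layer_conj_eq hl' hu' hev' hk₀l hd' hxl
    have e2 := layer_conj_eq hl hu hev hj₀ hd hwx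
    rw [← hQdef] at e1
    rw [← hPdef] at e2
    rw [e1, e2, map_mul, map_mul, map_star, huu k₀ hk₀l]
    refine ⟨rfl, ?_⟩
    have hsub : block k₀ 2 ⊆ ball r (m + 1) := by
      rintro z ⟨q, hq, rfl⟩
      change r ≤ (shift k₀ q).val + (m + 1) ∧ (shift k₀ q).val ≤ r + (m + 1)
      rw [shift_val_of_lt k₀ (by omega)]
      omega
    exact localAlg_mono hsub (mul_mem (mul_mem (evenOn_le_localAlg _ (star_mem_evenOn
      (hev' k₀ hk₀l))) hxl) (evenOn_le_localAlg _ (hev' k₀ hk₀l)))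

/-- The left ends of the bonds of a layer. -/
def bonds (t : Bool) (L : ℕ) : List (Fin L) :=
  List.ofFn fun i : Fin (L / 2) =>
    (⟨2 * i.val + t.toNat, by have := i.isLt; have := t.toNat_lt; omega⟩ : Fin L)

lemma bonds_nodup (t : Bool) (L : ℕ) : (bonds t L).Nodup := by
  refine List.nodup_ofFn_ofInjective fun i j h => ?_
  have := congr_arg Fin.val h
  exact Fin.ext (by simp only at this; omega)

lemma mem_bonds (hL : Even L) (t : Bool) (j : Fin L) : j ∈ bonds t L ↔ j.val % 2 = t.toNat := by
  have ht := t.toNat_lt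
  rw [bonds, List.mem_ofFn]
  constructor
  · rintro ⟨i, rfl⟩
    simp only
    omega
  · intro h
    have hj := j.isLt
    obtain ⟨m, hm⟩ := hL
    exact ⟨⟨j.val / 2, by omega⟩, Fin.ext (by simp only; omega)⟩

/-- A layer of the brick-wall ansatz. -/
def layer (L : ℕ) (a : Bool × FPoly 2) : FockOp (Mode L) :=
  ((bonds a.1 L).map fun j => place j a.2).prod

lemma layerA_eq (g : FPoly 2) (L : ℕ) : layerA g L = layer L (false, g) := by
  rw [layer, layerA, bonds, List.map_ofFn]; rfl

lemma layerB_eq (g : FPoly 2) (L : ℕ) : layerB g L = layer L (true, g) := by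
  rw [layer, layerB, bonds, List.map_ofFn]; rfl

/-- The left ends of the bonds of a layer in a window of the ring. -/
def windowBonds (β : ℕ) (t : Bool) (n : ℕ) : List (Fin n) :=
  (List.finRange n).filter fun k => (β + k.val) % 2 = t.toNat ∧ k.val + 1 < n

/-- The gates of a layer in a window of the ring. -/
def windowLayer (β n : ℕ) (a : Bool × FPoly 2) : FockOp (Mode n) :=
  ((windowBonds β a.1 n).map fun j => place j a.2).prod

lemma windowBonds_nodup (β : ℕ) (t : Bool) (n : ℕ) : (windowBonds β t n).Nodup :=
  (List.nodup_finRange n).filter _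

lemma mem_windowBonds (β : ℕ) (t : Bool) (n : ℕ) (k : Fin n) :
    k ∈ windowBonds β t n ↔ (β + k.val) % 2 = t.toNat ∧ k.val + 1 < n := by
  simp [windowBonds]

variable {a : Bool × FPoly 2}

lemma layer_mem_unitary (hL : 2 ≤ L) (ha : IsUnitaryPoly (n := 1) a.2) :
    layer L a ∈ unitary (FockOp (Mode L)) :=
  list_map_prod_mem_unitary fun j _ => ha.place hL j

lemma commute_parity_layer (hae : a.2 ∈ evenPoly 2) : Commute (parity (Mode L)) (layer L a) := by
  refine Commute.list_prod_right _ _ fun x hx => ?_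
  obtain ⟨j, _, rfl⟩ := List.mem_map.1 hx
  exact commute_parity_of_mem_evenOn (place_mem_evenOn j hae)

lemma actsAs_windowLayer (hLe : Even L) (hL : 2 * r + 1 ≤ L) (b : Fin L) {β : ℕ}
    (hb : b.val % 2 = β % 2) (hae : a.2 ∈ evenPoly 2) (ha : IsUnitaryPoly (n := 1) a.2) :
    ActsAs hL b (layer L a) (windowLayer β (2 * r + 1) a) := by
  rcases Nat.eq_zero_or_pos r with rfl | hr
  · exact fun m hm => absurd hm (Nat.not_lt_zero m)
  refine actsAs_layer hLe hL b hb (bonds_nodup _ L) (mem_bonds hLe a.1) (windowBonds_nodup _ _ _)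
    (mem_windowBonds β a.1 _) a.1.toNat_lt (fun j _ => ha.place (by omega) j)
    (fun j _ => place_mem_evenOn j hae) (fun j _ => ha.place (by omega) j)
    (fun j _ => place_mem_evenOn j hae) fun k hk => window_place hL b k ?_ _
  have := ((mem_windowBonds _ _ _ _).1 hk).2
  omega

/-- The adjoint of a layer is again a layer, with adjoint gates in reverse order. It is needed
because half of the circuit is moved to the other factor of the trace. -/
lemma actsAs_star_windowLayer (hLe : Even L) (hL : 2 * r + 1 ≤ L) (b : Fin L) {β : ℕ}
    (hb : b.val % 2 = β % 2) (hae : a.2 ∈ evenPoly 2) (ha : IsUnitaryPoly (n := 1) a.2) :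
    ActsAs hL b (star (layer L a)) (star (windowLayer β (2 * r + 1) a)) := by
  rcases Nat.eq_zero_or_pos r with rfl | hr
  · exact fun m hm => absurd hm (Nat.not_lt_zero m)
  have h1 : star (layer L a) = ((bonds a.1 L).reverse.map fun j => star (place j a.2)).prod := by
    rw [layer, star_list_prod, ← List.map_reverse, List.map_map]; rfl
  have h2 : star (windowLayer β (2 * r + 1) a) =
      ((windowBonds β a.1 (2 * r + 1)).reverse.map fun j => star (place j a.2)).prod := by
    rw [windowLayer, star_list_prod, ← List.map_reverse, List.map_map]; rfl
  rw [h1, h2]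
  refine actsAs_layer hLe hL b hb (List.nodup_reverse.2 (bonds_nodup _ L))
    (fun j => List.mem_reverse.trans (mem_bonds hLe a.1 j))
    (List.nodup_reverse.2 (windowBonds_nodup _ _ _))
    (fun j => List.mem_reverse.trans (mem_windowBonds β a.1 _ j)) a.1.toNat_lt
    (fun j _ => Unitary.star_mem (ha.place (by omega) j))
    (fun j _ => star_mem_evenOn (place_mem_evenOn j hae))
    (fun j _ => Unitary.star_mem (ha.place (by omega) j))
    (fun j _ => star_mem_evenOn (place_mem_evenOn j hae)) fun k hk => ?_
  rw [map_star, window_place hL b k ?_]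
  have := ((mem_windowBonds _ _ _ _).1 (List.mem_reverse.1 hk)).2
  omega

/-- The layers of the brick-wall ansatz. -/
def layers {d : ℕ} (G : Fin d → ℝ → FPoly 2) (θ : Fin (2 * d) → ℝ) : List (Bool × FPoly 2) :=
  (List.ofFn fun k : Fin d => [(true, G k (θ ⟨2 * k.val + 1, by have := k.isLt; omega⟩)),
    (false, G k (θ ⟨2 * k.val, by have := k.isLt; omega⟩))]).flatten

variable {d : ℕ} {G : Fin d → ℝ → FPoly 2} {θ : Fin (2 * d) → ℝ}

lemma length_layers : (layers G θ).length = 2 * d := by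
  rw [layers, List.length_flatten, List.map_ofFn]
  simp [Function.comp_def, List.ofFn_const, mul_comm]

lemma ansatz_eq (L : ℕ) : ansatz G θ L = ((layers G θ).map (layer L)).prod := by
  rw [layers, List.map_flatten, List.prod_flatten, List.map_ofFn, List.map_ofFn, ansatz]
  congr 2
  funext k
  simp [layerA_eq, layerB_eq]

lemma forall_mem_layers {p : FPoly 2 → Prop} (h : ∀ k t, p (G k t)) : ∀ a ∈ layers G θ, p a.2 := by
  intro a ha
  rw [layers, List.mem_flatten] at ha
  obtain ⟨l, hl, hal⟩ := ha
  obtain ⟨k, rfl⟩ := List.mem_ofFn.1 hl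
  simp only [List.mem_cons, List.not_mem_nil, or_false] at hal
  rcases hal with rfl | rfl <;> exact h _ _

end LightCone

/-! ### Norms and supports of the matrix units of a mode -/

open scoped Matrix.Norms.L2Operator

section Norms

variable {ι : Type*} [Fintype ι] [LinearOrder ι]

lemma norm_apply_le (X : FockOp ι) (s t : Finset ι) : ‖X s t‖ ≤ ‖X‖ := by
  have h := Matrix.l2_opNorm_mulVec X (EuclideanSpace.single t (1 : ℂ))
  have h1 := (PiLp.norm_apply_le _ s).trans h
  simpa using h1

lemma norm_ntr_le (X : FockOp ι) : ‖ntr X‖ ≤ ‖X‖ := by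
  have h : ‖X.trace‖ ≤ 2 ^ Fintype.card ι * ‖X‖ := by
    refine (norm_sum_le _ _).trans ((Finset.sum_le_card_nsmul _ _ ‖X‖ fun s _ =>
      norm_apply_le X s s).trans ?_)
    rw [Finset.card_univ, Fintype.card_finset, nsmul_eq_mul]
    push_cast
    exact le_rfl
  rw [ntr, norm_div, norm_pow, Complex.norm_ofNat, div_le_iff₀ (by positivity), mul_comm]
  exact h

/-- The number operator is a self-adjoint idempotent, so the C*-identity gives ‖N‖² = ‖N‖. -/
lemma norm_number_le (μ : ι) : ‖(create μ * annihilate μ : FockOp ι)‖ ≤ 1 := by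
  set N : FockOp ι := create μ * annihilate μ with hN
  have h1 : Nᴴ = N := by
    rw [hN, Matrix.conjTranspose_mul, conjTranspose_annihilate, conjTranspose_create]
  have h2 : N * N = N := by
    calc N * N = create μ * (annihilate μ * create μ) * annihilate μ := by
          rw [hN]; simp only [mul_assoc]
      _ = N := by
          rw [annihilate_mul_create, mul_sub, sub_mul, mul_one, ← mul_assoc, create_mul_self,
            zero_mul, zero_mul, sub_zero]
  have h3 := Matrix.l2_opNorm_conjTranspose_mul_self N
  rw [h1, h2] at h3
  nlinarith [norm_nonneg N]

lemma norm_annihilate_le (μ : ι) : ‖(annihilate μ : FockOp ι)‖ ≤ 1 := by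
  have h := Matrix.l2_opNorm_conjTranspose_mul_self (annihilate μ : FockOp ι)
  rw [conjTranspose_annihilate] at h
  nlinarith [norm_nonneg (annihilate μ : FockOp ι), norm_number_le μ]

lemma norm_create_le (μ : ι) : ‖(create μ : FockOp ι)‖ ≤ 1 := by
  rw [create, Matrix.l2_opNorm_conjTranspose]
  exact norm_annihilate_le μ

lemma norm_modeOp_le (μ : ι) (k : Fin 4) : ‖modeOp μ k‖ ≤ 1 := by
  have ha := norm_annihilate_le μ
  have hc := norm_create_le μ
  fin_cases k
  · exact norm_number_le μ
  · exact (norm_mul_le _ _).trans (mul_le_one₀ ha (norm_nonneg _) hc)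
  · exact ha
  · exact hc

end Norms

section ModeOp

variable {L n : ℕ}

lemma modeOp_mem_localAlg {S : Set (Fin L)} {i : Fin L} (hi : i ∈ S) (σ : Fin 2) (k : Fin 4) :
    modeOp (toLex (i, σ)) k ∈ localAlg S := by
  have ha := annihilate_mem_localAlg hi σ
  have hc := create_mem_localAlg hi σ
  fin_cases k
  · exact mul_mem hc ha
  · exact mul_mem ha hc
  · exact ha
  · exact hc

lemma conjTranspose_modeOp_mem_localAlg {S : Set (Fin L)} {i : Fin L} (hi : i ∈ S) (σ : Fin 2)
    (k : Fin 4) : (modeOp (toLex (i, σ)) k)ᴴ ∈ localAlg S := by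
  have ha := annihilate_mem_localAlg hi σ
  have hc := create_mem_localAlg hi σ
  fin_cases k
  · change (create _ * annihilate _)ᴴ ∈ _
    rw [Matrix.conjTranspose_mul, conjTranspose_create, conjTranspose_annihilate]
    exact mul_mem hc ha
  · change (annihilate _ * create _)ᴴ ∈ _
    rw [Matrix.conjTranspose_mul, conjTranspose_create, conjTranspose_annihilate]
    exact mul_mem ha hc
  · exact hc
  · change (create _)ᴴ ∈ _
    rw [conjTranspose_create]
    exact ha

lemma window_modeOp (hn : n ≤ L) (b : Fin L) (j : Fin n) (σ : Fin 2) (k : Fin 4) :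
    window hn b (modeOp (toLex (j, σ)) k) = modeOp (toLex (shift b j, σ)) k := by
  fin_cases k
  · exact (map_mul _ _ _).trans (by rw [window_create, window_annihilate]; rfl)
  · exact (map_mul _ _ _).trans (by rw [window_create, window_annihilate]; rfl)
  · exact window_annihilate hn b j σ
  · exact window_create hn b j σ

end ModeOp

/-! ### Locality and embedding of the time evolution -/

section Dynamics

variable {dH L : ℕ} {h : FPoly (dH + 1)}

lemma commute_parity_evolve (hev : h ∈ evenPoly (dH + 1)) (τ : ℝ) :
    Commute (parity (Mode L)) (evolve h L τ) := by
  rw [evolve]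
  refine Commute.exp_right ((Commute.sum_right _ _ _ fun i _ => ?_).smul_right _)
  exact commute_parity_of_mem_evenOn (place_mem_evenOn i hev)

/-- A finite-dimensional subalgebra is closed, so it contains the limits of power series in its
elements. -/
lemma exp_mem_localAlg {S : Set (Fin L)} {x : FockOp (Mode L)} (hx : x ∈ localAlg S) :
    NormedSpace.exp x ∈ localAlg S := by
  let _ : NormedAlgebra ℚ (FockOp (Mode L)) := NormedAlgebra.restrictScalars ℚ ℂ _
  exact NormedSpace.exp_mem (s := localAlg S)
    (Submodule.closed_of_finiteDimensional (Subalgebra.toSubmodule (localAlg S))) hx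

lemma flow_mem_localAlg {S : Set (Fin L)} {x y : FockOp (Mode L)} (hx : x ∈ localAlg S)
    (hy : y ∈ localAlg S) (t : ℝ) : flow x t y ∈ localAlg S := by
  have h : ∀ s : ℝ, s • x ∈ localAlg S := fun s => by
    rw [← Complex.coe_smul]
    exact Subalgebra.smul_mem _ hx _
  exact mul_mem (mul_mem (exp_mem_localAlg (h _)) hy) (exp_mem_localAlg (h _))

lemma window_flow {n : ℕ} (hn : n ≤ L) (b : Fin L) (x y : FockOp (Mode n)) (t : ℝ) :
    window hn b (flow x t y) = flow (window hn b x) t (window hn b y) := by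
  let _ : NormedAlgebra ℚ (FockOp (Mode n)) := NormedAlgebra.restrictScalars ℚ ℂ _
  let _ : NormedAlgebra ℚ (FockOp (Mode L)) := NormedAlgebra.restrictScalars ℚ ℂ _
  have hc : Continuous (window hn b) :=
    LinearMap.continuous_of_finiteDimensional
      ((window hn b).toAlgHom.toLinearMap : FockOp (Mode n) →ₗ[ℂ] FockOp (Mode L))
  have hs : ∀ s : ℝ, window hn b (s • x) = s • window hn b x := fun s => by
    rw [← Complex.coe_smul, map_smul, Complex.coe_smul]
  rw [flow, map_mul, map_mul, NormedSpace.map_exp (window hn b) hc, NormedSpace.map_exp _ hc, hs, hs, flow]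

end Dynamics

/-! ### Comparing a local cost with a quantity of the window -/

section Comparison

variable {dH L r ρ : ℕ} {h : FPoly (dH + 1)}

lemma window_generator {n : ℕ} (hn : n ≤ L) (b : Fin L) (z : ℂ) {J : Finset (Fin n)}
    (hJ : ∀ j ∈ J, j.val + (dH + 1) ≤ n) :
    window hn b (generator h z J) = generator h z (J.image fun j => shift b j.val) := by
  rw [generator, generator, map_smul, map_sum, Finset.sum_image]
  · exact congr_arg _ (Finset.sum_congr rfl fun j hj => window_place hn b j (hJ j hj) h)
  · intro j _ j' _ hjj
    exact Fin.ext (shift_injective b (j.isLt.trans_le hn) (j'.isLt.trans_le hn) hjj)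

/-- The positions of the interaction terms supported in the ball of radius `ρ`. -/
def innerTerms (dH r ρ : ℕ) : Finset (Fin (2 * r + 1)) :=
  Finset.univ.filter fun j => r ≤ j.val + ρ ∧ j.val + dH ≤ r + ρ

lemma mem_innerTerms {j : Fin (2 * r + 1)} :
    j ∈ innerTerms dH r ρ ↔ r ≤ j.val + ρ ∧ j.val + dH ≤ r + ρ := by
  simp [innerTerms]

lemma generator_innerTerms_mem (hev : h ∈ evenPoly (dH + 1)) (hρ : ρ ≤ r) (z : ℂ) :
    generator h z (innerTerms dH r ρ) ∈ localAlg (ball r ρ) := by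
  refine Subalgebra.smul_mem _ (sum_mem fun j hj => ?_) _
  rw [mem_innerTerms] at hj
  refine localAlg_mono ?_ (evenOn_le_localAlg _ (place_mem_evenOn j hev))
  rintro _ ⟨k, hk, rfl⟩
  change r ≤ (shift j k).val + ρ ∧ (shift j k).val ≤ r + ρ
  rw [shift_val_of_lt j (by omega)]
  omega

/-- A term reaches dH sites to the right of its start, so every term starting at distance less than
ρ − dH from the centre lies in the ball of radius ρ. -/
lemma le_siteDist_of_notMem (hρ : ρ ≤ r) {b j : Fin L}
    (hj : j ∉ (innerTerms dH r ρ).image fun j => shift b j.val) :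
    (ρ : ℝ) - dH ≤ siteDist j (shift b r) := by
  by_contra! hlt
  have h1 : siteDist j (shift b r) + dH < ρ := by
    have : ((siteDist j (shift b r) + dH : ℕ) : ℝ) < (ρ : ℕ) := by push_cast; linarith
    exact_mod_cast this
  obtain ⟨k, hk, hkm⟩ := siteDist_le_iff.1 (le_refl (siteDist j (shift b r)))
  rw [abs_le] at hk
  -- If k is the displacement from j to the centre, the term starts at position r − k of the window.
  refine hj (Finset.mem_image.2 ⟨⟨((r : ℤ) - k).toNat, by omega⟩, ?_, ?_⟩)
  · rw [mem_innerTerms]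
    simp only
    omega
  · have h2 := shift_congr_int b ((r : ℤ) - k).toNat
    rw [Int.toNat_of_nonneg (by omega)] at h2
    have h3 := ((shift_congr_int b r).symm.trans hkm).sub_right k
    refine eq_of_int_modEq (h2.trans ?_)
    simpa [add_sub_assoc] using h3

/-- The normalized trace which approximates, in an open chain of `2r+1` sites, the overlap of the
Heisenberg evolutions of the `k`-th operator of a mode under the dynamics and under a circuit. -/
def windowOverlap (h : FPoly (dH + 1)) (τ : ℝ) (l : List (Bool × FPoly 2)) (r d β : ℕ) (σ : Fin 2)
    (k : Fin 4) : ℂ :=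
  let e : FockOp (Mode (2 * r + 1)) := modeOp (toLex (⟨r, by omega⟩, σ)) k
  let P := ((l.take d).map (windowLayer β (2 * r + 1))).prod
  let Q := ((l.drop d).reverse.map fun a => star (windowLayer β (2 * r + 1) a)).prod
  ntr ((star Q * flow (generator h (-Complex.I) (innerTerms dH r (r - d))) τ e * Q) *
    (star P * eᴴ * P))

/-- The evolved operator, truncated to radius r − d, and the bare adjoint matrix unit are each
conjugated by d of the 2d layers, reaching radii r and d ≤ r. Both stay inside the window, where the
trace no longer sees L; the only error is that of the truncation. -/
lemma norm_overlap_sub_le (hev : h ∈ evenPoly (dH + 1)) (hsa : IsSelfAdjointPoly h) {τ δ : ℝ}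
    {d : ℕ} {l : List (Bool × FPoly 2)} (hl : l.length = 2 * d) (hle : ∀ a ∈ l, a.2 ∈ evenPoly 2)
    (hlu : ∀ a ∈ l, IsUnitaryPoly (n := 1) a.2) (hdr : d ≤ r) (hLe : Even L)
    (hL : 2 * r + 1 ≤ L) (hLH : dH + 1 ≤ L) (hL2 : 2 ≤ L) (i : Fin L) (σ : Fin 2) (k : Fin 4)
    (hδ : ∀ S : Finset (Fin L), (∀ j ∉ S, ((r - d : ℕ) : ℝ) - dH ≤ siteDist j i) →
      ‖flow (generator h (-Complex.I) Finset.univ) τ (modeOp (toLex (i, σ)) k) -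
        flow (generator h (-Complex.I) S) τ (modeOp (toLex (i, σ)) k)‖ ≤ δ) :
    ‖ntr (((evolve h L τ)ᴴ * modeOp (toLex (i, σ)) k * evolve h L τ) *
        (((l.map (layer L)).prod)ᴴ * (modeOp (toLex (i, σ)) k)ᴴ * (l.map (layer L)).prod)) -
      windowOverlap h τ l r d (i.val % 2 + r) σ k‖ ≤ δ := by
  set e : FockOp (Mode L) := modeOp (toLex (i, σ)) k with he
  set V := (l.map (layer L)).prod with hV
  set β := i.val % 2 + r with hβ
  have hVu : V ∈ unitary (FockOp (Mode L)) :=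
    list_map_prod_mem_unitary fun a ha => layer_mem_unitary hL2 (hlu a ha)
  -- The window starts r sites to the left of i, a shift by L − r on the ring. Its parity is that of
  -- i + r because L is even.
  set b : Fin L := shift i (L - r) with hb
  have hbr : shift b r = i := by
    rw [hb, shift_shift, Nat.sub_add_cancel (by omega)]
    exact eq_of_int_modEq ((shift_congr_int i L).trans (Int.modEq_iff_dvd.2 ⟨-1, by ring⟩))
  have hb2 : b.val % 2 = β % 2 := by
    rw [hb, shift_mod_two hLe]
    obtain ⟨m, hm⟩ := hLe
    omega
  set J := innerTerms dH r (r - d) with hJ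
  set S := J.image fun j => shift b j.val with hS
  set c : Fin (2 * r + 1) := ⟨r, by omega⟩ with hc
  set e' : FockOp (Mode (2 * r + 1)) := modeOp (toLex (c, σ)) k with he'
  have hwe : window hL b e' = e := by
    rw [he', window_modeOp, he, show shift b c.val = i from hbr]
  have hwe' : window hL b e'ᴴ = eᴴ := by
    rw [← Matrix.star_eq_conjTranspose, map_star, hwe, Matrix.star_eq_conjTranspose]
  set X' := flow (generator h (-Complex.I) J) τ e' with hX'
  have hc0 : c ∈ ball r 0 := ⟨le_rfl, le_rfl⟩
  have hcρ : c ∈ ball r (r - d) := ⟨Nat.le_add_right _ _, Nat.le_add_right _ _⟩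
  have hX'm : X' ∈ localAlg (ball r (r - d)) :=
    flow_mem_localAlg (generator_innerTerms_mem hev (Nat.sub_le _ _) _)
      (modeOp_mem_localAlg hcρ σ k) τ
  have hwX : window hL b X' = flow (generator h (-Complex.I) S) τ e := by
    rw [hX', window_flow, window_generator, hwe]
    intro j hj
    rw [hJ, mem_innerTerms] at hj
    omega
  set X := flow (generator h (-Complex.I) (Finset.univ : Finset (Fin L))) τ e with hX
  have hXX : ‖X - window hL b X'‖ ≤ δ := by
    rw [hwX]
    exact hδ S fun j hj => hbr ▸ le_siteDist_of_notMem (Nat.sub_le _ _) hj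
  rw [evolve_conj hsa hLH, ← hX]
  have hY1 : ‖Vᴴ * eᴴ * V‖ ≤ 1 := by
    rw [CStarRing.norm_mul_mem_unitary _ hVu, ← Matrix.star_eq_conjTranspose,
      CStarRing.norm_mem_unitary_mul _ (Unitary.star_mem hVu), Matrix.l2_opNorm_conjTranspose]
    exact norm_modeOp_le _ _
  have hval : ntr (window hL b X' * (Vᴴ * eᴴ * V)) = windowOverlap h τ l r d β σ k := by
    set P := ((l.take d).map (layer L)).prod with hP
    set Q := ((l.drop d).reverse.map fun a => star (layer L a)).prod with hQ
    -- P is the left half of the circuit and Q the adjoint of the right half, so cyclicity moves Q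
    -- onto the evolved operator.
    have hVPQ : V = P * star Q := by
      rw [hQ, star_list_prod, ← List.map_reverse, List.reverse_reverse, List.map_map, hP, hV]
      conv_lhs => rw [← List.take_append_drop d l, List.map_append, List.prod_append]
      simp [Function.comp_def]
    have h1 := actsAs_list (hL := hL) (b := b) (l.take d)
      (fun a ha => actsAs_windowLayer hLe hL b hb2 (hle a (List.mem_of_mem_take ha))
        (hlu a (List.mem_of_mem_take ha))) (m := 0) (by simp; omega)
      (conjTranspose_modeOp_mem_localAlg hc0 σ k)
    have hmem : ∀ a ∈ (l.drop d).reverse, a ∈ l := fun a ha =>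
      List.mem_of_mem_drop (List.mem_reverse.1 ha)
    have h2 := actsAs_list (hL := hL) (b := b) (l.drop d).reverse
      (fun a ha => actsAs_star_windowLayer hLe hL b hb2 (hle a (hmem a ha))
        (hlu a (hmem a ha))) (m := r - d) (by simp; omega) hX'm
    rw [← hP, hwe'] at h1
    rw [← hQ] at h2
    have h3 : ntr (window hL b X' * (Vᴴ * eᴴ * V)) =
        ntr ((star Q * window hL b X' * Q) * (star P * eᴴ * P)) := by
      have : window hL b X' * (Vᴴ * eᴴ * V) =
          (window hL b X' * Q * (star P * eᴴ * P)) * star Q := by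
        rw [hVPQ, ← Matrix.star_eq_conjTranspose (P * star Q), star_mul, star_star]
        simp only [mul_assoc]
      rw [this, ntr_mul_comm]
      simp only [mul_assoc]
    rw [h3, h1, h2, ← map_mul, ntr_map, windowOverlap]
  rw [← hval, ← ntr_sub, ← sub_mul]
  refine (norm_ntr_le _).trans ((norm_mul_le _ _).trans ?_)
  calc _ ≤ δ * 1 := mul_le_mul hXX hY1 (norm_nonneg _) ((norm_nonneg _).trans hXX)
    _ = δ := mul_one _

/-- Four overlaps, each with error δ and prefactor ½, give 2δ. -/
lemma abs_costLHSTMode_sub_le (hev : h ∈ evenPoly (dH + 1)) (hsa : IsSelfAdjointPoly h) {τ δ : ℝ}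
    {d : ℕ} {l : List (Bool × FPoly 2)} (hl : l.length = 2 * d) (hle : ∀ a ∈ l, a.2 ∈ evenPoly 2)
    (hlu : ∀ a ∈ l, IsUnitaryPoly (n := 1) a.2) (hdr : d ≤ r) (hLe : Even L)
    (hL : 2 * r + 1 ≤ L) (hLH : dH + 1 ≤ L) (hL2 : 2 ≤ L) (i : Fin L) (σ : Fin 2)
    (hδ : ∀ k, ∀ S : Finset (Fin L), (∀ j ∉ S, ((r - d : ℕ) : ℝ) - dH ≤ siteDist j i) →
      ‖flow (generator h (-Complex.I) Finset.univ) τ (modeOp (toLex (i, σ)) k) -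
        flow (generator h (-Complex.I) S) τ (modeOp (toLex (i, σ)) k)‖ ≤ δ) :
    |costLHSTMode (toLex (i, σ)) (evolve h L τ) (l.map (layer L)).prod -
      (1 - (1 / 2) * ∑ k, (windowOverlap h τ l r d (i.val % 2 + r) σ k).re)| ≤ 2 * δ := by
  have hVp : Commute (parity (Mode L)) (l.map (layer L)).prod := by
    refine Commute.list_prod_right _ _ fun x hx => ?_
    obtain ⟨a, ha, rfl⟩ := List.mem_map.1 hx
    exact commute_parity_layer (hle a ha)
  have hk := fun k => norm_overlap_sub_le hev hsa hl hle hlu hdr hLe hL hLH hL2 i σ k (hδ k)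
  rw [costLHSTMode_eq _ (commute_parity_evolve hev τ) hVp, modeExp_eq_sum]
  set U := evolve h L τ
  set V := (l.map (layer L)).prod
  have h1 : ntr ((U * Vᴴ)ᴴ * ((1 / 2 : ℂ) • ∑ k, modeOp (toLex (i, σ)) k * (U * Vᴴ) *
      (modeOp (toLex (i, σ)) k)ᴴ)) = ((1 / 2 : ℝ) : ℂ) * ∑ k, ntr ((Uᴴ * modeOp (toLex (i, σ)) k * U) *
        (Vᴴ * (modeOp (toLex (i, σ)) k)ᴴ * V)) := by
    have hterm : ∀ e : FockOp (Mode L), ntr ((U * Vᴴ)ᴴ * (e * (U * Vᴴ) * eᴴ)) =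
        ntr ((Uᴴ * e * U) * (Vᴴ * eᴴ * V)) := by
      intro e
      rw [Matrix.conjTranspose_mul, Matrix.conjTranspose_conjTranspose, mul_assoc V, ntr_mul_comm]
      simp only [mul_assoc]
    have hsum : ∀ f : Fin 4 → FockOp (Mode L), ntr (∑ k, f k) = ∑ k, ntr (f k) := by
      intro f
      simp only [Fin.sum_univ_four, ntr_add]
    rw [mul_smul_comm, ntr_smul, Finset.mul_sum, hsum]
    simp only [hterm]
    norm_num
  rw [h1, Complex.re_ofReal_mul, Complex.re_sum]
  rw [show ∀ x y : ℝ, (1 - 1 / 2 * x) - (1 - 1 / 2 * y) = (1 / 2) * (y - x) from fun _ _ => by ring,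
    abs_mul, ← Finset.sum_sub_distrib]
  have h2 : |∑ k, ((windowOverlap h τ l r d (i.val % 2 + r) σ k).re -
      (ntr ((Uᴴ * modeOp (toLex (i, σ)) k * U) * (Vᴴ * (modeOp (toLex (i, σ)) k)ᴴ * V))).re)| ≤
      4 * δ := by
    refine (Finset.abs_sum_le_sum_abs _ _).trans ((Finset.sum_le_card_nsmul _ _ δ fun k _ => ?_).trans
      (by simp))
    rw [abs_sub_comm, ← Complex.sub_re]
    exact (Complex.abs_re_le_norm _).trans (hk k)
  rw [abs_of_pos (by norm_num : (0 : ℝ) < 1 / 2)]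
  linarith

end Comparison

/-! ### Averages over an even ring -/

section Average

lemma sum_range_parity {g : ℕ → ℝ} (m : ℕ) :
    ∑ k ∈ Finset.range (m + m), g (k % 2) = m * (g 0 + g 1) := by
  induction m with
  | zero => simp
  | succ m ih =>
    rw [show m + 1 + (m + 1) = (m + m) + 1 + 1 by ring, Finset.sum_range_succ, Finset.sum_range_succ,
      ih, show (m + m) % 2 = 0 by omega, show (m + m + 1) % 2 = 1 by omega]
    push_cast
    ring

lemma card_mode (L : ℕ) : Fintype.card (Mode L) = 2 * L := by
  rw [Fintype.card_lex, Fintype.card_prod, Fintype.card_fin, Fintype.card_fin, mul_comm]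

lemma sum_mode {L : ℕ} (g : Mode L → ℝ) : ∑ μ, g μ = ∑ i, ∑ σ, g (toLex (i, σ)) := by
  rw [← Fintype.sum_prod_type' (f := fun i σ => g (toLex (i, σ)))]
  exact (Equiv.sum_comp toLex g).symm

/-- An even ring has equally many sites of each parity, so the average is over the four pairs of
parity and spin, whatever L is. -/
lemma average_mode_parity {L : ℕ} (hL : Even L) (hL0 : 0 < L) (g : ℕ → Fin 2 → ℝ) :
    (1 / (Fintype.card (Mode L) : ℝ)) * ∑ μ : Mode L, g ((ofLex μ).1.val % 2) (ofLex μ).2 =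
      (1 / 4) * ∑ σ, (g 0 σ + g 1 σ) := by
  obtain ⟨m, rfl⟩ := hL
  rw [sum_mode, Finset.sum_comm, card_mode]
  have h1 : ∀ σ, ∑ i : Fin (m + m), g (i.val % 2) σ = m * (g 0 σ + g 1 σ) := fun σ => by
    rw [Fin.sum_univ_eq_sum_range (fun k => g (k % 2) σ) (m + m), sum_range_parity (g := (g · σ))]
  simp only [ofLex_toLex, h1, ← Finset.mul_sum]
  have : (m : ℝ) ≠ 0 := by
    have : m ≠ 0 := by omega
    exact_mod_cast this
  push_cast
  field_simp
  ring

/-- Local costs which depend on the position only through its parity, up to errors, have averages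
that do not depend on the length of the chain, up to the errors. -/
lemma abs_costLHST_sub_le {L : ℕ} (hL : Even L) (hL0 : 0 < L) {U V : FockOp (Mode L)}
    {g : ℕ → Fin 2 → ℝ} {δ : ℝ}
    (h : ∀ i σ, |costLHSTMode (toLex (i, σ)) U V - g (i.val % 2) σ| ≤ δ) :
    |costLHST U V - (1 / 4) * ∑ σ, (g 0 σ + g 1 σ)| ≤ δ := by
  have hc : (0 : ℝ) < Fintype.card (Mode L) := by rw [card_mode]; push_cast; positivity
  rw [costLHST, ← average_mode_parity hL hL0, ← mul_sub, ← Finset.sum_sub_distrib, abs_mul,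
    abs_of_pos (by positivity), one_div, inv_mul_le_iff₀ hc]
  refine (Finset.abs_sum_le_sum_abs _ _).trans
    ((Finset.sum_le_card_nsmul _ _ δ fun μ _ => h (ofLex μ).1 (ofLex μ).2).trans ?_)
  rw [nsmul_eq_mul, Finset.card_univ]

end Average

/-! ### Order of the costs for the evolution and the ansatz -/

section CostOrder

variable {dH d L : ℕ} {h : FPoly (dH + 1)} {τ : ℝ} {G : Fin d → ℝ → FPoly 2}

lemma commute_parity_ansatz (hGe : ∀ k t, G k t ∈ evenPoly 2) (θ : Fin (2 * d) → ℝ) :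
    Commute (parity (Mode L)) (ansatz G θ L) := by
  rw [ansatz_eq]
  refine Commute.list_prod_right _ _ fun x hx => ?_
  obtain ⟨a, ha, rfl⟩ := List.mem_map.1 hx
  exact commute_parity_layer (forall_mem_layers hGe a ha)

lemma costLHST_evolve_ansatz_le_costHST (hev : h ∈ evenPoly (dH + 1))
    (hGe : ∀ k t, G k t ∈ evenPoly 2) (θ : Fin (2 * d) → ℝ) (hL : 0 < L) :
    costLHST (evolve h L τ) (ansatz G θ L) ≤ costHST (evolve h L τ) (ansatz G θ L) := by
  have : Nonempty (Mode L) := ⟨toLex (⟨0, hL⟩, 0)⟩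
  exact costLHST_le_costHST (commute_parity_evolve hev τ) (commute_parity_ansatz hGe θ)

lemma costHST_evolve_ansatz_le (hev : h ∈ evenPoly (dH + 1)) (hsa : IsSelfAdjointPoly h)
    (hGe : ∀ k t, G k t ∈ evenPoly 2) (hGu : ∀ k t, IsUnitaryPoly (n := 1) (G k t))
    (θ : Fin (2 * d) → ℝ) (hLH : dH + 1 ≤ L) (hL : 2 ≤ L) :
    costHST (evolve h L τ) (ansatz G θ L) ≤
      2 * (L : ℝ) * costLHST (evolve h L τ) (ansatz G θ L) := by
  have : Nonempty (Mode L) := ⟨toLex (⟨0, by omega⟩, 0)⟩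
  have hV : ansatz G θ L ∈ unitary (FockOp (Mode L)) := by
    rw [ansatz_eq]
    exact list_map_prod_mem_unitary fun a ha =>
      layer_mem_unitary hL (forall_mem_layers (p := fun x => IsUnitaryPoly (n := 1) x) hGu a ha)
  have hle := costHST_le_card_mul_costLHST (commute_parity_evolve hev τ)
    (commute_parity_ansatz hGe θ) (evolve_mem_unitary hsa hLH τ) hV
  rw [card_mode] at hle
  push_cast at hle
  exact hle

end CostOrder

/-! ### Transfer between the two lengths -/

section Main

variable {dH : ℕ} {h : FPoly (dH + 1)}

/-- Both rings contain the same window, and each average is within 2δ of the same window quantity;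
the two errors add up to the 4 in the bound. -/
theorem exists_costLHST_le (hev : h ∈ evenPoly (dH + 1)) (hsa : IsSelfAdjointPoly h) {v ξ τ : ℝ}
    (hv : 0 ≤ v) (hξ : 0 < ξ) (hτ : 0 ≤ τ) :
    ∃ K : ℝ, 0 < K ∧ ∀ (l₀ : ℝ) (L Lt d : ℕ) (G : Fin d → ℝ → FPoly 2) (θ : Fin (2 * d) → ℝ),
      0 ≤ l₀ → Even L → Even Lt → Lt ≤ L → (∀ k t, G k t ∈ evenPoly 2) →
      (∀ k t, IsUnitaryPoly (n := 1) (G k t)) → l₀ + (dH : ℝ) + v * τ + 2 * (d : ℝ) + 1 ≤ (Lt : ℝ) →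
      costLHST (evolve h L τ) (ansatz G θ L) ≤
        costLHST (evolve h Lt τ) (ansatz G θ Lt) + 4 * (K * Real.exp (-l₀ / ξ)) := by
  obtain ⟨K, hK0, hK⟩ := exists_truncation_bound hev hsa hξ hτ
  -- The exponential pays for the reach dH of the terms and for rounding the half-length of the
  -- chain; the summand 1 makes the constant positive.
  refine ⟨K * Real.exp ((1 + 2 * dH) / ξ) + 1, by positivity, ?_⟩
  intro l₀ L Lt d G θ hl₀ hLe hLte hLL hGe hGu hLt
  have hvτ : 0 ≤ v * τ := mul_nonneg hv hτ
  have hLt1 : dH + 2 * d + 1 ≤ Lt := by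
    have : ((dH + 2 * d + 1 : ℕ) : ℝ) ≤ Lt := by push_cast; linarith
    exact_mod_cast this
  obtain ⟨m, rfl⟩ := hLte
  -- The short chain has 2r + 2 sites, so a window of 2r + 1 fits into it.
  obtain ⟨r, rfl⟩ : ∃ r, m = r + 1 := ⟨m - 1, by omega⟩
  have hdr : d ≤ r := by omega
  -- The truncation radius is R = r − d − dH. The error decays with 2R because the window extends on
  -- both sides, and 2R ≥ l₀ − 1 − 2dH by the assumption on the length.
  set δ := K * Real.exp (-(2 * (((r - d : ℕ) : ℝ) - dH)) / ξ) with hδ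
  have hδle : δ ≤ K * Real.exp ((1 + 2 * dH) / ξ) * Real.exp (-l₀ / ξ) := by
    rw [hδ, mul_assoc, ← Real.exp_add, ← add_div]
    refine mul_le_mul_of_nonneg_left (Real.exp_le_exp.2 ?_) hK0
    refine div_le_div_of_nonneg_right ?_ hξ.le
    rw [Nat.cast_sub hdr]
    push_cast at hLt
    have hd0 : (0 : ℝ) ≤ dH := Nat.cast_nonneg _
    linarith
  set l := layers G θ with hl
  have key : ∀ L' : ℕ, Even L' → r + 1 + (r + 1) ≤ L' →
      |costLHST (evolve h L' τ) (ansatz G θ L') - (1 / 4) * ∑ σ,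
        ((1 - (1 / 2) * ∑ k, (windowOverlap h τ l r d (0 + r) σ k).re) +
          (1 - (1 / 2) * ∑ k, (windowOverlap h τ l r d (1 + r) σ k).re))| ≤ 2 * δ := by
    intro L' hL'e hL'
    rw [ansatz_eq]
    refine abs_costLHST_sub_le (g := fun p σ =>
      1 - (1 / 2) * ∑ k, (windowOverlap h τ l r d (p + r) σ k).re) hL'e (by omega) fun i σ => ?_
    refine abs_costLHSTMode_sub_le hev hsa length_layers (forall_mem_layers hGe)
      (forall_mem_layers (p := fun x => IsUnitaryPoly (n := 1) x) hGu) hdr hL'e (by omega) (by omega)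
      (by omega) i σ fun k S hS => ?_
    exact hK L' (by omega) i _ (modeOp_mem_localAlg (Set.mem_singleton i) σ k) (norm_modeOp_le _ _)
      S _ hS
  have h1 := abs_le.1 (key L hLe hLL)
  have h2 := abs_le.1 (key _ ⟨r + 1, rfl⟩ le_rfl)
  have h3 := Real.exp_pos (-l₀ / ξ)
  have h4 : δ ≤ (K * Real.exp ((1 + 2 * dH) / ξ) + 1) * Real.exp (-l₀ / ξ) := by
    rw [add_mul]; linarith
  linarith [h1.2, h2.1]

end Main

end LVQC

end

theorem theorem1 (dH : ℕ) (h : LVQC.FPoly (dH + 1))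
    (h_even : h ∈ LVQC.evenPoly (dH + 1)) (h_sa : LVQC.IsSelfAdjointPoly h) :
    (∃ C v ξ : ℝ, LVQC.LiebRobinsonBound h (fun _ => C) v ξ) ∧
    ∀ (C : ℝ → ℝ) (v ξ : ℝ), LVQC.LiebRobinsonBound h C v ξ →
      ∀ τ : ℝ, 0 ≤ τ →
        ∃ K : ℝ, 0 < K ∧
          ∀ (l₀ : ℝ) (L Lt d : ℕ) (G : Fin d → ℝ → LVQC.FPoly 2) (θ_opt : Fin (2 * d) → ℝ),
            0 ≤ l₀ → Even L → Even Lt → Lt ≤ L →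
            (∀ k t, G k t ∈ LVQC.evenPoly 2) → (∀ k t, LVQC.IsUnitaryPoly (G k t)) →
            l₀ + (dH : ℝ) + v * τ + 2 * (d : ℝ) + 1 ≤ (Lt : ℝ) →
            (∀ ε_LHST : ℝ, 0 < ε_LHST →
              LVQC.costLHST (LVQC.evolve h Lt τ) (LVQC.ansatz G θ_opt Lt) < ε_LHST →
              LVQC.costLHST (LVQC.evolve h L τ) (LVQC.ansatz G θ_opt L)
                ≤ ε_LHST + 4 * (K * Real.exp (-l₀ / ξ))) ∧
            (∀ ε_HST : ℝ, 0 < ε_HST →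
              LVQC.costHST (LVQC.evolve h Lt τ) (LVQC.ansatz G θ_opt Lt) < ε_HST →
              LVQC.costHST (LVQC.evolve h L τ) (LVQC.ansatz G θ_opt L)
                ≤ 2 * (L : ℝ) * (ε_HST + 4 * (K * Real.exp (-l₀ / ξ)))) := by
  refine ⟨LVQC.exists_liebRobinsonBound h_even h_sa, fun C v ξ hLR τ hτ => ?_⟩
  obtain ⟨K, hK, hb⟩ := LVQC.exists_costLHST_le h_even h_sa hLR.1 hLR.2.1 hτ
  refine ⟨K, hK, fun l₀ L Lt d G θ_opt hl₀ hLe hLte hLL hGe hGu hLt => ?_⟩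
  have hle := hb l₀ L Lt d G θ_opt hl₀ hLe hLte hLL hGe hGu hLt
  refine ⟨fun ε _ hε => by linarith, fun ε _ hε => ?_⟩
  have hvτ : 0 ≤ v * τ := mul_nonneg hLR.1 hτ
  have hLt1 : dH + 1 ≤ Lt := by
    have hd : (0 : ℝ) ≤ d := Nat.cast_nonneg d
    have : ((dH + 1 : ℕ) : ℝ) ≤ Lt := by push_cast; linarith
    exact_mod_cast this
  have hLt2 : 2 ≤ Lt := by
    obtain ⟨m, rfl⟩ := hLte
    omega
  -- The global cost passes to the local one on the short chain, then to the long chain, and returns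
  -- to the global one there at the price of the 2L modes.
  have h1 := LVQC.costLHST_evolve_ansatz_le_costHST h_even (τ := τ) hGe θ_opt (by omega : 0 < Lt)
  have h2 := LVQC.costHST_evolve_ansatz_le h_even h_sa (τ := τ) hGe hGu θ_opt (hLt1.trans hLL)
    (hLt2.trans hLL)
  refine h2.trans (mul_le_mul_of_nonneg_left ?_ (by positivity))
  linarith
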